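/- **Setup.** Let $n>2$. A (type II) triangulation of the sphere may have multiple edges but no loops. Let $T$ be a uniformly random rooted triangulation of the sphere with $n$ vertices; it has $2(n-2)$ triangles and $3(n-2)$ edges. Choose an edge $e_1$ of $T$ uniformly at random and open it into a 2-gon $f_1$ (the *source*); then choose an edge $e_2$ uniformly among the $3(n-2)+1$ edges of the resulting map (the two sides of $f_1$ count as two edges) and open it into a second 2-gon $f_2$ (the *target*). *Explorations.* An exploration starts with $f_1$ explored and enters one unexplored face per step. After $k$ steps let $R_k$ be the component containing $f_2$ of the unexplored region (faces being adjacent when they share an edge), let $C_k$ be its boundary cycle, of length $M_k+2$, and let $N_k$ be the number of vertices in the interior of $R_k$. In step $k+1$ the face of $R_k$ incident to a *seed* edge of $C_k$ is entered. If this face is $f_2$, the exploration stops, and $\tau:=k$ is the number of triangles explored; otherwise the face is a triangle. A component that is separated from $f_2$ in a step and contains at least one triangle is a *bubble*, and is not explored further. The *necklace* $D_k$ ($1\le k\le\tau$) is the union of the cycles $C_{k-1}$ and $C_k$ with the triangle and the bubble (if any) added in step $k$, viewed as a planar map with an inner boundary $C_{k-1}$ and an outer boundary $C_k$, up to orientation-preserving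 isomorphism. - *Eden exploration:* given the past, each seed is uniform among the $M_k+2$ edges of $C_k$. - *Percolation exploration:* fix, for every map with source and target, a non-self-intersecting path $p$ of the dual map from $f_1$ to $f_2$, and colour the vertices red or blue by independent fair coins. There is then a unique non-self-intersecting path of the dual map from $f_1$ to $f_2$ such that each edge it crosses either has endpoints of opposite colours and does not cross $p$, or has endpoints of the same colour and crosses $p$. The exploration follows this path (the percolation interface): its seeds are the edges that the path crosses. **Proposition.** For every choice of the paths $p$, the following are the same for the Eden exploration and for the percolation exploration: 1. the law of the chain $(M_k,N_k)_{0\le k\le\tau}$, which terminates when the target 2-gon is reached; 2. the law of the total number of triangles observed before the target is reached, both when one counts only the triangles explored one by one and when one also counts the triangles in the bubbles; 3. the law of the sequence $(D_1,\dots,D_\tau)$ of necklaces. Moreover, the Eden exploration is obtained by randomly rotating the necklaces of the percolation exploration: cut the map of the percolation exploration along $C_0,\dots,C_\tau$ into $f_1$, $D_1,\dots,D_\tau$ and the final region $R_\tau$ (which contains $f_2$), and reglue consecutive pieces along each $C_k$ after a rotation chosen uniformly among the $M_k+2$ possible ones, independently for all $k$. Then the resulting map, with the same faces entered in the same order through the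 same sides, has exactly the joint law of the random map and its Eden exploration. -/

import Mathlib

open Equiv

/-! ### Combinatorial maps -/

/-- A combinatorial map on a set `D` of darts (oriented edges). Every dart lies on the boundary of
the face on its left; `face` sends a dart to the next dart along the boundary of that face, and
`edge` sends a dart to the same edge with the opposite orientation. -/
@[ext]
structure CombMap (D : Type) where
  face : Perm D
  edge : Perm D

namespace CombMap

section basic

variable {D : Type} (M : CombMap D)

/-- The rotation about the origin of a dart: its cycles are the vertices. -/
def rot : Perm D := M.face * M.edge

/-- The vertices of the map. -/
abbrev Vertex : Type := Quotient (Perm.SameCycle.setoid M.rot)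

/-- The (unoriented) edges of the map. -/
abbrev Edge : Type := Quotient (Perm.SameCycle.setoid M.edge)

/-- The faces of the map. -/
abbrev Face : Type := Quotient (Perm.SameCycle.setoid M.face)

/-- The origin of a dart. -/
def origin (d : D) : M.Vertex := Quotient.mk _ d

/-- The face on the left of a dart. -/
def faceOf (d : D) : M.Face := Quotient.mk _ d

/-- A type II triangulation of the sphere: a connected map of Euler characteristic `2` all of whose
faces are triangles and none of whose edges is a loop (multiple edges are allowed). -/
structure IsSphereTriangulation : Prop where
  edge_ne : ∀ d, M.edge d ≠ d
  edge_edge : ∀ d, M.edge (M.edge d) = d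
  face_ne : ∀ d, M.face d ≠ d
  face_face_face : ∀ d, M.face (M.face (M.face d)) = d
  connected : ∀ d d' : D, ∃ g ∈ Subgroup.closure {M.face, M.edge}, g d = d'
  euler : (Nat.card M.Vertex : ℤ) - Nat.card M.Edge + Nat.card M.Face = 2
  loopless : ∀ d, M.origin d ≠ M.origin (M.edge d)

open Classical in
/-- Fatten the edge carrying `d` into a 2-gon. The two new darts `Sum.inr false`, `Sum.inr true`
bound the 2-gon; `Sum.inr false` becomes opposite to `d`, and `Sum.inr true` becomes opposite to the
former opposite of `d`. -/
noncomputable def fatten (d : D) : CombMap (D ⊕ Bool) where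
  face := Perm.sumCongr M.face Equiv.boolNot
  edge :=
    swap (Sum.inl (M.edge d)) (Sum.inr false) * Perm.sumCongr M.edge Equiv.boolNot *
      swap (Sum.inl (M.edge d)) (Sum.inr false)

/-- Cut all edges open and glue them again after the darts have been moved by `r`. -/
def reglue (r : Perm D) : CombMap D where
  face := M.face
  edge := r * M.edge * r⁻¹

end basic

/-! ### Explorations

In this section `a` is a dart of the source face, `b` is a dart of the target face, and `γ` is the
list of darts through which the explored faces are entered: the `k`-th dart of `γ` lies on the face
that is entered in step `k`, and its opposite lies on the side from which that face is entered. -/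

section exploration

variable {D : Type} (M : CombMap D) (a b : D) (γ : List D)

/-- `γ` crosses the successive edges of a non-self-intersecting path of faces from the source face
to the target face. -/
def IsDualPath : Prop :=
  (a :: γ).IsChain (fun s s' => M.faceOf (M.edge s') = M.faceOf s) ∧
  ((a :: γ).map M.faceOf).Nodup ∧
  M.faceOf ((a :: γ).getLast (List.cons_ne_nil a γ)) = M.faceOf b

/-- The darts of the explored faces: the source face and the faces of the darts in `γ`. -/
def explored : Set D := {d | ∃ s ∈ a :: γ, M.faceOf d = M.faceOf s}

/-- The darts of the faces in the component of the unexplored region that contains the target: those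
that can be reached from the target by moving around faces and across edges, without entering an
explored face. -/
def region : Set D :=
  {d | Relation.ReflTransGen
    (fun x y => (y = M.face x ∨ y = M.edge x) ∧ y ∉ M.explored a γ) b d}

/-- The darts on the boundary of a union `R` of faces (having `R` on their left). -/
def bdry (R : Set D) : Set D := {d | d ∈ R ∧ M.edge d ∉ R}

/-- The vertices in the interior of a union `R` of faces. -/
def interiorVertices (R : Set D) : Set M.Vertex := {v | ∀ d, M.origin d = v → d ∈ R}

/-- The pair `(m, n)`: the boundary of the region has length `m + 2`, and `n` is the number of
vertices in its interior. -/
noncomputable def size (R : Set D) : ℤ × ℕ :=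
  ((M.bdry R).ncard - 2, (M.interiorVertices R).ncard)

/-- The region `R_k` which is left after `k` steps. -/
def regionAt (k : ℕ) : Set D := M.region a b (γ.take k)

/-- The sequence `(M_k, N_k)`, `0 ≤ k ≤ τ`, where the face entered through the last dart of `γ`, in
step `τ + 1`, is the target. -/
noncomputable def sizes : List (ℤ × ℕ) :=
  (List.range γ.length).map fun k => M.size (M.regionAt a b γ k)

/-- The number `τ` of triangles explored, one per step, before the target is reached. -/
def numExplored : ℕ := γ.length - 1

/-- The number of triangles which do not lie in the unexplored region containing the target when
the target is reached, that is, explored triangles together with the triangles in bubbles. -/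
noncomputable def numSwallowed : ℕ :=
  {f : M.Face | f ≠ M.faceOf a ∧
    ∀ d, M.faceOf d = f → d ∉ M.regionAt a b γ (γ.length - 1)}.ncard

/-- The Eden exploration continued from the seeds `γ`, for at most the given number of steps: as
long as the target has not been reached, the next face is entered through a uniformly random edge
of the boundary of the unexplored region containing the target. -/
noncomputable def edenSteps [Fintype D] : ℕ → List D → PMF (List D)
  | 0, γ => PMF.pure γ
  | k + 1, γ =>
    open Classical in
    if h : (M.bdry (M.region a b γ)).toFinset.Nonempty then
      (PMF.uniformOfFinset (M.bdry (M.region a b γ)).toFinset h).bind fun s =>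
        if M.faceOf s = M.faceOf b then PMF.pure (γ ++ [s]) else edenSteps k (γ ++ [s])
    else PMF.pure γ

/-- The Eden exploration, run until it reaches the target. Each step enters a new face, so the
number of darts is a sufficient number of steps. -/
noncomputable def eden [Fintype D] : PMF (List D) := M.edenSteps a b (Fintype.card D) []

/-- The edge of `d` is crossed by the path `p`. -/
def Crosses (p : List D) (d : D) : Prop := d ∈ p ∨ M.edge d ∈ p

/-- `γ` is a percolation interface for the colouring `c` and the reference path `p`: a dual path
from source to target such that each edge it crosses either has endpoints of opposite colours and
does not cross `p`, or has endpoints of the same colour and crosses `p`. -/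
def IsInterface (p : List D) (c : M.Vertex → Bool) : Prop :=
  M.IsDualPath a b γ ∧ ∀ s ∈ γ,
    (c (M.origin s) ≠ c (M.origin (M.edge s)) ∧ ¬ M.Crosses p s) ∨
    (c (M.origin s) = c (M.origin (M.edge s)) ∧ M.Crosses p s)

open Classical in
/-- The percolation interface. -/
noncomputable def interface (p : List D) (c : M.Vertex → Bool) : List D :=
  if h : ∃ γ, M.IsInterface a b γ p c then h.choose else []

open Classical in
/-- The law of the percolation interface when the vertices are coloured by independent fair
coins. -/
noncomputable def percolation [Finite D] (p : List D) : PMF (List D) :=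
  haveI : Fintype (M.Vertex → Bool) := Fintype.ofFinite _
  (PMF.uniformOfFintype (M.Vertex → Bool)).map (M.interface a b p)

end exploration

end CombMap

/-! ### Rotations of boundary cycles -/

section firstReturn

variable {D : Type} [Finite D]

open Classical in
/-- The first return map to `S` of the permutation `π`, extended by the identity. -/
noncomputable def firstReturnFun (π : Perm D) (S : Set D) (d : D) : D :=
  if d ∈ S then (π ^ sInf {j : ℕ | 0 < j ∧ (π ^ j) d ∈ S}) d else d

theorem firstReturnFun_spec (π : Perm D) {S : Set D} {d : D} (hd : d ∈ S) :
    ∃ j : ℕ, 0 < j ∧ (π ^ j) d ∈ S ∧ firstReturnFun π S d = (π ^ j) d ∧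
      ∀ i : ℕ, 0 < i → i < j → (π ^ i) d ∉ S := by
  have hne : {j : ℕ | 0 < j ∧ (π ^ j) d ∈ S}.Nonempty :=
    ⟨orderOf π, orderOf_pos π, by simpa [pow_orderOf_eq_one] using hd⟩
  have hm := Nat.sInf_mem hne
  refine ⟨_, hm.1, hm.2, by simp [firstReturnFun, hd], fun i hi hij hiS => ?_⟩
  exact absurd (Nat.sInf_le (show i ∈ {j : ℕ | 0 < j ∧ (π ^ j) d ∈ S} from ⟨hi, hiS⟩))
    (not_le.2 hij)

theorem firstReturnFun_injective (π : Perm D) (S : Set D) :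
    Function.Injective (firstReturnFun π S) := by
  have key : ∀ (x y : D) (j k : ℕ), j ≤ k → x ∈ S → 0 < j → (π ^ j) x = (π ^ k) y →
      (∀ i : ℕ, 0 < i → i < k → (π ^ i) y ∉ S) → x = y := by
    intro x y j k hjk hx hj h hmin
    have hxy : x = (π ^ (k - j)) y := by
      apply (π ^ j).injective
      rw [h, ← Perm.mul_apply, ← pow_add, Nat.add_sub_cancel' hjk]
    rcases Nat.eq_zero_or_pos (k - j) with h0 | h0
    · simpa [h0] using hxy
    · exact absurd (hxy ▸ hx) (hmin _ h0 (by omega))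
  intro x y hxy
  by_cases hx : x ∈ S <;> by_cases hy : y ∈ S
  · obtain ⟨j, hj, -, ej, mj⟩ := firstReturnFun_spec π hx
    obtain ⟨k, hk, -, ek, mk⟩ := firstReturnFun_spec π hy
    rw [ej, ek] at hxy
    rcases le_total j k with hjk | hjk
    · exact key x y j k hjk hx hj hxy mk
    · exact (key y x k j hjk hy hk hxy.symm mj).symm
  · obtain ⟨j, -, hS, ej, -⟩ := firstReturnFun_spec π hx
    have : firstReturnFun π S y = y := by simp [firstReturnFun, hy]
    rw [ej, this] at hxy
    exact absurd (hxy ▸ hS) hy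
  · obtain ⟨j, -, hS, ej, -⟩ := firstReturnFun_spec π hy
    have : firstReturnFun π S x = x := by simp [firstReturnFun, hx]
    rw [ej, this] at hxy
    exact absurd (hxy ▸ hS) hx
  · simpa [firstReturnFun, hx, hy] using hxy

/-- The first return map, as a permutation. -/
noncomputable def firstReturn (π : Perm D) (S : Set D) : Perm D :=
  Equiv.ofBijective (firstReturnFun π S)
    (Finite.injective_iff_bijective.1 (firstReturnFun_injective π S))

end firstReturn

namespace CombMap

section rotation

variable {D : Type} (M : CombMap D)

open Classical in
/-- Cross the edge of `d` if it lies in the interior of `R`, and stay at `d` otherwise. -/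
noncomputable def innerCross (R : Set D) (d : D) : D :=
  if d ∈ R ∧ M.edge d ∈ R ∧ M.edge (M.edge d) = d then M.edge d else d

theorem innerCross_involutive (R : Set D) : Function.Involutive (M.innerCross R) := by
  intro d
  by_cases h : d ∈ R ∧ M.edge d ∈ R ∧ M.edge (M.edge d) = d
  · have h1 : M.innerCross R d = M.edge d := if_pos h
    have h2 : M.edge d ∈ R ∧ M.edge (M.edge d) ∈ R ∧ M.edge (M.edge (M.edge d)) = M.edge d :=
      ⟨h.2.1, by rw [h.2.2]; exact h.1, by rw [h.2.2]⟩
    rw [h1, innerCross, if_pos h2, h.2.2]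
  · have h1 : M.innerCross R d = d := if_neg h
    rw [h1, h1]

/-- The next dart along the boundary of `R`: go to the next dart of the face, and turn about its
origin inside `R` until the boundary of `R` is hit. It fixes the darts off the boundary. -/
noncomputable def nextBdry [Finite D] (R : Set D) : Perm D :=
  firstReturn (M.face * (M.innerCross_involutive R).toPerm) (M.bdry R)

variable (a b : D) (γ : List D)

open Classical in
/-- The composition of independent uniformly random rotations of the boundary cycles
`C_0, …, C_{k-1}` of the regions `R_0, …, R_{k-1}`. The rotations of a cycle are the powers of the
permutation that moves every dart of the cycle to the next one. -/
noncomputable def randomRotation [Finite D] : ℕ → PMF (Perm D)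
  | 0 => PMF.pure 1
  | k + 1 =>
    haveI : Fintype (Subgroup.zpowers (M.nextBdry (M.regionAt a b γ k))) := Fintype.ofFinite _
    (randomRotation k).bind fun r =>
      (PMF.uniformOfFintype (Subgroup.zpowers (M.nextBdry (M.regionAt a b γ k)))).map
        fun u => (u : Perm D) * r

/-- Cut the map along the boundary cycles `C_0, …, C_τ` into the source, the necklaces and the final
unexplored region; rotate these pieces with respect to each other, independently and uniformly
(everything inside `C_k` being turned along `C_k`); and glue them again along the cycles. -/
noncomputable def rotateNecklaces [Finite D] : PMF (CombMap D) :=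
  (M.randomRotation a b γ γ.length).map M.reglue

end rotation

end CombMap

/-! ### Necklaces -/

/-- A labelled necklace: a map whose darts are labelled by a subset of `D`, with two distinguished
boundary components. Only the values of `edge` and `face` on `darts` matter; `inner` and `outer` are
the darts (of the two boundary cycles) that have the source side hole, respectively the target side
hole, on their left. -/
structure Necklace (D : Type) where
  darts : Set D
  inner : Set D
  outer : Set D
  edge : D → D
  face : D → D

namespace Necklace

variable {D : Type}

/-- Isomorphism of necklaces (preserving orientation and the two boundary components). -/
def Iso (K L : Necklace D) : Prop :=
  ∃ f : Perm D, (∀ d, f d ∈ L.darts ↔ d ∈ K.darts) ∧ (∀ d, f d ∈ L.inner ↔ d ∈ K.inner) ∧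
    (∀ d, f d ∈ L.outer ↔ d ∈ K.outer) ∧
    ∀ d ∈ K.darts, L.edge (f d) = f (K.edge d) ∧ L.face (f d) = f (K.face d)

theorem iso_equivalence : Equivalence (Iso (D := D)) where
  refl K := ⟨1, by simp⟩
  symm := by
    rintro K L ⟨f, h1, h2, h3, h4⟩
    refine ⟨f⁻¹, fun d => ?_, fun d => ?_, fun d => ?_, fun d hd => ?_⟩
    · simpa using (h1 (f⁻¹ d)).symm
    · simpa using (h2 (f⁻¹ d)).symm
    · simpa using (h3 (f⁻¹ d)).symm
    · have hd' : f⁻¹ d ∈ K.darts := by simpa using (h1 (f⁻¹ d)).symm.2 (by simpa using hd)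
      have h := h4 _ hd'
      have hf : f (f⁻¹ d) = d := f.apply_symm_apply d
      rw [hf] at h
      rw [h.1, h.2]
      exact ⟨(f.symm_apply_apply _).symm, (f.symm_apply_apply _).symm⟩
  trans := by
    rintro K L N ⟨f, h1, h2, h3, h4⟩ ⟨g, k1, k2, k3, k4⟩
    refine ⟨g * f, fun d => ?_, fun d => ?_, fun d => ?_, fun d hd => ?_⟩
    · rw [Perm.mul_apply, k1, h1]
    · rw [Perm.mul_apply, k2, h2]
    · rw [Perm.mul_apply, k3, h3]
    · have h := h4 d hd
      have k := k4 (f d) ((h1 d).2 hd)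
      simp only [Perm.mul_apply]
      rw [k.1, k.2, h.1, h.2]
      exact ⟨rfl, rfl⟩

instance setoid (D : Type) : Setoid (Necklace D) := ⟨Iso, iso_equivalence⟩

end Necklace

/-- Unlabelled necklaces. -/
abbrev NecklaceClass (D : Type) : Type := Quotient (Necklace.setoid D)

namespace CombMap

section necklaces

variable {D : Type} [Finite D] (M : CombMap D) (a b : D) (γ : List D)

open Classical in
/-- The part of the map between the boundary of a region `R` and the boundary of a smaller region
`R'`, both boundaries included: all faces of `R` outside `R'`, the hole bounded by the boundary of
`R` (on the side not in `R`), and the hole bounded by the boundary of `R'` (on the side of `R'`). -/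
noncomputable def between (R R' : Set D) : Necklace D where
  darts := (R \ R') ∪ {d | M.edge d ∈ M.bdry R} ∪ M.bdry R'
  inner := {d | M.edge d ∈ M.bdry R}
  outer := M.bdry R'
  edge := M.edge
  face := fun d =>
    if d ∈ M.bdry R' then M.nextBdry R' d
    else if M.edge d ∈ M.bdry R then M.edge ((M.nextBdry R)⁻¹ (M.edge d))
    else M.face d

/-- The sequence of necklaces `D_1, …, D_τ`, where `D_k` consists of the cycles `C_{k-1}` and `C_k`
and of the triangle and the bubble (if there is one) added in step `k`. -/
noncomputable def necklaces : List (NecklaceClass D) :=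
  (List.range (γ.length - 1)).map fun k =>
    Quotient.mk _ (M.between (M.regionAt a b γ k) (M.regionAt a b γ (k + 1)))

end necklaces

end CombMap

/-! ### The random triangulation with its two distinguished edges -/

/-- A triangulation of the sphere with `n` vertices (its `6 (n - 2)` darts being labelled), a
distinguished edge `e₁`, and a distinguished edge `e₂` of the map in which `e₁` has been fattened
into a 2-gon. (Both edges are given by one of their two darts.) -/
@[ext]
structure MarkedTriangulation (n : ℕ) where
  map : CombMap (Fin (6 * (n - 2)))
  isSphere : map.IsSphereTriangulation
  card_vertex : Nat.card map.Vertex = n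
  e₁ : Fin (6 * (n - 2))
  e₂ : Fin (6 * (n - 2)) ⊕ Bool

/-- The darts after both distinguished edges have been fattened into 2-gons. -/
abbrev FatDart (n : ℕ) : Type := (Fin (6 * (n - 2)) ⊕ Bool) ⊕ Bool

/-- A dart of the source 2-gon. -/
def source (n : ℕ) : FatDart n := Sum.inl (Sum.inr false)

/-- A dart of the target 2-gon. -/
def target (n : ℕ) : FatDart n := Sum.inr false

namespace MarkedTriangulation

variable {n : ℕ}

/-- The map in which both distinguished edges have been fattened into 2-gons. -/
noncomputable def fat (ω : MarkedTriangulation n) : CombMap (FatDart n) :=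
  (ω.map.fatten ω.e₁).fatten ω.e₂

instance : Finite (MarkedTriangulation n) := by
  apply Finite.of_injective
    (β := Perm (Fin (6 * (n - 2))) × Perm (Fin (6 * (n - 2))) × Fin (6 * (n - 2)) ×
      (Fin (6 * (n - 2)) ⊕ Bool))
    (fun ω => (ω.map.face, ω.map.edge, ω.e₁, ω.e₂))
  intro ω ω' h
  simp only [Prod.mk.injEq] at h
  exact MarkedTriangulation.ext (CombMap.ext h.1 h.2.1) h.2.2.1 h.2.2.2

end MarkedTriangulation


/-! ### Existence of triangulations -/

section existence

/-- Number of cycles of a permutation from a labelling of the cycles. -/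
theorem card_cycles {D L : Type} (π : Perm D) (l : D → L) (hl : Function.Surjective l)
    (h1 : ∀ d, l (π d) = l d) (h2 : ∀ d d', l d = l d' → π.SameCycle d d') :
    Nat.card (Quotient (Perm.SameCycle.setoid π)) = Nat.card L := by
  have hpow : ∀ (k : ℕ) d, l ((π ^ k) d) = l d := by
    intro k
    induction k with
    | zero => intro d; simp
    | succ k ih => intro d; rw [pow_succ', Perm.mul_apply, h1, ih]
  have h3 : ∀ d d', π.SameCycle d d' → l d = l d' := by
    rintro d d' ⟨i, hi⟩
    cases i with
    | ofNat i =>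
      rw [← hi]
      exact (hpow i d).symm
    | negSucc i =>
      have : (π ^ (i + 1)) d' = d := by
        rw [← hi, zpow_negSucc]
        exact (π ^ (i + 1)).apply_symm_apply d
      rw [← this, hpow]
  refine Nat.card_congr (Equiv.ofBijective (Quotient.lift l h3) ⟨?_, ?_⟩)
  · rintro ⟨d⟩ ⟨d'⟩ h
    exact Quotient.sound (h2 d d' h)
  · intro x
    obtain ⟨d, rfl⟩ := hl x
    exact ⟨Quotient.mk _ d, rfl⟩

/-- Transport of a map along a relabelling of its darts. -/
def CombMap.relabel {D D' : Type} (f : D ≃ D') (M : CombMap D) : CombMap D' :=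
  ⟨f.permCongr M.face, f.permCongr M.edge⟩

/-- `k + 1` digons with common poles, each triangulated with one inner vertex, glued cyclically. -/
def digonFace (k : ℕ) : Perm (Fin (k + 1) × Fin 6) where
  toFun d := (d.1, ![1, 2, 0, 4, 5, 3] d.2)
  invFun d := (d.1, ![2, 0, 1, 5, 3, 4] d.2)
  left_inv := by rintro ⟨i, j⟩; fin_cases j <;> rfl
  right_inv := by rintro ⟨i, j⟩; fin_cases j <;> rfl

def digonEdgeFun (k : ℕ) (d : Fin (k + 1) × Fin 6) : Fin (k + 1) × Fin 6 :=
  (![d.1 + 1, d.1, d.1, d.1 - 1, d.1, d.1] d.2, ![3, 5, 4, 0, 2, 1] d.2)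

theorem digonEdgeFun_involutive (k : ℕ) : Function.Involutive (digonEdgeFun k) := by
  rintro ⟨i, j⟩; fin_cases j <;> simp [digonEdgeFun]

def digonMap (k : ℕ) : CombMap (Fin (k + 1) × Fin 6) :=
  ⟨digonFace k, (digonEdgeFun_involutive k).toPerm⟩

def digonVertex (k : ℕ) (d : Fin (k + 1) × Fin 6) : Option (Option (Fin (k + 1))) :=
  ![none, some none, some (some d.1), some none, none, some (some d.1)] d.2

def digonEdgeLabel (k : ℕ) (d : Fin (k + 1) × Fin 6) : Fin (k + 1) × Fin 3 :=
  (![d.1, d.1, d.1, d.1 - 1, d.1, d.1] d.2, ![0, 1, 2, 0, 2, 1] d.2)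

def digonFaceLabel (k : ℕ) (d : Fin (k + 1) × Fin 6) : Fin (k + 1) × Fin 2 :=
  (d.1, ![0, 0, 0, 1, 1, 1] d.2)

theorem digonMap_pole (k : ℕ) (i : Fin (k + 1)) :
    (digonMap k).rot.SameCycle (0, 0) (i, 0) ∧ (digonMap k).rot.SameCycle (0, 3) (i, 3) := by
  have step : ∀ i : Fin (k + 1), (digonMap k).rot.SameCycle (i, 0) (i + 1, 0) ∧
      (digonMap k).rot.SameCycle (i + 1, 3) (i, 3) := by
    intro i
    constructor
    · refine ⟨2, ?_⟩
      have h : (digonMap k).rot ((digonMap k).rot (i, 0)) = (i + 1, 0) := by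
        simp [CombMap.rot, digonMap, digonFace, digonEdgeFun]
      exact h
    · refine ⟨2, ?_⟩
      have h : (digonMap k).rot ((digonMap k).rot (i + 1, 3)) = (i, 3) := by
        simp [CombMap.rot, digonMap, digonFace, digonEdgeFun]
      exact h
  induction i using Fin.induction with
  | zero => exact ⟨Perm.SameCycle.refl _ _, Perm.SameCycle.refl _ _⟩
  | succ i ih =>
    have h := step i.castSucc
    rw [Fin.coeSucc_eq_succ] at h
    exact ⟨ih.1.trans h.1, ih.2.trans h.2.symm⟩

theorem digonMap_card (k : ℕ) : Nat.card (digonMap k).Vertex = k + 3 ∧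
    Nat.card (digonMap k).Edge = (k + 1) * 3 ∧ Nat.card (digonMap k).Face = (k + 1) * 2 := by
  have rotA : ∀ i, (digonMap k).rot.SameCycle (0, 0) (i, 4) := by
    intro i
    refine (digonMap_pole k i).1.trans (Perm.SameCycle.symm ⟨1, ?_⟩)
    simp [CombMap.rot, digonMap, digonFace, digonEdgeFun]
  have rotB : ∀ i, (digonMap k).rot.SameCycle (0, 3) (i, 1) := by
    intro i
    refine (digonMap_pole k i).2.trans (Perm.SameCycle.symm ⟨1, ?_⟩)
    simp [CombMap.rot, digonMap, digonFace, digonEdgeFun]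
  have rotV : ∀ i, (digonMap k).rot.SameCycle (i, 2) (i, 5) := by
    intro i
    refine ⟨1, ?_⟩
    simp [CombMap.rot, digonMap, digonFace, digonEdgeFun]
  refine ⟨?_, ?_, ?_⟩
  · rw [card_cycles (digonMap k).rot (digonVertex k)]
    · simp
    · rintro (_ | _ | i)
      · exact ⟨(0, 0), rfl⟩
      · exact ⟨(0, 3), rfl⟩
      · exact ⟨(i, 2), rfl⟩
    · rintro ⟨i, j⟩
      fin_cases j <;> simp [CombMap.rot, digonMap, digonFace, digonEdgeFun, digonVertex]
    · have hA : ∀ d, digonVertex k d = none → (digonMap k).rot.SameCycle (0, 0) d := by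
        rintro ⟨i, j⟩ h
        fin_cases j <;> simp [digonVertex] at h
        · exact (digonMap_pole k i).1
        · exact rotA i
      have hB : ∀ d, digonVertex k d = some none → (digonMap k).rot.SameCycle (0, 3) d := by
        rintro ⟨i, j⟩ h
        fin_cases j <;> simp [digonVertex] at h
        · exact rotB i
        · exact (digonMap_pole k i).2
      have hV : ∀ v d, digonVertex k d = some (some v) →
          (digonMap k).rot.SameCycle (v, 2) d := by
        rintro v ⟨i, j⟩ h
        fin_cases j <;> simp [digonVertex] at h
        · subst h; exact Perm.SameCycle.refl _ _
        · subst h; exact rotV i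
      intro d d' h
      rcases hd : digonVertex k d with _ | _ | v
      · exact (hA d hd).symm.trans (hA d' (h ▸ hd))
      · exact (hB d hd).symm.trans (hB d' (h ▸ hd))
      · exact (hV v d hd).symm.trans (hV v d' (h ▸ hd))
  · rw [card_cycles (digonMap k).edge (digonEdgeLabel k)]
    · simp
    · rintro ⟨i, j⟩
      fin_cases j
      · exact ⟨(i, 0), rfl⟩
      · exact ⟨(i, 1), rfl⟩
      · exact ⟨(i, 2), rfl⟩
    · rintro ⟨i, j⟩
      fin_cases j <;> simp [digonMap, digonEdgeFun, digonEdgeLabel]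
    · have h0 : ∀ v d, digonEdgeLabel k d = v →
          (digonMap k).edge.SameCycle (v.1, ![0, 1, 2] v.2) d := by
        rintro v ⟨i, j⟩ rfl
        fin_cases j
        · exact Perm.SameCycle.refl _ _
        · exact Perm.SameCycle.refl _ _
        · exact Perm.SameCycle.refl _ _
        · exact ⟨1, by simp [digonMap, digonEdgeFun, digonEdgeLabel]⟩
        · exact ⟨1, by simp [digonMap, digonEdgeFun, digonEdgeLabel]⟩
        · exact ⟨1, by simp [digonMap, digonEdgeFun, digonEdgeLabel]⟩
      exact fun d d' h => (h0 _ d h).symm.trans (h0 _ d' rfl)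
  · rw [card_cycles (digonMap k).face (digonFaceLabel k)]
    · simp
    · rintro ⟨i, j⟩
      fin_cases j
      · exact ⟨(i, 0), rfl⟩
      · exact ⟨(i, 3), rfl⟩
    · rintro ⟨i, j⟩
      fin_cases j <;> simp [digonMap, digonFace, digonFaceLabel]
    · have h0 : ∀ v d, digonFaceLabel k d = v →
          (digonMap k).face.SameCycle (v.1, ![0, 3] v.2) d := by
        rintro v ⟨i, j⟩ rfl
        fin_cases j
        · exact Perm.SameCycle.refl _ _
        · exact ⟨1, by simp [digonMap, digonFace, digonFaceLabel]⟩
        · exact ⟨2, rfl⟩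
        · exact Perm.SameCycle.refl _ _
        · exact ⟨1, by simp [digonMap, digonFace, digonFaceLabel]⟩
        · exact ⟨2, rfl⟩
      exact fun d d' h => (h0 _ d h).symm.trans (h0 _ d' rfl)

theorem digonMap_isSphere (k : ℕ) : (digonMap k).IsSphereTriangulation where
  edge_ne := by
    rintro ⟨i, j⟩
    fin_cases j <;> simp [digonMap, digonEdgeFun]
  edge_edge := digonEdgeFun_involutive k
  face_ne := by
    rintro ⟨i, j⟩
    fin_cases j <;> simp [digonMap, digonFace]
  face_face_face := by
    rintro ⟨i, j⟩
    fin_cases j <;> rfl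
  connected := by
    set G := Subgroup.closure {(digonMap k).face, (digonMap k).edge} with hG
    have hf : (digonMap k).face ∈ G := Subgroup.subset_closure (by simp)
    have he : (digonMap k).edge ∈ G := Subgroup.subset_closure (by simp)
    have hr : (digonMap k).rot ∈ G := G.mul_mem hf he
    have base : ∀ d, ∃ g ∈ G, g (0, 0) = d := by
      have h0 : ∀ i, ∃ g ∈ G, g (0, 0) = (i, (0 : Fin 6)) := by
        intro i
        obtain ⟨z, hz⟩ := (digonMap_pole k i).1
        exact ⟨_, G.zpow_mem hr z, hz⟩
      have mul : ∀ g ∈ G, ∀ d d', (∃ h ∈ G, h (0, 0) = d) → g d = d' → ∃ h ∈ G, h (0, 0) = d' := by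
        rintro g hg d d' ⟨h, hh, rfl⟩ rfl
        exact ⟨g * h, G.mul_mem hg hh, rfl⟩
      have h1 := fun i => mul _ hf (i, 0) (i, 1) (h0 i) rfl
      have h2 := fun i => mul _ hf (i, 1) (i, 2) (h1 i) rfl
      have h4 := fun i => mul _ he (i, 2) (i, 4) (h2 i) rfl
      have h5 := fun i => mul _ hf (i, 4) (i, 5) (h4 i) rfl
      have h3 := fun i => mul _ hf (i, 5) (i, 3) (h5 i) rfl
      rintro ⟨i, j⟩
      fin_cases j
      exacts [h0 i, h1 i, h2 i, h3 i, h4 i, h5 i]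
    intro d d'
    obtain ⟨g, hg, rfl⟩ := base d
    obtain ⟨g', hg', rfl⟩ := base d'
    exact ⟨g' * g⁻¹, G.mul_mem hg' (G.inv_mem hg), congrArg g' (g.symm_apply_apply _)⟩
  euler := by
    obtain ⟨h1, h2, h3⟩ := digonMap_card k
    rw [h1, h2, h3]
    push_cast
    ring
  loopless := by
    have hinv : ∀ d d', (digonMap k).origin d = (digonMap k).origin d' →
        digonVertex k d = digonVertex k d' := by
      intro d d' h
      have h1 : ∀ d, digonVertex k ((digonMap k).rot d) = digonVertex k d := by
        rintro ⟨i, j⟩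
        fin_cases j <;> simp [CombMap.rot, digonMap, digonFace, digonEdgeFun, digonVertex]
      have h2 : ∀ (m : ℕ) d, digonVertex k (((digonMap k).rot ^ m) d) = digonVertex k d := by
        intro m
        induction m with
        | zero => intro d; simp
        | succ m ih => intro d; rw [pow_succ', Perm.mul_apply, h1, ih]
      obtain ⟨m, -, hm⟩ := Perm.SameCycle.exists_pow_eq' (Quotient.exact h : Perm.SameCycle _ d d')
      rw [← hm, h2]
    rintro ⟨i, j⟩ h
    have h' := hinv _ _ h
    fin_cases j <;> simp [digonMap, digonEdgeFun, digonVertex] at h'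

section relabel

variable {D D' : Type} (f : D ≃ D') (M : CombMap D)

theorem sameCycle_permCongr (π : Perm D) (x y : D) :
    (f.permCongr π).SameCycle (f x) (f y) ↔ π.SameCycle x y := by
  have hz : ∀ i : ℤ, (f.permCongr π) ^ i = f.permCongr (π ^ i) := fun i =>
    (map_zpow f.permCongrHom π i).symm
  simp [Perm.SameCycle, hz, Equiv.permCongr_apply]

theorem card_cycles_permCongr (π : Perm D) :
    Nat.card (Quotient (Perm.SameCycle.setoid (f.permCongr π))) =
      Nat.card (Quotient (Perm.SameCycle.setoid π)) :=
  (Nat.card_congr (Quotient.congr f fun x y => (sameCycle_permCongr f π x y).symm)).symm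

theorem CombMap.relabel_rot : (M.relabel f).rot = f.permCongr M.rot :=
  (map_mul f.permCongrHom M.face M.edge).symm

theorem CombMap.IsSphereTriangulation.relabel {M : CombMap D} (h : M.IsSphereTriangulation) :
    (M.relabel f).IsSphereTriangulation where
  edge_ne d := by
    have := h.edge_ne (f.symm d)
    simpa [CombMap.relabel, Equiv.permCongr_apply, ← Equiv.eq_symm_apply] using this
  edge_edge d := by simp [CombMap.relabel, Equiv.permCongr_apply, h.edge_edge]
  face_ne d := by
    have := h.face_ne (f.symm d)
    simpa [CombMap.relabel, Equiv.permCongr_apply, ← Equiv.eq_symm_apply] using this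
  face_face_face d := by simp [CombMap.relabel, Equiv.permCongr_apply, h.face_face_face]
  connected d d' := by
    obtain ⟨g, hg, hgd⟩ := h.connected (f.symm d) (f.symm d')
    refine ⟨f.permCongr g, ?_, by simp [Equiv.permCongr_apply, hgd]⟩
    have := Subgroup.mem_map_of_mem f.permCongrHom.toMonoidHom hg
    rw [MonoidHom.map_closure, Set.image_pair] at this
    exact this
  euler := by
    have hV : Nat.card (M.relabel f).Vertex = Nat.card M.Vertex := by
      unfold CombMap.Vertex
      rw [CombMap.relabel_rot, card_cycles_permCongr]
    have hE : Nat.card (M.relabel f).Edge = Nat.card M.Edge := card_cycles_permCongr f M.edge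
    have hF : Nat.card (M.relabel f).Face = Nat.card M.Face := card_cycles_permCongr f M.face
    rw [hV, hE, hF, h.euler]
  loopless d hd := by
    apply h.loopless (f.symm d)
    apply Quotient.sound
    have h1 : (M.relabel f).rot.SameCycle d ((M.relabel f).edge d) := Quotient.exact hd
    rw [CombMap.relabel_rot] at h1
    have h2 := (sameCycle_permCongr f M.rot (f.symm d) (M.edge (f.symm d))).1
    rw [Equiv.apply_symm_apply] at h2
    exact h2 h1

end relabel

theorem MarkedTriangulation.nonempty {n : ℕ} (hn : 2 < n) : Nonempty (MarkedTriangulation n) := by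
  obtain ⟨k, rfl⟩ : ∃ k, n = k + 3 := ⟨n - 3, by omega⟩
  have hc : Fintype.card (Fin (k + 1) × Fin 6) = 6 * (k + 3 - 2) := by
    simp only [Fintype.card_prod, Fintype.card_fin]
    omega
  let f := Fintype.equivFinOfCardEq hc
  refine ⟨⟨(digonMap k).relabel f, (digonMap_isSphere k).relabel f, ?_, f (0, 0),
    Sum.inl (f (0, 0))⟩⟩
  unfold CombMap.Vertex
  rw [CombMap.relabel_rot, card_cycles_permCongr]
  exact (digonMap_card k).1

end existence

/-! ### The laws of the two explorations -/

section laws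

variable (n : ℕ) (hn : 2 < n)

open Classical in
/-- The uniform law on marked triangulations with `n` vertices. A rooted triangulation has no
nontrivial automorphism, so that all isomorphism classes of rooted triangulations (the root being
the dart with label `0`) have the same number of labellings: under this law the rooted triangulation
is uniformly distributed, and `e₁`, `e₂` are independent uniform choices. -/
noncomputable def uniformLaw : PMF (MarkedTriangulation n) :=
  haveI := MarkedTriangulation.nonempty hn
  haveI : Fintype (MarkedTriangulation n) := Fintype.ofFinite _
  PMF.uniformOfFintype (MarkedTriangulation n)

/-- The joint law of the fattened random triangulation and of its Eden exploration. -/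
noncomputable def edenLaw : PMF (CombMap (FatDart n) × List (FatDart n)) :=
  (uniformLaw n hn).bind fun ω =>
    (ω.fat.eden (source n) (target n)).map fun γ => (ω.fat, γ)

/-- The joint law of the fattened random triangulation and of its percolation interface, where
`p ω` is the reference path used for `ω`. -/
noncomputable def percolationLaw (p : MarkedTriangulation n → List (FatDart n)) :
    PMF (CombMap (FatDart n) × List (FatDart n)) :=
  (uniformLaw n hn).bind fun ω =>
    (ω.fat.percolation (source n) (target n) (p ω)).map fun γ => (ω.fat, γ)

end laws

/-! Darts are labelled, so an exploration is a list `γ` of darts, and entering the same faces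
through the same sides means keeping `γ`. Turning everything inside a boundary cycle `C_j` by a
rotation `u` keeps `face` and conjugates `edge` by `u` (`reglue`); only the matching of the two
sides of `C_j` changes.

The proof rests on three facts.

(a) Rotations are invisible to the statistics. The reglued map is again a loopless map of the
sphere, `γ` is still an exploration of it, and all regions, their sizes and the necklaces are kept
(`reglue_isSphere_and_label`, `IsExploration.regionAt_reglue`, `size_reglue`,
`IsExploration.necklaces_reglue`). The fattened triangulations are closed under such changes
(`mem_range_fat_of_face_eq`), so rotations stay within a set of equally likely maps. Planarity
enters through homology mod 2: since the Euler characteristic is 2, every closed curve separates the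
faces, and therefore the boundary of each region is one simple cycle.

(b) Both laws are products over the steps. Eden gives `γ` the weight of all `1 / |C_i|`
(`eden_apply`). For percolation, the next seed lies on the face entered last. If only one side of
that face borders the remaining region, the seed is forced. If two do, they meet at a vertex not
touched by earlier seeds, whose colour is a fresh fair coin, and each has probability one half; the
path `p` merely swaps the meaning of the coin. So `γ` has the weight of all `1 / (number of
candidates)`, or zero if some seed is not adjacent to the last face, and `p` drops out
(`percolation_apply`).

(c) Averaging over the rotations of `C_j` replaces the percolation factor of that step by the Eden
factor. As `u` runs over the rotations, `u⁻¹ γ[j]` runs once over the edges of `C_j`, so the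
percolation factors add up to 1 and the uniform choice of `u` contributes `1 / |C_j|`
(`IsExploration.sum_stepProb_reglue`). The later factors depend only on what lies inside `C_j`, and
the earlier factors, already those of Eden, are cycle lengths. Moving through the cycles from `C_0`
outwards in time therefore carries the percolation law to the Eden law via the intermediate
`hybridWeight`.

The statement about random rotations is (c), and the equalities of laws follow from it by (a). -/

open Equiv

namespace CombMap

/-! ### Homology of a map with coefficients in `ZMod 2` -/

section homology

open Classical in
/-- The incidence matrix of two partitions of the darts. -/
noncomputable def incMatrix {D X Y : Type} [Fintype D] (α : D → X) (β : D → Y) :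
    Matrix X Y (ZMod 2) :=
  fun x y => ∑ d : D, if α d = x ∧ β d = y then 1 else 0

section incMatrix

variable {D X Y Z : Type} [Fintype D]

theorem incMatrix_transpose (α : D → X) (β : D → Y) :
    (incMatrix α β).transpose = incMatrix β α := by
  ext x y
  simp only [Matrix.transpose_apply, incMatrix]
  classical exact Finset.sum_congr rfl fun d _ => if_congr and_comm rfl rfl

theorem incMatrix_mulVec [Fintype Y] [DecidableEq X] (α : D → X) (β : D → Y) (g : Y → ZMod 2) (x : X) :
    (incMatrix α β).mulVec g x = ∑ d : D, if α d = x then g (β d) else 0 := by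
  classical
  simp only [Matrix.mulVec, dotProduct, incMatrix, Finset.sum_mul]
  rw [Finset.sum_comm]
  refine Finset.sum_congr rfl fun d _ => ?_
  by_cases h : α d = x
  · simp [h]
  · simp [h]

end incMatrix

variable {D : Type} (M : CombMap D)

/-- The edge carrying a dart. -/
def edgeOf (d : D) : M.Edge := Quotient.mk _ d

variable {M}

theorem edgeOf_eq_iff (hee : ∀ d, M.edge (M.edge d) = d) {d d' : D} :
    M.edgeOf d = M.edgeOf d' ↔ d = d' ∨ d = M.edge d' := by
  have h2 : ∀ x, (M.edge ^ 2) x = x := fun x => by simp [pow_two, hee]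
  have hz : ∀ (i : ℤ) (x : D), (M.edge ^ i) x = x ∨ (M.edge ^ i) x = M.edge x := by
    intro i x
    have h21 : M.edge ^ (2 : ℤ) = 1 := by
      ext y; exact h2 y
    rcases Int.even_or_odd' i with ⟨k, rfl | rfl⟩
    · left; rw [zpow_mul, h21, one_zpow]; rfl
    · right; rw [zpow_add, zpow_mul, h21, one_zpow]; simp
  constructor
  · intro h
    obtain ⟨i, hi⟩ : M.edge.SameCycle d d' := Quotient.exact h
    rcases hz i d with h' | h'
    · left; rw [← hi, h']
    · right; rw [← hi, h', hee]
  · rintro (rfl | rfl)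
    · rfl
    · exact Quotient.sound ⟨1, by simp [hee]⟩

theorem faceOf_face (d : D) : M.faceOf (M.face d) = M.faceOf d :=
  Quotient.sound ⟨-1, by simp⟩

theorem origin_rot (d : D) : M.origin (M.rot d) = M.origin d :=
  Quotient.sound ⟨-1, by simp⟩

theorem origin_face (hee : ∀ d, M.edge (M.edge d) = d) (d : D) :
    M.origin (M.face d) = M.origin (M.edge d) := by
  conv_lhs => rw [← hee d]
  exact origin_rot (M.edge d)

/-- A property of darts that is preserved by `face` and `edge` and holds somewhere holds everywhere
on a connected map. -/
theorem connected_induction [Finite D]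
    (hc : ∀ d d' : D, ∃ g ∈ Subgroup.closure {M.face, M.edge}, g d = d')
    {P : D → Prop} (hf : ∀ d, P d → P (M.face d)) (he : ∀ d, P d → P (M.edge d))
    {d : D} (hd : P d) (d' : D) : P d' := by
  obtain ⟨g, hg, rfl⟩ := hc d d'
  have hpow : ∀ (π : Perm D), (∀ d, P d → P (π d)) → ∀ (k : ℕ) d, P d → P ((π ^ k) d) := by
    intro π hπ k
    induction k with
    | zero => intro d h; simpa using h
    | succ k ih => intro d h; rw [pow_succ', Perm.mul_apply]; exact hπ _ (ih _ h)
  have hinv : ∀ (π : Perm D), (∀ d, P d → P (π d)) → ∀ d, P d → P (π⁻¹ d) := by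
    intro π hπ d h
    have h1 : π⁻¹ = π ^ (orderOf π - 1) := by
      have := orderOf_pos π
      rw [inv_eq_iff_mul_eq_one, ← pow_succ', Nat.sub_add_cancel this, pow_orderOf_eq_one]
    rw [h1]; exact hpow π hπ _ d h
  have key : ∀ d, P d → P (g d) := by
    induction hg using Subgroup.closure_induction with
    | mem x hx =>
      rcases hx with rfl | rfl
      exacts [hf, he]
    | one => intro d h; simpa using h
    | mul x y _ _ hx hy => intro d h; exact hx _ (hy _ h)
    | inv x _ hx => exact hinv x hx
  exact key d hd

theorem sum_edgeOf [Fintype D] [DecidableEq M.Edge] (hne : ∀ d, M.edge d ≠ d) (hee : ∀ d, M.edge (M.edge d) = d)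
    (f : D → ZMod 2) (d : D) :
    (∑ d' : D, if M.edgeOf d' = M.edgeOf d then f d' else 0) = f d + f (M.edge d) := by
  classical
  rw [← Finset.sum_filter]
  have : Finset.univ.filter (fun d' => M.edgeOf d' = M.edgeOf d) = {d, M.edge d} := by
    ext x; simp [edgeOf_eq_iff hee]
  rw [this, Finset.sum_pair (hne d).symm]

variable [Finite D]

/-- A kernel vector is a function on `Y` with equal values at the two darts of every edge, hence
constant by `hconst`, and the kernel is the line through `1`. For `β = origin` this is connectedness
of the graph, for `β = faceOf` connectedness of its dual. -/
theorem rank_incMatrix {Y : Type} [Fintype D] [Fintype Y] [Nonempty D]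
    (hne : ∀ d, M.edge d ≠ d)
    (hee : ∀ d, M.edge (M.edge d) = d) (β : D → Y) (hβ : Function.Surjective β)
    (hconst : ∀ g : Y → ZMod 2, (∀ d, g (β (M.edge d)) = g (β d)) → ∀ d d', g (β d) = g (β d')) :
    (incMatrix M.edgeOf β).rank + 1 = Fintype.card Y := by
  classical
  have : Fintype M.Edge := Fintype.ofFinite _
  have hker : LinearMap.ker (incMatrix M.edgeOf β).mulVecLin = Submodule.span (ZMod 2) {1} := by
    ext g
    rw [LinearMap.mem_ker, Submodule.mem_span_singleton]
    have h1 : (incMatrix M.edgeOf β).mulVecLin g = 0 ↔ ∀ d, g (β d) + g (β (M.edge d)) = 0 := by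
      constructor
      · intro h d
        have := congrFun h (M.edgeOf d)
        rwa [Matrix.mulVecLin_apply, incMatrix_mulVec,
          sum_edgeOf hne hee (fun d => g (β d))] at this
      · intro h
        ext e
        induction e using Quotient.inductionOn with
        | _ d =>
          rw [Matrix.mulVecLin_apply, incMatrix_mulVec]
          exact (sum_edgeOf hne hee (fun d => g (β d)) d).trans (h d)
    rw [h1]
    constructor
    · intro h
      have hc := hconst g fun d => (CharTwo.add_eq_zero.1 (h d)).symm
      obtain ⟨d0⟩ := ‹Nonempty D›
      refine ⟨g (β d0), ?_⟩
      ext y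
      obtain ⟨d, rfl⟩ := hβ y
      simpa using hc d0 d
    · rintro ⟨r, rfl⟩ d
      simp [CharTwo.add_self_eq_zero]
  have h2 := LinearMap.finrank_range_add_finrank_ker (incMatrix M.edgeOf β).mulVecLin
  have h1 : (1 : Y → ZMod 2) ≠ 0 := by
    obtain ⟨d0⟩ := ‹Nonempty D›
    intro h
    exact one_ne_zero (congrFun h (β d0))
  rw [hker, finrank_span_singleton h1, Module.finrank_fintype_fun_eq_card] at h2
  exact h2

theorem rank_incMatrix_origin [Fintype D] [Nonempty D] [Fintype M.Vertex]
    (hne : ∀ d, M.edge d ≠ d) (hee : ∀ d, M.edge (M.edge d) = d)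
    (hc : ∀ d d' : D, ∃ g ∈ Subgroup.closure {M.face, M.edge}, g d = d') :
    (incMatrix M.edgeOf M.origin).rank + 1 = Fintype.card M.Vertex := by
  refine rank_incMatrix hne hee M.origin Quotient.mk_surjective fun g hg d d' => ?_
  refine connected_induction hc (P := fun x => g (M.origin d) = g (M.origin x)) ?_ ?_ rfl d'
  · intro x hx; rw [origin_face hee, hg, hx]
  · intro x hx; rw [hg, hx]

theorem rank_incMatrix_faceOf [Fintype D] [Nonempty D] [Fintype M.Face]
    (hne : ∀ d, M.edge d ≠ d) (hee : ∀ d, M.edge (M.edge d) = d)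
    (hc : ∀ d d' : D, ∃ g ∈ Subgroup.closure {M.face, M.edge}, g d = d') :
    (incMatrix M.edgeOf M.faceOf).rank + 1 = Fintype.card M.Face := by
  refine rank_incMatrix hne hee M.faceOf Quotient.mk_surjective fun g hg d d' => ?_
  refine connected_induction hc (P := fun x => g (M.faceOf d) = g (M.faceOf x)) ?_ ?_ rfl d'
  · intro x hx; rw [faceOf_face, hx]
  · intro x hx; rw [hg, hx]

-- The boundary of a boundary vanishes in the complex of faces, edges and vertices. The face across
-- `d` is the face of `M.rot d`, so around a vertex every corner is counted by two successive darts.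
omit [Finite D] in
theorem range_le_ker_incMatrix [Fintype D] [Fintype M.Face] [Fintype M.Edge]
    (hne : ∀ d, M.edge d ≠ d) (hee : ∀ d, M.edge (M.edge d) = d) :
    LinearMap.range (incMatrix M.edgeOf M.faceOf).mulVecLin ≤
      LinearMap.ker (incMatrix M.origin M.edgeOf).mulVecLin := by
  classical
  rintro _ ⟨f, rfl⟩
  rw [LinearMap.mem_ker]
  ext v
  rw [Matrix.mulVecLin_apply, incMatrix_mulVec]
  have h1 : ∀ d, (incMatrix M.edgeOf M.faceOf).mulVecLin f (M.edgeOf d) =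
      f (M.faceOf d) + f (M.faceOf (M.rot d)) := by
    intro d
    rw [Matrix.mulVecLin_apply, incMatrix_mulVec, sum_edgeOf hne hee (fun d => f (M.faceOf d))]
    congr 2
    exact (faceOf_face (M.edge d)).symm
  simp only [h1]
  have h2 : ∀ d, (if M.origin d = v then f (M.faceOf d) + f (M.faceOf (M.rot d)) else 0) =
      (if M.origin d = v then f (M.faceOf d) else 0) +
      (if M.origin (M.rot d) = v then f (M.faceOf (M.rot d)) else 0) := by
    intro d; rw [origin_rot]; split_ifs <;> simp
  simp only [h2, Finset.sum_add_distrib]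
  rw [Equiv.sum_comp M.rot (fun d => if M.origin d = v then f (M.faceOf d) else 0)]
  exact CharTwo.add_self_eq_zero _

theorem card_darts (hne : ∀ d, M.edge d ≠ d) (hee : ∀ d, M.edge (M.edge d) = d) :
    Nat.card D = 2 * Nat.card M.Edge := by
  classical
  have := Fintype.ofFinite D
  have : Fintype M.Edge := Fintype.ofFinite _
  rw [Nat.card_eq_fintype_card, Nat.card_eq_fintype_card, ← Finset.card_univ,
    Finset.card_eq_sum_card_fiberwise (f := M.edgeOf) (t := Finset.univ) (by simp), mul_comm,
    ← Finset.card_univ, ← smul_eq_mul, ← Finset.sum_const]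
  refine Finset.sum_congr rfl fun e _ => ?_
  induction e using Quotient.inductionOn with
  | _ d =>
    have : Finset.univ.filter (fun d' => M.edgeOf d' = M.edgeOf d) = {d, M.edge d} := by
      ext x; simp [edgeOf_eq_iff hee]
    exact (congrArg Finset.card this).trans (Finset.card_pair (hne d).symm)

/-- The Euler characteristic of a connected map is at most two. -/
theorem euler_le (hne : ∀ d, M.edge d ≠ d) (hee : ∀ d, M.edge (M.edge d) = d)
    (hc : ∀ d d' : D, ∃ g ∈ Subgroup.closure {M.face, M.edge}, g d = d') [Nonempty D] :
    (Nat.card M.Vertex : ℤ) - Nat.card M.Edge + Nat.card M.Face ≤ 2 := by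
  classical
  have := Fintype.ofFinite D
  have : Fintype M.Edge := Fintype.ofFinite _
  have : Fintype M.Face := Fintype.ofFinite _
  have : Fintype M.Vertex := Fintype.ofFinite _
  have h1 := rank_incMatrix_origin hne hee hc
  have h2 := rank_incMatrix_faceOf hne hee hc
  have h3 := Submodule.finrank_mono (range_le_ker_incMatrix (M := M) hne hee)
  have h4 := LinearMap.finrank_range_add_finrank_ker (incMatrix M.origin M.edgeOf).mulVecLin
  rw [Module.finrank_fintype_fun_eq_card] at h4
  have h5 : (incMatrix M.origin M.edgeOf).rank = (incMatrix M.edgeOf M.origin).rank := by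
    rw [← incMatrix_transpose, Matrix.rank_transpose]
  simp only [Matrix.rank] at h1 h2 h5
  simp only [Nat.card_eq_fintype_card]
  -- The inclusion of boundaries in cycles reads `F - 1 ≤ E - (V - 1)`.
  omega

/-- On the sphere every cycle is a boundary. -/
theorem exists_face_potential [Fintype D] [DecidableEq M.Vertex] [Nonempty D]
    (hne : ∀ d, M.edge d ≠ d) (hee : ∀ d, M.edge (M.edge d) = d)
    (hc : ∀ d d' : D, ∃ g ∈ Subgroup.closure {M.face, M.edge}, g d = d')
    (heul : (Nat.card M.Vertex : ℤ) - Nat.card M.Edge + Nat.card M.Face = 2)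
    (h : D → ZMod 2) (hsym : ∀ d, h (M.edge d) = h d)
    (hclosed : ∀ v, (∑ d : D, if M.origin d = v then h d else 0) = 0) :
    ∃ f : M.Face → ZMod 2, ∀ d, h d = f (M.faceOf d) + f (M.faceOf (M.edge d)) := by
  classical
  have : Fintype M.Edge := Fintype.ofFinite _
  have : Fintype M.Face := Fintype.ofFinite _
  have : Fintype M.Vertex := Fintype.ofFinite _
  have h1 := rank_incMatrix_origin hne hee hc
  have h2 := rank_incMatrix_faceOf hne hee hc
  have h3 := range_le_ker_incMatrix (M := M) hne hee
  have h4 := LinearMap.finrank_range_add_finrank_ker (incMatrix M.origin M.edgeOf).mulVecLin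
  rw [Module.finrank_fintype_fun_eq_card] at h4
  have h5 : (incMatrix M.origin M.edgeOf).rank = (incMatrix M.edgeOf M.origin).rank := by
    rw [← incMatrix_transpose, Matrix.rank_transpose]
  simp only [Matrix.rank] at h1 h2 h5
  simp only [Nat.card_eq_fintype_card] at heul
  -- Equality in Euler's inequality: the first homology mod 2 is zero and every cycle is a boundary.
  have h6 := Submodule.eq_of_le_of_finrank_eq h3 (by omega)
  have hlift : ∀ d d' : D, M.edge.SameCycle d d' → h d = h d' := by
    intro d d' hd
    rcases (edgeOf_eq_iff hee).1 (Quotient.sound hd : M.edgeOf d = M.edgeOf d') with rfl | rfl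
    · rfl
    · exact hsym _
  let H : M.Edge → ZMod 2 := Quotient.lift h hlift
  have h7 : H ∈ LinearMap.ker (incMatrix M.origin M.edgeOf).mulVecLin := by
    rw [LinearMap.mem_ker]
    ext v
    rw [Matrix.mulVecLin_apply, incMatrix_mulVec]
    exact hclosed v
  rw [← h6] at h7
  obtain ⟨f, hf⟩ := h7
  refine ⟨f, fun d => ?_⟩
  have := congrFun hf (M.edgeOf d)
  rw [Matrix.mulVecLin_apply, incMatrix_mulVec, sum_edgeOf hne hee (fun d => f (M.faceOf d))] at this
  exact this.symm

/-- A map of the sphere without loops. -/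
structure IsSphere (M : CombMap D) : Prop where
  edge_ne : ∀ d, M.edge d ≠ d
  edge_edge : ∀ d, M.edge (M.edge d) = d
  connected : ∀ d d' : D, ∃ g ∈ Subgroup.closure {M.face, M.edge}, g d = d'
  euler : (Nat.card M.Vertex : ℤ) - Nat.card M.Edge + Nat.card M.Face = 2
  loopless : ∀ d, M.origin d ≠ M.origin (M.edge d)

omit [Finite D] in
theorem IsSphereTriangulation.isSphere (h : M.IsSphereTriangulation) : M.IsSphere :=
  ⟨h.edge_ne, h.edge_edge, h.connected, h.euler, h.loopless⟩

theorem card_darts_of_triangulation (h : M.IsSphereTriangulation) :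
    Nat.card D = 3 * Nat.card M.Face := by
  classical
  have := Fintype.ofFinite D
  have : Fintype M.Face := Fintype.ofFinite _
  rw [Nat.card_eq_fintype_card, Nat.card_eq_fintype_card, ← Finset.card_univ,
    Finset.card_eq_sum_card_fiberwise (f := M.faceOf) (t := Finset.univ) (by simp), mul_comm,
    ← Finset.card_univ, ← smul_eq_mul, ← Finset.sum_const]
  refine Finset.sum_congr rfl fun e _ => ?_
  induction e using Quotient.inductionOn with
  | _ d =>
    have h3 : M.face ^ 3 = 1 := by
      ext x; simp [pow_succ, h.face_face_face]
    have : Finset.univ.filter (fun d' => M.faceOf d' = M.faceOf d) =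
        {d, M.face d, M.face (M.face d)} := by
      ext x
      simp only [Finset.mem_filter, Finset.mem_univ, true_and, Finset.mem_insert,
        Finset.mem_singleton]
      constructor
      · intro hx
        obtain ⟨i, hi⟩ : M.face.SameCycle d x := (Quotient.exact hx : M.face.SameCycle x d).symm
        have h3' : M.face ^ (3 : ℤ) = 1 := by exact_mod_cast h3
        rw [← Int.emod_add_mul_ediv i 3, zpow_add, zpow_mul, h3', one_zpow, mul_one] at hi
        have h0 := Int.emod_nonneg i (show (3 : ℤ) ≠ 0 by norm_num)
        have h1 := Int.emod_lt_of_pos i (show (0 : ℤ) < 3 by norm_num)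
        generalize i % 3 = j at *
        interval_cases j
        · left; simpa using hi.symm
        · right; left; simpa using hi.symm
        · right; right
          rw [← hi]; exact (congrFun (congrArg DFunLike.coe (zpow_two M.face)) d)
      · rintro (rfl | rfl | rfl) <;> simp [faceOf_face]
    refine (congrArg Finset.card this).trans ?_
    rw [Finset.card_eq_three]
    refine ⟨_, _, _, (h.face_ne d).symm, ?_, (h.face_ne _).symm, rfl⟩
    intro hd
    apply h.face_ne d
    conv_rhs => rw [← h.face_face_face d, ← hd]

/-- The numbers of faces, edges and darts of a triangulation of the sphere. -/
theorem IsSphereTriangulation.card_eq (h : M.IsSphereTriangulation) {n : ℕ} (hn : 2 < n)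
    (hv : Nat.card M.Vertex = n) :
    Nat.card M.Face = 2 * (n - 2) ∧ Nat.card M.Edge = 3 * (n - 2) ∧
      Nat.card D = 6 * (n - 2) := by
  have h1 := card_darts h.edge_ne h.edge_edge
  have h2 := card_darts_of_triangulation h
  have h3 := h.euler
  omega

end homology

end CombMap

namespace CombMap

/-! ### Discs and their boundary cycles -/

section disk

variable {D : Type} {M : CombMap D} {R : Set D}

/-- A union `R` of faces such that both `R` and its complement are nonempty and connected through
edges. On the sphere, this is a disc. -/
structure IsDisk (M : CombMap D) (R : Set D) : Prop where
  nonempty : R.Nonempty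
  compl_nonempty : Rᶜ.Nonempty
  face_mem : ∀ d, M.face d ∈ R ↔ d ∈ R
  conn : ∀ P : D → Prop, (∀ d ∈ R, P (M.face d) ↔ P d) →
    (∀ d ∈ R, M.edge d ∈ R → (P (M.edge d) ↔ P d)) → ∀ d ∈ R, ∀ d' ∈ R, P d → P d'
  compl_conn : ∀ P : D → Prop, (∀ d ∉ R, P (M.face d) ↔ P d) →
    (∀ d ∉ R, M.edge d ∉ R → (P (M.edge d) ↔ P d)) → ∀ d ∉ R, ∀ d' ∉ R, P d → P d'

theorem innerCross_of_mem_bdry {d : D} (hd : d ∈ M.bdry R) : M.innerCross R d = d :=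
  if_neg fun h => hd.2 h.2.1

theorem innerCross_of_mem (hee : ∀ d, M.edge (M.edge d) = d) {d : D} (hd : d ∈ R)
    (hd' : M.edge d ∈ R) : M.innerCross R d = M.edge d :=
  if_pos ⟨hd, hd', hee d⟩

variable [Finite D]

/-- The first step, `face`, arrives at the head of `d`. Every later step crosses an inner edge and
applies `face`; this is `rot`, which keeps the origin, until a boundary dart appears. -/
theorem nextBdry_spec (hM : M.IsSphere) (hR : M.IsDisk R) {d : D} (hd : d ∈ M.bdry R) :
    M.nextBdry R d ∈ M.bdry R ∧ M.origin (M.nextBdry R d) = M.origin (M.edge d) := by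
  set π := M.face * (M.innerCross_involutive R).toPerm with hπ
  obtain ⟨j, hj, hjR, hj', hmin⟩ := firstReturnFun_spec π hd
  have hnext : M.nextBdry R d = (π ^ j) d := hj'
  rw [hnext]
  refine ⟨hjR, ?_⟩
  have key : ∀ i, i + 1 ≤ j → (π ^ (i + 1)) d ∈ R ∧
      M.origin ((π ^ (i + 1)) d) = M.origin (M.edge d) := by
    intro i
    induction i with
    | zero =>
      intro _
      have h1 : (π ^ (0 + 1)) d = M.face d := by
        simp [hπ, Perm.mul_apply, innerCross_of_mem_bdry hd]
      rw [h1]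
      exact ⟨(hR.face_mem d).2 hd.1, origin_face hM.edge_edge d⟩
    | succ i ih =>
      intro hi
      obtain ⟨ih1, ih2⟩ := ih (by omega)
      have h2 := hmin (i + 1) (by omega) (by omega)
      rw [pow_succ', Perm.mul_apply]
      generalize (π ^ (i + 1)) d = y at *
      have h3 : M.edge y ∈ R := by
        by_contra h; exact h2 ⟨ih1, h⟩
      have h4 : π y = M.face (M.edge y) := by
        simp [hπ, Perm.mul_apply, innerCross_of_mem hM.edge_edge ih1 h3]
      rw [h4]
      exact ⟨(hR.face_mem _).2 h3, (origin_rot y).trans ih2⟩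
  obtain ⟨i, rfl⟩ : ∃ i, j = i + 1 := ⟨j - 1, by omega⟩
  exact (key i le_rfl).2

theorem nextBdry_of_notMem {d : D} (hd : d ∉ M.bdry R) : M.nextBdry R d = d :=
  if_neg hd

theorem nextBdry_mem_iff (hM : M.IsSphere) (hR : M.IsDisk R) (d : D) :
    M.nextBdry R d ∈ M.bdry R ↔ d ∈ M.bdry R := by
  refine ⟨fun h => ?_, fun h => (nextBdry_spec hM hR h).1⟩
  by_contra h'
  rw [nextBdry_of_notMem h'] at h
  exact h' h

/-- A closed curve in the boundary of a disc is empty or the entire boundary. -/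
theorem IsDisk.bdry_subset_of_closed [DecidableEq M.Vertex] (hM : M.IsSphere) (hR : M.IsDisk R)
    (Z : Finset D)
    (hZ : ∀ d ∈ Z, d ∈ M.bdry R) (hZ0 : Z.Nonempty)
    (hcl : ∀ v, ∑ d ∈ Z, ((if M.origin d = v then 1 else 0) +
      (if M.origin (M.edge d) = v then 1 else 0)) = (0 : ZMod 2)) :
    ∀ d ∈ M.bdry R, d ∈ Z := by
  classical
  have := Fintype.ofFinite D
  have : Nonempty D := ⟨hZ0.choose⟩
  have hee := hM.edge_edge
  obtain ⟨f, hf⟩ := exists_face_potential hM.edge_ne hee hM.connected hM.euler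
    (fun d => (if d ∈ Z then 1 else 0) + (if M.edge d ∈ Z then 1 else 0))
    (fun d => by simp only [hee]; rw [add_comm]) (fun v => by
      refine Eq.trans ?_ (hcl v)
      rw [Finset.sum_add_distrib]
      have h1 : ∀ d, (if M.origin d = v then
          ((if d ∈ Z then 1 else 0) + (if M.edge d ∈ Z then 1 else 0) : ZMod 2) else 0) =
          (if d ∈ Z then (if M.origin d = v then 1 else 0) else 0) +
          (if M.edge d ∈ Z then (if M.origin (M.edge (M.edge d)) = v then 1 else 0) else 0) := by
        intro d; rw [hee]; split_ifs <;> simp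
      rw [Finset.sum_congr rfl fun d _ => h1 d, Finset.sum_add_distrib]
      rw [Equiv.sum_comp M.edge (fun d => if d ∈ Z then
        (if M.origin (M.edge d) = v then (1 : ZMod 2) else 0) else 0)]
      simp only [Finset.sum_ite_mem, Finset.univ_inter])
  obtain ⟨z, hz⟩ := hZ0
  intro d hd
  by_contra hdZ
  -- The potential `f` jumps exactly across the edges of `Z`, all of which are boundary edges. So
  -- `f` is constant on `R` and on its complement; it jumps at `z`, hence across every boundary
  -- edge.
  have hin : ∀ x ∈ R, ∀ y ∈ R, f (M.faceOf x) = f (M.faceOf z) → f (M.faceOf y) = f (M.faceOf z) :=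
    hR.conn (fun x => f (M.faceOf x) = f (M.faceOf z)) (fun x _ => by simp [faceOf_face])
      (fun x hx hx' => by
        have h1 : x ∉ Z := fun h => (hZ x h).2 hx'
        have h2 : M.edge x ∉ Z := fun h => (hZ _ h).2 (by rwa [hee])
        have h3 := hf x
        simp only [h1, h2, if_false, add_zero] at h3
        rw [CharTwo.add_eq_zero.1 h3.symm])
  have hout : ∀ x ∉ R, ∀ y ∉ R, f (M.faceOf x) = f (M.faceOf (M.edge z)) →
      f (M.faceOf y) = f (M.faceOf (M.edge z)) :=
    hR.compl_conn (fun x => f (M.faceOf x) = f (M.faceOf (M.edge z)))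
      (fun x _ => by simp [faceOf_face])
      (fun x hx hx' => by
        have h1 : x ∉ Z := fun h => hx (hZ x h).1
        have h2 : M.edge x ∉ Z := fun h => hx' (hZ _ h).1
        have h3 := hf x
        simp only [h1, h2, if_false, add_zero] at h3
        rw [CharTwo.add_eq_zero.1 h3.symm])
  have hzb := hZ z hz
  have e1 := hf z
  have e2 := hf d
  have h1 : M.edge z ∉ Z := fun h => hzb.2 (hZ _ h).1
  have h2 : M.edge d ∉ Z := fun h => hd.2 (hZ _ h).1
  simp only [hz, hdZ, h1, h2, if_true, if_false, add_zero] at e1 e2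
  rw [hin z hzb.1 d hd.1 rfl, hout _ hzb.2 _ hd.2 rfl, ← e1] at e2
  exact zero_ne_one e2

/-- The orbit of `d` is a closed curve, because the head of each dart is the origin of its
successor. A nonempty closed curve in the boundary is all of it. -/
theorem nextBdry_sameCycle (hM : M.IsSphere) (hR : M.IsDisk R) {d d' : D} (hd : d ∈ M.bdry R)
    (hd' : d' ∈ M.bdry R) : (M.nextBdry R).SameCycle d d' := by
  classical
  have := Fintype.ofFinite D
  have h := hR.bdry_subset_of_closed hM
    (Finset.univ.filter fun x => x ∈ M.bdry R ∧ (M.nextBdry R).SameCycle d x)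
    (fun x hx => (Finset.mem_filter.1 hx).2.1) ⟨d, by simp [hd, Perm.SameCycle.refl]⟩
    (fun v => by
      rw [Finset.sum_add_distrib]
      have h1 : ∀ x ∈ Finset.univ.filter fun x => x ∈ M.bdry R ∧ (M.nextBdry R).SameCycle d x,
          (if M.origin (M.edge x) = v then 1 else 0 : ZMod 2) =
          (if M.origin (M.nextBdry R x) = v then 1 else 0) := by
        intro x hx
        rw [(nextBdry_spec hM hR (Finset.mem_filter.1 hx).2.1).2]
      rw [Finset.sum_congr rfl h1, Finset.sum_filter, Finset.sum_filter]
      rw [← Equiv.sum_comp (M.nextBdry R)]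
      simp only [nextBdry_mem_iff hM hR, Perm.sameCycle_apply_right]
      exact CharTwo.add_self_eq_zero _)
  exact (Finset.mem_filter.1 (h d' hd')).2.2

/-- The boundary cycle of a disc is simple. -/
theorem origin_injOn_bdry (hM : M.IsSphere) (hR : M.IsDisk R) {z z' : D} (hz : z ∈ M.bdry R)
    (hz' : z' ∈ M.bdry R) (hzz : M.origin z = M.origin z') : z = z' := by
  classical
  by_contra hne
  set ν := M.nextBdry R with hν
  have hex : ∃ m, (ν ^ m) z = z' := by
    obtain ⟨m, -, hm⟩ := (nextBdry_sameCycle hM hR hz hz').exists_pow_eq'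
    exact ⟨m, hm⟩
  set m := Nat.find hex with hm
  have hmz : (ν ^ m) z = z' := Nat.find_spec hex
  have hmin : ∀ i < m, (ν ^ i) z ≠ z' := fun i hi => Nat.find_min hex hi
  have hm0 : 0 < m := by
    rcases Nat.eq_zero_or_pos m with h | h
    · rw [h] at hmz; exact absurd hmz hne
    · exact h
  have hmem : ∀ i, (ν ^ i) z ∈ M.bdry R := by
    intro i
    induction i with
    | zero => simpa using hz
    | succ i ih => rw [pow_succ', Perm.mul_apply]; exact (nextBdry_mem_iff hM hR _).2 ih
  have hinj : Set.InjOn (fun i => (ν ^ i) z) (Finset.range m) := by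
    have key : ∀ i k, i < k → k < m → (ν ^ i) z ≠ (ν ^ k) z := by
      intro i k hik hkm h
      apply hmin (m - k + i) (by omega)
      rw [pow_add, Perm.mul_apply, h, ← Perm.mul_apply, ← pow_add, Nat.sub_add_cancel hkm.le, hmz]
    intro i hi k hk h
    rcases lt_trichotomy i k with hik | hik | hik
    · exact absurd h (key i k hik (by simpa using hk))
    · exact hik
    · exact absurd h.symm (key k i hik (by simpa using hi))
  -- The arc from `z` up to, but not including, `z'` is closed when the two origins agree, so it
  -- must be the entire boundary. By minimality of `m` it misses `z'`.
  have h := hR.bdry_subset_of_closed hM ((Finset.range m).image fun i => (ν ^ i) z)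
    (fun d hd => by
      obtain ⟨i, -, rfl⟩ := Finset.mem_image.1 hd
      exact hmem i)
    (by simpa using hm0.ne')
    (fun v => by
      rw [Finset.sum_image hinj]
      have h1 : ∀ i, M.origin (M.edge ((ν ^ i) z)) = M.origin ((ν ^ (i + 1)) z) := by
        intro i
        rw [pow_succ', Perm.mul_apply, (nextBdry_spec hM hR (hmem i)).2]
      simp only [h1]
      have h2 : ∀ k, ∑ i ∈ Finset.range k, ((if M.origin ((ν ^ i) z) = v then 1 else 0) +
          (if M.origin ((ν ^ (i + 1)) z) = v then 1 else 0)) =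
          (if M.origin z = v then 1 else 0 : ZMod 2) +
          (if M.origin ((ν ^ k) z) = v then 1 else 0) := by
        intro k
        induction k with
        | zero => simpa using (CharTwo.add_self_eq_zero _).symm
        | succ k ih =>
          rw [Finset.sum_range_succ, ih]
          generalize (if M.origin ((ν ^ k) z) = v then 1 else 0 : ZMod 2) = x
          rw [add_assoc, ← add_assoc x, CharTwo.add_self_eq_zero, zero_add]
      rw [h2, hmz, hzz]
      exact CharTwo.add_self_eq_zero _)
  obtain ⟨i, hi, hi'⟩ := Finset.mem_image.1 (h z' hz')
  exact hmin i (by simpa using hi) hi'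

theorem IsDisk.bdry_nonempty (hM : M.IsSphere) (hR : M.IsDisk R) : (M.bdry R).Nonempty := by
  by_contra h
  rw [Set.not_nonempty_iff_eq_empty] at h
  obtain ⟨d, hd⟩ := hR.nonempty
  obtain ⟨d', hd'⟩ := hR.compl_nonempty
  refine hd' (connected_induction hM.connected (P := fun x => x ∈ R)
    (fun x hx => (hR.face_mem x).2 hx) (fun x hx => ?_) hd d')
  by_contra hx'
  exact (Set.mem_empty_iff_false x).1 (h ▸ (⟨hx, hx'⟩ : x ∈ M.bdry R))

end disk

/-! ### The group of rotations of a boundary cycle -/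

section rotationGroup

variable {D : Type} {M : CombMap D} {R : Set D} [Finite D]

theorem rotation_mem_bdry (hM : M.IsSphere) (hR : M.IsDisk R) {u : Perm D}
    (hu : u ∈ Subgroup.zpowers (M.nextBdry R)) (d : D) : u d ∈ M.bdry R ↔ d ∈ M.bdry R := by
  rw [Subgroup.zpowers_eq_closure] at hu
  induction hu using Subgroup.closure_induction generalizing d with
  | mem x hx => rw [Set.mem_singleton_iff.1 hx]; exact nextBdry_mem_iff hM hR d
  | one => rfl
  | mul x y _ _ hx hy => rw [Perm.mul_apply, hx, hy]
  | inv x _ hx => rw [← hx]; simp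

theorem rotation_of_notMem {u : Perm D}
    (hu : u ∈ Subgroup.zpowers (M.nextBdry R)) {d : D} (hd : d ∉ M.bdry R) : u d = d := by
  rw [Subgroup.zpowers_eq_closure] at hu
  induction hu using Subgroup.closure_induction with
  | mem x hx => rw [Set.mem_singleton_iff.1 hx]; exact nextBdry_of_notMem hd
  | one => rfl
  | mul x y _ _ hx hy => rw [Perm.mul_apply, hy, hx]
  | inv x _ hx => rw [Perm.inv_eq_iff_eq, hx]

theorem rotation_comm {u : Perm D} (hu : u ∈ Subgroup.zpowers (M.nextBdry R)) (d : D) :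
    u (M.nextBdry R d) = M.nextBdry R (u d) := by
  obtain ⟨i, rfl⟩ := hu
  exact congrFun (congrArg DFunLike.coe ((Commute.refl (M.nextBdry R)).zpow_left i).eq) d

/-- The group is abelian and the boundary is a single orbit, so the action is simply transitive. The
inverse appears because in the reglued map `z` faces what `u⁻¹ z` faced before. -/
theorem rotation_bijective (hM : M.IsSphere) (hR : M.IsDisk R) {z : D} (hz : z ∈ M.bdry R) :
    Function.Bijective (fun u : Subgroup.zpowers (M.nextBdry R) =>
      (⟨(u : Perm D)⁻¹ z, (rotation_mem_bdry hM hR (Subgroup.inv_mem _ u.2) z).2 hz⟩ :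
        M.bdry R)) := by
  constructor
  · intro u u' h
    have h1 : (u : Perm D)⁻¹ z = (u' : Perm D)⁻¹ z := congrArg Subtype.val h
    have key : ∀ w : Perm D, w ∈ Subgroup.zpowers (M.nextBdry R) → w z = z → w = 1 := by
      intro w hw hwz
      ext d
      by_cases hd : d ∈ M.bdry R
      · obtain ⟨i, rfl⟩ := nextBdry_sameCycle hM hR hz hd
        obtain ⟨k, rfl⟩ := hw
        have : (M.nextBdry R ^ k * M.nextBdry R ^ i) z = (M.nextBdry R ^ i * M.nextBdry R ^ k) z := by
          rw [← zpow_add, ← zpow_add, add_comm]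
        rw [Perm.mul_apply, Perm.mul_apply] at this
        rw [this]
        exact congrArg _ hwz
      · exact rotation_of_notMem hw hd
    have h2 := key ((u' : Perm D) * (u : Perm D)⁻¹)
      (Subgroup.mul_mem _ u'.2 (Subgroup.inv_mem _ u.2)) (by
        rw [Perm.mul_apply, h1]; simp)
    exact Subtype.ext (mul_inv_eq_one.1 h2).symm
  · rintro ⟨d, hd⟩
    obtain ⟨i, hi⟩ := nextBdry_sameCycle hM hR hz hd
    exact ⟨⟨(M.nextBdry R ^ i)⁻¹, Subgroup.inv_mem _ (Subgroup.zpow_mem_zpowers _ _)⟩,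
      Subtype.ext (by simpa using hi)⟩

theorem card_rotations (hM : M.IsSphere) (hR : M.IsDisk R) :
    Nat.card (Subgroup.zpowers (M.nextBdry R)) = (M.bdry R).ncard := by
  obtain ⟨z, hz⟩ := hR.bdry_nonempty hM
  exact Nat.card_congr (Equiv.ofBijective _ (rotation_bijective hM hR hz))

end rotationGroup

end CombMap

namespace CombMap

/-! ### Rotation along the boundary of a disc -/

section reglue

variable {D : Type} {M : CombMap D} {S R R' : Set D} {u : Perm D}

theorem reglue_edge_apply (d : D) : (M.reglue u).edge (u d) = u (M.edge d) := by
  simp [reglue]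

theorem reglue_mul (r : Perm D) : M.reglue (u * r) = (M.reglue r).reglue u := by
  simp only [reglue, mul_inv_rev, mul_assoc]

theorem reglue_one : M.reglue 1 = M := by
  simp [reglue]

variable [Finite D]

/-! ### Edges and vertices after a rotation -/

section edges

variable (hM : M.IsSphere) (hS : M.IsDisk S) (hu : u ∈ Subgroup.zpowers (M.nextBdry S))

include hM hS hu

theorem rotation_mem_iff (hSR : S ⊆ R) (d : D) : u d ∈ R ↔ d ∈ R := by
  by_cases hd : d ∈ M.bdry S
  · exact iff_of_true (hSR ((rotation_mem_bdry hM hS hu d).2 hd).1) (hSR hd.1)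
  · rw [rotation_of_notMem hu hd]

/-- `u` moves only the inner sides of the boundary cycle and fixes the outer ones, so the
conjugation shifts the matching between the two sides. -/
theorem reglue_edge_of_mem_bdry {d : D} (hd : d ∈ M.bdry S) :
    (M.reglue u).edge d = M.edge (u⁻¹ d) := by
  have h1 := (rotation_mem_bdry hM hS (Subgroup.inv_mem _ hu) d).2 hd
  have h2 := reglue_edge_apply (M := M) (u := u) (u⁻¹ d)
  rw [show u (u⁻¹ d) = d from u.apply_symm_apply d] at h2
  rw [h2]
  exact rotation_of_notMem hu fun h => h1.2 h.1

theorem reglue_edge_notMem {d : D} (hd : d ∈ M.bdry S) : (M.reglue u).edge d ∉ S := by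
  rw [reglue_edge_of_mem_bdry hM hS hu hd]
  exact ((rotation_mem_bdry hM hS (Subgroup.inv_mem _ hu) d).2 hd).2

omit hS in
theorem reglue_edge_of_edge_mem_bdry {d : D} (hd : M.edge d ∈ M.bdry S) :
    (M.reglue u).edge d = u (M.edge d) := by
  have h1 : u d = d := rotation_of_notMem hu fun h => hd.2 (by rw [hM.edge_edge]; exact h.1)
  conv_lhs => rw [← h1]
  exact reglue_edge_apply d

omit hM hS in
theorem reglue_edge_of_notMem {d : D} (hd : d ∉ M.bdry S) (hd' : M.edge d ∉ M.bdry S) :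
    (M.reglue u).edge d = M.edge d := by
  have h1 : u d = d := rotation_of_notMem hu hd
  conv_lhs => rw [← h1]
  rw [reglue_edge_apply]
  exact rotation_of_notMem hu hd'

omit hS in
theorem reglue_edge_of_mem {d : D} (hd : d ∈ S) (hd' : M.edge d ∈ S) :
    (M.reglue u).edge d = M.edge d :=
  reglue_edge_of_notMem hu (fun h => h.2 hd') fun h => h.2 (by rwa [hM.edge_edge])

omit hM hS in
theorem reglue_edge_of_not_mem_of_not_mem {d : D} (hd : d ∉ S) (hd' : M.edge d ∉ S) :
    (M.reglue u).edge d = M.edge d :=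
  reglue_edge_of_notMem hu (fun h => hd h.1) fun h => hd' h.1

/-- How rotation along a simple closed curve acts on vertices. -/
theorem exists_vertex_rotation : ∃ ψ : M.Vertex → M.Vertex, Function.Injective ψ ∧
    (∀ z ∈ M.bdry S, ψ (M.origin (u z)) = M.origin z) ∧
    ∀ v, (∀ z ∈ M.bdry S, M.origin z ≠ v) → ψ v = v := by
  classical
  have hui := rotation_mem_bdry hM hS (Subgroup.inv_mem _ hu)
  -- The boundary is simple, so the chosen dart is the only boundary dart with this origin.
  let ψ : M.Vertex → M.Vertex := fun v =>
    if h : ∃ z, z ∈ M.bdry S ∧ M.origin z = v then M.origin (u⁻¹ h.choose) else v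
  have h1 : ∀ z ∈ M.bdry S, ψ (M.origin z) = M.origin (u⁻¹ z) := by
    intro z hz
    have h : ∃ z', z' ∈ M.bdry S ∧ M.origin z' = M.origin z := ⟨z, hz, rfl⟩
    have h2 : h.choose = z := origin_injOn_bdry hM hS h.choose_spec.1 hz h.choose_spec.2
    simp only [ψ, dif_pos h, h2]
  have h2 : ∀ v, (∀ z ∈ M.bdry S, M.origin z ≠ v) → ψ v = v := fun v hv =>
    dif_neg fun ⟨z, hz, hzv⟩ => hv z hz hzv
  refine ⟨ψ, ?_, ?_, h2⟩
  · have key : ∀ v w, ψ v = ψ w → (∃ z ∈ M.bdry S, M.origin z = v) → v = w := by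
      rintro _ w h ⟨z, hz, rfl⟩
      rw [h1 z hz] at h
      by_cases hw : ∃ z ∈ M.bdry S, M.origin z = w
      · obtain ⟨z', hz', rfl⟩ := hw
        rw [h1 z' hz'] at h
        have := origin_injOn_bdry hM hS ((hui z).2 hz) ((hui z').2 hz') h
        rw [u⁻¹.injective this]
      · push Not at hw
        rw [h2 w hw] at h
        exact absurd h (hw _ ((hui z).2 hz))
    intro v w h
    by_cases hv : ∃ z ∈ M.bdry S, M.origin z = v
    · exact key v w h hv
    · by_cases hw : ∃ z ∈ M.bdry S, M.origin z = w
      · exact (key w v h.symm hw).symm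
      · push Not at hv hw
        rwa [h2 v hv, h2 w hw] at h
  · intro z hz
    rw [h1 _ ((rotation_mem_bdry hM hS hu z).2 hz)]
    simp

-- The label names the new origin of `d` by an old vertex: darts outside `S` keep their origin,
-- those in `S` have it turned back by `ψ`. Invariance under `rot` makes the label a function of the
-- new vertices. On entering `S` one arrives at the head of `u (M.edge d)`, the origin of the next
-- boundary dart; `u` commutes with `nextBdry`, and `ψ` undoes `u`.
open Classical in
theorem label_rot {ψ : M.Vertex → M.Vertex}
    (h1 : ∀ z ∈ M.bdry S, ψ (M.origin (u z)) = M.origin z) (d : D) :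
    (if (M.reglue u).rot d ∈ S then ψ (M.origin ((M.reglue u).rot d)) else
      M.origin ((M.reglue u).rot d)) = if d ∈ S then ψ (M.origin d) else M.origin d := by
  have hrot : (M.reglue u).rot d = M.face ((M.reglue u).edge d) := rfl
  by_cases hd : d ∈ S
  · by_cases hd' : M.edge d ∈ S
    · have : (M.reglue u).rot d = M.rot d := by
        rw [hrot, reglue_edge_of_mem hM hu hd hd']; rfl
      have h2 : M.rot d ∈ S := (hS.face_mem _).2 hd'
      rw [this, if_pos hd, if_pos h2, origin_rot]
    · have hb := (rotation_mem_bdry hM hS (Subgroup.inv_mem _ hu) d).2 ⟨hd, hd'⟩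
      have : (M.reglue u).rot d = M.rot (u⁻¹ d) := by
        rw [hrot, reglue_edge_of_mem_bdry hM hS hu ⟨hd, hd'⟩]; rfl
      have h2 : M.rot (u⁻¹ d) ∉ S := fun h => hb.2 ((hS.face_mem _).1 h)
      rw [this, if_pos hd, if_neg h2, origin_rot, ← h1 _ hb]
      simp
  · by_cases hd' : M.edge d ∈ S
    · have hb : M.edge d ∈ M.bdry S := ⟨hd', by rwa [hM.edge_edge]⟩
      have hb' := (rotation_mem_bdry hM hS hu _).2 hb
      have h2 : M.face (u (M.edge d)) ∈ S := (hS.face_mem _).2 hb'.1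
      rw [hrot, reglue_edge_of_edge_mem_bdry hM hu hb, if_pos h2, if_neg hd,
        origin_face hM.edge_edge, ← (nextBdry_spec hM hS hb').2, ← rotation_comm hu,
        h1 _ (nextBdry_spec hM hS hb).1, (nextBdry_spec hM hS hb).2, hM.edge_edge]
    · have : (M.reglue u).rot d = M.rot d := by
        rw [hrot, reglue_edge_of_not_mem_of_not_mem hu hd hd']; rfl
      have h2 : M.rot d ∉ S := fun h => hd' ((hS.face_mem _).1 h)
      rw [this, if_neg hd, if_neg h2, origin_rot]

-- Edges strictly inside or outside `S` are kept, so both sides stay connected, and any boundary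
-- edge still joins them.
omit hM in
theorem reglue_connected (hM : M.IsSphere) (d d' : D) :
    ∃ g ∈ Subgroup.closure {(M.reglue u).face, (M.reglue u).edge}, g d = d' := by
  set G := Subgroup.closure {(M.reglue u).face, (M.reglue u).edge} with hG
  have hf : M.face ∈ G := Subgroup.subset_closure (by simp [reglue])
  have he : (M.reglue u).edge ∈ G := Subgroup.subset_closure (by simp)
  have iff_mul : ∀ g ∈ G, ∀ x y, (∃ h ∈ G, h x = g y) ↔ ∃ h ∈ G, h x = y := by
    intro g hg x y
    constructor
    · rintro ⟨h, hh, e⟩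
      exact ⟨g⁻¹ * h, G.mul_mem (G.inv_mem hg) hh, by simp [e]⟩
    · rintro ⟨h, hh, rfl⟩
      exact ⟨g * h, G.mul_mem hg hh, rfl⟩
  have hin : ∀ x ∈ S, ∀ y ∈ S, ∃ h ∈ G, h x = y := by
    intro x hx y hy
    refine hS.conn (fun y => ∃ h ∈ G, h x = y) (fun y _ => iff_mul _ hf x y) (fun y h1 h2 => ?_)
      x hx y hy ⟨1, G.one_mem, rfl⟩
    have := iff_mul _ he x y
    rwa [reglue_edge_of_mem hM hu h1 h2] at this
  have hout : ∀ x ∉ S, ∀ y ∉ S, ∃ h ∈ G, h x = y := by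
    intro x hx y hy
    refine hS.compl_conn (fun y => ∃ h ∈ G, h x = y) (fun y _ => iff_mul _ hf x y)
      (fun y h1 h2 => ?_) x hx y hy ⟨1, G.one_mem, rfl⟩
    have := iff_mul _ he x y
    rwa [reglue_edge_of_not_mem_of_not_mem hu h1 h2] at this
  obtain ⟨z, hz⟩ := hS.bdry_nonempty hM
  have hz' := reglue_edge_notMem hM hS hu hz
  have trans : ∀ x y w, (∃ h ∈ G, h x = y) → (∃ h ∈ G, h y = w) → ∃ h ∈ G, h x = w := by
    rintro x y w ⟨h, hh, rfl⟩ ⟨k, hk, rfl⟩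
    exact ⟨k * h, G.mul_mem hk hh, rfl⟩
  have symm : ∀ x y, (∃ h ∈ G, h x = y) → (∃ h ∈ G, h y = x) := by
    rintro x y ⟨h, hh, rfl⟩
    exact ⟨h⁻¹, G.inv_mem hh, by simp⟩
  have hall : ∀ x, ∃ h ∈ G, h z = x := by
    intro x
    by_cases hx : x ∈ S
    · exact hin z hz.1 x hx
    · exact trans _ _ _ ⟨_, he, rfl⟩ (hout _ hz' x hx)
  exact trans _ _ _ (symm _ _ (hall d)) (hall d')

open Classical in
/-- Rotation along the boundary of a disc gives a map of the sphere without loops, and the vertices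
of the two maps correspond. -/
theorem reglue_isSphere_and_label {ψ : M.Vertex → M.Vertex} (hψ : Function.Injective ψ)
    (h1 : ∀ z ∈ M.bdry S, ψ (M.origin (u z)) = M.origin z)
    (h2 : ∀ v, (∀ z ∈ M.bdry S, M.origin z ≠ v) → ψ v = v) :
    (M.reglue u).IsSphere ∧
      ∃ Λ : (M.reglue u).Vertex → M.Vertex, Function.Bijective Λ ∧
        ∀ d, Λ ((M.reglue u).origin d) = if d ∈ S then ψ (M.origin d) else M.origin d := by
  have hpow : ∀ (k : ℕ) d, (if ((M.reglue u).rot ^ k) d ∈ S then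
      ψ (M.origin (((M.reglue u).rot ^ k) d)) else M.origin (((M.reglue u).rot ^ k) d)) =
      if d ∈ S then ψ (M.origin d) else M.origin d := by
    intro k
    induction k with
    | zero => intro d; rfl
    | succ k ih => intro d; rw [pow_succ', Perm.mul_apply, label_rot hM hS hu h1, ih]
  have hlift : ∀ d d' : D, (M.reglue u).rot.SameCycle d d' →
      (if d ∈ S then ψ (M.origin d) else M.origin d) =
        if d' ∈ S then ψ (M.origin d') else M.origin d' := by
    intro d d' h
    obtain ⟨k, -, rfl⟩ := h.exists_pow_eq'
    exact (hpow k d).symm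
  let Λ : (M.reglue u).Vertex → M.Vertex := Quotient.lift _ hlift
  have hΛ : ∀ d, Λ ((M.reglue u).origin d) = if d ∈ S then ψ (M.origin d) else M.origin d :=
    fun d => rfl
  have hsurj : Function.Surjective Λ := by
    intro v
    by_cases hv : ∃ d, d ∉ S ∧ M.origin d = v
    · obtain ⟨d, hd, rfl⟩ := hv
      exact ⟨(M.reglue u).origin d, by rw [hΛ, if_neg hd]⟩
    · push Not at hv
      obtain ⟨d, rfl⟩ : ∃ d, M.origin d = v := Quotient.exists_rep v
      have hdS : d ∈ S := by
        by_contra h; exact hv d h rfl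
      refine ⟨(M.reglue u).origin d, ?_⟩
      rw [hΛ, if_pos hdS]
      -- A vertex with all its darts in `S` is off the boundary cycle: for a boundary dart `z`, the
      -- dart `M.rot z` is outside `S`.
      refine h2 _ fun z hz hzd => hv (M.rot z) (fun h => hz.2 ((hS.face_mem _).1 h)) ?_
      rw [origin_rot, hzd]
  have hne : ∀ d, (M.reglue u).edge d ≠ d := by
    intro d hd
    have h := reglue_edge_apply (M := M) (u := u) (u⁻¹ d)
    rw [show u (u⁻¹ d) = d from u.apply_symm_apply d, hd] at h
    apply hM.edge_ne (u⁻¹ d)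
    apply u.injective
    rw [← h]
    exact (u.apply_symm_apply d).symm
  have hee : ∀ d, (M.reglue u).edge ((M.reglue u).edge d) = d := by
    intro d
    obtain ⟨x, rfl⟩ := u.surjective d
    rw [reglue_edge_apply, reglue_edge_apply, hM.edge_edge]
  have hc := reglue_connected hS hu hM
  have : Nonempty D := ⟨hS.nonempty.choose⟩
  have heu := euler_le hne hee hc
  have hE := card_darts hne hee
  have hE' := card_darts hM.edge_ne hM.edge_edge
  have heM := hM.euler
  have hF : Nat.card (M.reglue u).Face = Nat.card M.Face := rfl
  have hV := Nat.card_le_card_of_surjective Λ hsurj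
  -- Surjectivity of `Λ` bounds the number of new vertices from below, and `euler_le` from above, as
  -- edges and faces are equally many in both maps.
  have hVeq : Nat.card (M.reglue u).Vertex = Nat.card M.Vertex := by omega
  refine ⟨⟨hne, hee, hc, by omega, ?_⟩, Λ, ?_, hΛ⟩
  · intro d hd
    have h := congrArg Λ hd
    rw [hΛ, hΛ] at h
    by_cases hdS : d ∈ S
    · by_cases hdS' : M.edge d ∈ S
      · rw [reglue_edge_of_mem hM hu hdS hdS', if_pos hdS, if_pos hdS'] at h
        exact hM.loopless d (hψ h)
      · have hb := (rotation_mem_bdry hM hS (Subgroup.inv_mem _ hu) d).2 ⟨hdS, hdS'⟩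
        rw [reglue_edge_of_mem_bdry hM hS hu ⟨hdS, hdS'⟩, if_pos hdS, if_neg hb.2] at h
        have h3 := h1 _ hb
        rw [show u (u⁻¹ d) = d from u.apply_symm_apply d] at h3
        rw [h3] at h
        exact hM.loopless _ h
    · by_cases hdS' : M.edge d ∈ S
      · have hb : M.edge d ∈ M.bdry S := ⟨hdS', by rwa [hM.edge_edge]⟩
        rw [reglue_edge_of_edge_mem_bdry hM hu hb, if_neg hdS,
          if_pos ((rotation_mem_bdry hM hS hu _).2 hb).1, h1 _ hb] at h
        exact hM.loopless d h
      · rw [reglue_edge_of_not_mem_of_not_mem hu hdS hdS', if_neg hdS, if_neg hdS'] at h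
        exact hM.loopless d h
  · exact (Nat.bijective_iff_surjective_and_card Λ).2 ⟨hsurj, hVeq⟩

theorem IsSphere.reglue : (M.reglue u).IsSphere := by
  obtain ⟨ψ, hψ, h1, h2⟩ := exists_vertex_rotation hM hS hu
  exact (reglue_isSphere_and_label hM hS hu hψ h1 h2).1

/-! #### Discs inside the rotated disc -/

section inside

variable (hRS : R ⊆ S)

include hRS

theorem reglue_edge_of_mem_of_subset {d : D} (hd : d ∈ R) (h : M.edge d ∈ R) :
    (M.reglue u).edge d = M.edge d :=
  have := hS
  reglue_edge_of_mem hM hu (hRS hd) (hRS h)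

theorem reglue_edge_mem_iff_of_subset {d : D} (hd : d ∈ R) :
    (M.reglue u).edge d ∈ R ↔ M.edge d ∈ R := by
  by_cases h : M.edge d ∈ S
  · rw [reglue_edge_of_mem hM hu (hRS hd) h]
  · exact iff_of_false (fun h' => reglue_edge_notMem hM hS hu ⟨hRS hd, h⟩ (hRS h'))
      fun h' => h (hRS h')

theorem bdry_reglue_of_subset : (M.reglue u).bdry R = M.bdry R := by
  ext d
  exact and_congr_right fun hd => not_congr (reglue_edge_mem_iff_of_subset hM hS hu hRS hd)

/-- The walk crosses only edges with both sides in `R ⊆ S`, and these are not changed. -/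
theorem nextBdry_reglue_of_subset : (M.reglue u).nextBdry R = M.nextBdry R := by
  have hee := (IsSphere.reglue hM hS hu).edge_edge
  have h : (M.reglue u).innerCross R = M.innerCross R := by
    ext d
    by_cases hd : d ∈ R ∧ M.edge d ∈ R
    · have h1 := (reglue_edge_mem_iff_of_subset hM hS hu hRS hd.1).2 hd.2
      rw [innerCross_of_mem hee hd.1 h1, innerCross_of_mem hM.edge_edge hd.1 hd.2,
        reglue_edge_of_mem_of_subset hM hS hu hRS hd.1 hd.2]
    · rw [innerCross, innerCross, if_neg (fun h => hd ⟨h.1,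
        (reglue_edge_mem_iff_of_subset hM hS hu hRS h.1).1 h.2.1⟩), if_neg (fun h => hd ⟨h.1, h.2.1⟩)]
  have h2 : ((M.reglue u).innerCross_involutive R).toPerm = (M.innerCross_involutive R).toPerm := by
    ext d; exact congrFun h d
  rw [nextBdry, nextBdry, h2, bdry_reglue_of_subset hM hS hu hRS]
  rfl

end inside

/-! #### Discs containing the rotated disc -/

section outside

variable (hSR : S ⊆ R)

include hSR

theorem mem_bdry_reglue_of_superset (d : D) : u d ∈ (M.reglue u).bdry R ↔ d ∈ M.bdry R := by
  have h := rotation_mem_iff hM hS hu hSR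
  show u d ∈ R ∧ (M.reglue u).edge (u d) ∉ R ↔ d ∈ R ∧ M.edge d ∉ R
  rw [reglue_edge_apply, h, h]

theorem bdry_reglue_of_superset : (M.reglue u).bdry R = u '' M.bdry R := by
  ext d
  obtain ⟨x, rfl⟩ := u.surjective d
  rw [mem_bdry_reglue_of_superset hM hS hu hSR, u.injective.mem_set_image]

/-- The walk that defines `nextBdry` may turn through `S`, where the two maps show different darts,
so it cannot be compared step by step. Instead a boundary dart is recognised by its origin, since
the boundary of `R` is simple in both maps, and origins are compared through `Λ`. -/
theorem nextBdry_reglue_of_superset (hR : M.IsDisk R) (hR' : (M.reglue u).IsDisk R) (d : D) :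
    (M.reglue u).nextBdry R (u d) = u (M.nextBdry R d) := by
  classical
  obtain ⟨ψ, hψ, h1, h2⟩ := exists_vertex_rotation hM hS hu
  obtain ⟨hM', Λ, hΛ, hΛ'⟩ := reglue_isSphere_and_label hM hS hu hψ h1 h2
  have hb := mem_bdry_reglue_of_superset hM hS hu hSR
  by_cases hd : d ∈ M.bdry R
  · obtain ⟨h3, h4⟩ := nextBdry_spec hM hR hd
    obtain ⟨h5, h6⟩ := nextBdry_spec hM' hR' ((hb d).2 hd)
    refine origin_injOn_bdry hM' hR' h5 ((hb _).2 h3) (hΛ.1 ?_)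
    have hd' : M.edge d ∉ S := fun h => hd.2 (hSR h)
    rw [h6, reglue_edge_apply, rotation_of_notMem hu fun h => hd' h.1, hΛ', if_neg hd', hΛ', ← h4]
    by_cases h7 : M.nextBdry R d ∈ S
    · rw [if_pos ((rotation_mem_iff hM hS hu subset_rfl _).2 h7),
        h1 _ ⟨h7, fun h => h3.2 (hSR h)⟩]
    · rw [rotation_of_notMem hu fun h => h7 h.1, if_neg h7]
  · rw [nextBdry_of_notMem hd, nextBdry_of_notMem fun h => hd ((hb d).1 h)]

end outside

theorem ncard_bdry_reglue (h : R ⊆ S ∨ S ⊆ R) :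
    ((M.reglue u).bdry R).ncard = (M.bdry R).ncard := by
  rcases h with h | h
  · rw [bdry_reglue_of_subset hM hS hu h]
  · rw [bdry_reglue_of_superset hM hS hu h, Set.ncard_image_of_injective _ u.injective]

/-- The bijection `Λ` preserves interior vertices. If `R ⊆ S`, a vertex interior to `R` is off the
boundary of `S` and `ψ` fixes it. If `S ⊆ R`, only darts outside `S` can fail to lie in `R`, and
these keep their origin. -/
theorem ncard_interiorVertices_reglue (h : R ⊆ S ∨ S ⊆ R) :
    ((M.reglue u).interiorVertices R).ncard = (M.interiorVertices R).ncard := by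
  classical
  obtain ⟨ψ, hψ, h1, h2⟩ := exists_vertex_rotation hM hS hu
  obtain ⟨hM', Λ, hΛ, hΛ'⟩ := reglue_isSphere_and_label hM hS hu hψ h1 h2
  suffices Λ '' (M.reglue u).interiorVertices R = M.interiorVertices R by
    rw [← this, Set.ncard_image_of_injective _ hΛ.1]
  ext v
  obtain ⟨v', rfl⟩ := hΛ.2 v
  rw [hΛ.1.mem_set_image]
  have h3 : v' ∈ (M.reglue u).interiorVertices R ↔
      ∀ d, (if d ∈ S then ψ (M.origin d) else M.origin d) = Λ v' → d ∈ R :=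
    forall_congr' fun d => by rw [← hΛ', hΛ.1.eq_iff]
  have h4 : Λ v' ∈ M.interiorVertices R ↔ ∀ d, M.origin d = Λ v' → d ∈ R := Iff.rfl
  rw [h3, h4]
  generalize Λ v' = v
  have hrot : ∀ z ∈ M.bdry S, M.rot z ∉ S := fun z hz h => hz.2 ((hS.face_mem _).1 h)
  rcases h with h | h
  · constructor
    · intro hv
      have h5 : ψ v = v := h2 v fun z hz hzv => hrot z hz (h (hv _ (by
        rw [if_neg (hrot z hz), origin_rot, hzv])))
      intro d hd
      apply hv
      split_ifs
      · rw [hd, h5]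
      · exact hd
    · intro hv
      have h5 : ψ v = v := h2 v fun z hz hzv => hrot z hz (h (hv _ (by rw [origin_rot, hzv])))
      intro d hd
      split_ifs at hd
      · exact hv d (hψ (hd.trans h5.symm))
      · exact hv d hd
  · constructor
    · intro hv d hd
      by_cases hdS : d ∈ S
      · exact h hdS
      · exact hv d (by rw [if_neg hdS, hd])
    · intro hv d hd
      by_cases hdS : d ∈ S
      · exact h hdS
      · rw [if_neg hdS] at hd
        exact hv d hd

theorem size_reglue (h : R ⊆ S ∨ S ⊆ R) : (M.reglue u).size R = M.size R := by
  rw [size, size, ncard_bdry_reglue hM hS hu h, ncard_interiorVertices_reglue hM hS hu h]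

/-- The necklace meets `S` only in darts that face the outer hole, and the new `edge` is the
conjugate by `u`. So `u` itself is the isomorphism. -/
theorem between_reglue_of_superset (hSR' : S ⊆ R') (hRR : R' ⊆ R) (hR : M.IsDisk R)
    (hR' : M.IsDisk R') (hRr : (M.reglue u).IsDisk R) (hRr' : (M.reglue u).IsDisk R') :
    (M.between R R').Iso ((M.reglue u).between R R') := by
  classical
  have hb := mem_bdry_reglue_of_superset hM hS hu (hSR'.trans hRR)
  have hb' := mem_bdry_reglue_of_superset hM hS hu hSR'
  have hm := rotation_mem_iff hM hS hu (hSR'.trans hRR)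
  have hm' := rotation_mem_iff hM hS hu hSR'
  refine ⟨u, fun d => ?_, fun d => ?_, fun d => hb' d, fun d hd => ⟨reglue_edge_apply d, ?_⟩⟩
  · simp only [between, Set.mem_union, Set.mem_sdiff, Set.mem_ofPred_eq, hm, hm', reglue_edge_apply,
      hb, hb']
  · simp only [between, Set.mem_ofPred_eq, reglue_edge_apply, hb]
  · simp only [between, reglue_edge_apply, hb, hb']
    simp only [between, Set.mem_union, Set.mem_sdiff, Set.mem_ofPred_eq] at hd
    split_ifs with h1 h2
    · exact nextBdry_reglue_of_superset hM hS hu hSR' hR' hRr' d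
    · refine (congrArg _ ?_).trans (reglue_edge_apply _)
      rw [Perm.inv_eq_iff_eq, nextBdry_reglue_of_superset hM hS hu (hSR'.trans hRR) hR hRr]
      simp
    · have h3 : d ∉ S := fun h => by
        rcases hd with (hd | hd) | hd
        · exact hd.2 (hSR' h)
        · exact h2 hd
        · exact h1 hd
      have h4 : M.face d ∉ S := fun h => h3 ((hS.face_mem d).1 h)
      rw [rotation_of_notMem hu fun h => h3 h.1, rotation_of_notMem hu fun h => h4 h.1]
      rfl

/-- Turning `S` by `u` is the same gluing as leaving `S` in place and turning the outer sides of its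
boundary by `u⁻¹`. The latter is `M.edge * u⁻¹ * M.edge`, which fixes `S` pointwise and moves at
most darts of the inner hole of the necklace. -/
theorem between_reglue_of_subset (hRS : R ⊆ S) (hRR : R' ⊆ R) (hR : M.IsDisk R)
    (hR' : M.IsDisk R') :
    (M.between R R').Iso ((M.reglue u).between R R') := by
  classical
  have hee := hM.edge_edge
  set f : Perm D := M.edge * u⁻¹ * M.edge with hf
  have hmb := rotation_mem_bdry hM hS hu
  have hmb' := rotation_mem_bdry hM hS (Subgroup.inv_mem _ hu)
  have huinv : u⁻¹ ∈ Subgroup.zpowers (M.nextBdry S) := Subgroup.inv_mem _ hu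
  have hfS : ∀ d ∈ S, f d = d := by
    intro d hd
    have h1 : M.edge d ∉ M.bdry S := fun h => h.2 (by rwa [hee])
    simp only [hf, Perm.mul_apply]
    rw [rotation_of_notMem huinv h1, hee]
  have hfb : ∀ d, M.edge d ∈ M.bdry S → f d = M.edge (u⁻¹ (M.edge d)) := fun d _ => rfl
  have hfn : ∀ d, M.edge d ∉ M.bdry S → f d = d := by
    intro d hd
    simp only [hf, Perm.mul_apply]
    rw [rotation_of_notMem huinv hd, hee]
  have hfm : ∀ d, f d ∈ S → f d = d := by
    intro d hd
    by_cases h : M.edge d ∈ M.bdry S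
    · exact absurd hd ((hmb' _).2 h).2
    · exact hfn d h
  have hfe : ∀ d, (M.reglue u).edge (f d) = f (M.edge d) := by
    intro d
    by_cases h1 : M.edge d ∈ M.bdry S
    · have h2 : u⁻¹ (M.edge d) ∈ M.bdry S := (hmb' _).2 h1
      rw [hfb d h1, reglue_edge_of_edge_mem_bdry hM hu (by rwa [hee]), hee, hfS _ h1.1]
      simp
    · rw [hfn d h1]
      by_cases h2 : d ∈ M.bdry S
      · rw [reglue_edge_of_mem_bdry hM hS hu h2, hfb _ (by rwa [hee]), hee]
      · rw [reglue_edge_of_notMem hu h2 h1, hfn _ (by rwa [hee])]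
  have hfR : ∀ Q ⊆ S, ∀ d, f d ∈ Q ↔ d ∈ Q := by
    intro Q hQ d
    constructor
    · intro h
      rwa [hfm d (hQ h)] at h
    · intro h
      rwa [hfS d (hQ h)]
  have hbR := hfR (M.bdry R) fun d hd => hRS hd.1
  have hbR' := hfR (M.bdry R') fun d hd => hRS (hRR hd.1)
  have hmR := hfR R hRS
  have hmR' := hfR R' (hRR.trans hRS)
  have eb := bdry_reglue_of_subset hM hS hu hRS
  have eb' := bdry_reglue_of_subset hM hS hu (hRR.trans hRS)
  have en := nextBdry_reglue_of_subset hM hS hu hRS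
  have en' := nextBdry_reglue_of_subset hM hS hu (hRR.trans hRS)
  refine ⟨f, fun d => ?_, fun d => ?_, fun d => ?_, fun d hd => ⟨hfe d, ?_⟩⟩
  · simp only [between, Set.mem_union, Set.mem_sdiff, Set.mem_ofPred_eq, eb, eb', hfe, hbR, hbR',
      hmR, hmR']
  · simp only [between, Set.mem_ofPred_eq, eb, hfe, hbR]
  · simp only [between, eb', hbR']
  · simp only [between, eb, eb', en, en', hfe, hbR, hbR']
    simp only [between, Set.mem_union, Set.mem_sdiff, Set.mem_ofPred_eq] at hd
    split_ifs with h1 h2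
    · rw [hfS d (hRS (hRR h1.1)), hfS _ (hRS (hRR (nextBdry_spec hM hR' h1).1.1))]
    · have h3 : (M.nextBdry R)⁻¹ (M.edge d) ∈ M.bdry R := by
        rw [← nextBdry_mem_iff hM hR]; simpa using h2
      rw [hfS _ (hRS h2.1), ← hfe, hfS _ (hRS h3.1)]
    · have h3 : d ∈ R := by
        rcases hd with (hd | hd) | hd
        · exact hd.1
        · exact absurd hd h2
        · exact absurd hd h1
      rw [hfS _ (hRS h3), hfS _ (hRS ((hR.face_mem d).2 h3))]
      rfl

end edges

end reglue

end CombMap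

theorem Equiv.Perm.apply_mem_iff_of_forall_mem {D : Type} [Finite D] (π : Perm D) {S : Set D}
    (h : ∀ d ∈ S, π d ∈ S) (d : D) : π d ∈ S ↔ d ∈ S := by
  refine ⟨fun hd => ?_, h d⟩
  have hpow : ∀ (k : ℕ) (x : D), x ∈ S → (π ^ k) x ∈ S := by
    intro k
    induction k with
    | zero => intro x hx; simpa using hx
    | succ k ih => intro x hx; rw [pow_succ', Perm.mul_apply]; exact h _ (ih x hx)
  have h1 : (π ^ (orderOf π - 1)) (π d) = d := by
    rw [← Perm.mul_apply, ← pow_succ, Nat.sub_add_cancel (orderOf_pos π), pow_orderOf_eq_one]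
    rfl
  rw [← h1]
  exact hpow _ _ hd

namespace CombMap

/-! ### The regions of an exploration -/

section regions

variable {D : Type} {M : CombMap D} {a b : D} {γ δ : List D}

theorem explored_mono (h : γ ⊆ δ) : M.explored a γ ⊆ M.explored a δ := by
  rintro d ⟨s, hs, hd⟩
  exact ⟨s, List.cons_subset_cons a h hs, hd⟩

theorem face_mem_explored (d : D) : M.face d ∈ M.explored a γ ↔ d ∈ M.explored a γ := by
  simp only [explored, Set.mem_ofPred_eq, faceOf_face]

theorem source_mem_explored : a ∈ M.explored a γ := ⟨a, by simp, rfl⟩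

theorem mem_explored_of_mem {s : D} (hs : s ∈ γ) : s ∈ M.explored a γ := ⟨s, by simp [hs], rfl⟩

theorem target_mem_region : b ∈ M.region a b γ := Relation.ReflTransGen.refl

theorem region_anti (h : γ ⊆ δ) : M.region a b δ ⊆ M.region a b γ := fun _ hd =>
  Relation.ReflTransGen.mono (fun _ _ hxy => ⟨hxy.1, fun h' => hxy.2 (explored_mono h h')⟩) _ _ hd

theorem notMem_explored_of_mem_region (hb : b ∉ M.explored a γ) {d : D}
    (hd : d ∈ M.region a b γ) : d ∉ M.explored a γ := by
  rcases Relation.ReflTransGen.cases_tail hd with rfl | ⟨x, -, hx⟩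
  · exact hb
  · exact hx.2

theorem edge_mem_region {d : D} (hd : d ∈ M.region a b γ) (h : M.edge d ∉ M.explored a γ) :
    M.edge d ∈ M.region a b γ :=
  Relation.ReflTransGen.tail hd ⟨Or.inr rfl, h⟩

theorem edge_mem_explored_of_mem_bdry {d : D} (hd : d ∈ M.bdry (M.region a b γ)) :
    M.edge d ∈ M.explored a γ := by
  by_contra h
  exact hd.2 (edge_mem_region hd.1 h)

variable [Finite D]

theorem face_mem_region (hb : b ∉ M.explored a γ) (d : D) :
    M.face d ∈ M.region a b γ ↔ d ∈ M.region a b γ :=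
  Perm.apply_mem_iff_of_forall_mem M.face (fun d hd => Relation.ReflTransGen.tail hd
    ⟨Or.inl rfl, fun h => notMem_explored_of_mem_region hb hd ((face_mem_explored d).1 h)⟩) d

/-- A property that is constant around faces and across the edges crossed by the seeds is constant
on the explored faces. -/
theorem explored_connected
    (hseed : ∀ i (hi : i < γ.length), γ[i] ∈ M.bdry (M.regionAt a b γ i)) {P : D → Prop}
    (hf : ∀ d ∈ M.explored a γ, P (M.face d) ↔ P d)
    (he : ∀ d ∈ M.explored a γ, M.edge d ∈ M.explored a γ → (P (M.edge d) ↔ P d)) :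
    ∀ d ∈ M.explored a γ, (P d ↔ P a) := by
  have hface : ∀ d s : D, s ∈ M.explored a γ → M.faceOf d = M.faceOf s → (P d ↔ P s) := by
    intro d s hs h
    obtain ⟨k, -, rfl⟩ := (Quotient.exact h : M.face.SameCycle d s).symm.exists_pow_eq'
    have key : ∀ k : ℕ, (M.face ^ k) s ∈ M.explored a γ ∧ (P ((M.face ^ k) s) ↔ P s) := by
      intro k
      induction k with
      | zero => exact ⟨by simpa using hs, Iff.rfl⟩
      | succ k ih =>
        rw [pow_succ', Perm.mul_apply]
        exact ⟨(face_mem_explored _).2 ih.1, (hf _ ih.1).trans ih.2⟩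
    exact (key k).2
  have key : ∀ i, i ≤ γ.length → ∀ d ∈ M.explored a (γ.take i), (P d ↔ P a) := by
    intro i
    induction i with
    | zero =>
      rintro - d ⟨s, hs, hd⟩
      rw [List.take_zero, List.mem_singleton] at hs
      subst hs
      exact hface d s source_mem_explored hd
    | succ i ih =>
      rintro hi d ⟨s, hs, hd⟩
      by_cases hs' : s ∈ a :: γ.take i
      · exact ih (by omega) d ⟨s, hs', hd⟩
      · have hsi : s = γ[i] := by
          rw [List.take_succ_eq_append_getElem (by omega), List.mem_cons, List.mem_append,
            List.mem_singleton] at hs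
          rw [List.mem_cons] at hs'
          tauto
        subst hsi
        have hmem : γ[i] ∈ M.explored a γ := mem_explored_of_mem (List.getElem_mem _)
        have h1 := edge_mem_explored_of_mem_bdry (hseed i (by omega))
        have h2 := explored_mono (List.take_subset i γ) h1
        rw [hface d _ hmem hd, ← he _ hmem h2]
        exact ih (by omega) _ h1
  intro d hd
  refine key γ.length le_rfl d ?_
  rwa [List.take_length]

/-- The region is connected by construction. Its complement consists of the explored faces, chained
together by the seeds, and of enclosed components. A path in the connected map that leaves the
region arrives on an explored face, so the enclosed components are attached to explored faces. -/
theorem region_isDisk (hM : M.IsSphere) (hb : b ∉ M.explored a γ)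
    (hseed : ∀ i (hi : i < γ.length), γ[i] ∈ M.bdry (M.regionAt a b γ i)) :
    M.IsDisk (M.region a b γ) where
  nonempty := ⟨b, target_mem_region⟩
  compl_nonempty := ⟨a, fun h => notMem_explored_of_mem_region hb h source_mem_explored⟩
  face_mem := face_mem_region hb
  conn := by
    intro P hf he
    have key : ∀ d, d ∈ M.region a b γ → (P d ↔ P b) := by
      intro d hd
      induction hd with
      | refl => exact Iff.rfl
      | tail hx hxy ih =>
        have hy := Relation.ReflTransGen.tail hx hxy
        rcases hxy.1 with rfl | rfl
        · exact (hf _ hx).trans ih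
        · exact (he _ hx hy).trans ih
    intro d hd d' hd' h
    exact (key d' hd').2 ((key d hd).1 h)
  compl_conn := by
    intro P hf he
    have hex : ∀ d ∈ M.explored a γ, d ∉ M.region a b γ := fun d hd h =>
      notMem_explored_of_mem_region hb h hd
    have h1 := explored_connected hseed (P := P) (fun d hd => hf d (hex d hd))
      (fun d hd hd' => he d (hex d hd) (hex _ hd'))
    have key : ∀ d, d ∈ M.region a b γ ∨ (P d ↔ P a) := by
      intro d
      refine connected_induction hM.connected
        (P := fun d => d ∈ M.region a b γ ∨ (P d ↔ P a)) ?_ ?_ (Or.inr Iff.rfl : _ ∨ (P a ↔ P a)) d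
      · rintro x hx
        by_cases h : x ∈ M.region a b γ
        · exact Or.inl ((face_mem_region hb x).2 h)
        · exact Or.inr ((hf x h).trans (hx.resolve_left h))
      · rintro x hx
        by_cases h' : M.edge x ∈ M.region a b γ
        · exact Or.inl h'
        right
        by_cases h : x ∈ M.region a b γ
        · exact h1 _ (edge_mem_explored_of_mem_bdry ⟨h, h'⟩)
        · exact (he x h h').trans (hx.resolve_left h)
    intro d hd d' hd' h
    exact ((key d').resolve_left hd').2 (((key d).resolve_left hd).1 h)

end regions

/-! ### Complete explorations and their invariance under rotation -/

section exploration

variable {D : Type} {M : CombMap D} {a b : D} {γ : List D}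

/-- `γ` is the list of the seeds of a complete exploration from the source to the target. -/
structure IsExploration (M : CombMap D) (a b : D) (γ : List D) : Prop where
  source_ne : M.faceOf a ≠ M.faceOf b
  ne_nil : γ ≠ []
  seed : ∀ i (hi : i < γ.length), γ[i] ∈ M.bdry (M.regionAt a b γ i)
  target : ∀ i (hi : i < γ.length), M.faceOf γ[i] = M.faceOf b ↔ i + 1 = γ.length

theorem regionAt_anti {i k : ℕ} (h : i ≤ k) : M.regionAt a b γ k ⊆ M.regionAt a b γ i :=
  region_anti (List.take_subset_take_left γ h)

theorem target_notMem_explored_iff : b ∉ M.explored a γ ↔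
    M.faceOf a ≠ M.faceOf b ∧ ∀ s ∈ γ, M.faceOf s ≠ M.faceOf b := by
  simp only [explored, Set.mem_ofPred_eq, List.mem_cons, not_exists, not_and]
  constructor
  · intro h
    exact ⟨fun h' => h a (Or.inl rfl) h'.symm, fun s hs h' => h s (Or.inr hs) h'.symm⟩
  · rintro ⟨h1, h2⟩ s (rfl | hs) h
    exacts [h1 h.symm, h2 s hs h.symm]

/-- The faces entered by an exploration are distinct. -/
theorem nodup_faces (hseed : ∀ i (hi : i < γ.length), γ[i] ∈ M.bdry (M.regionAt a b γ i))
    (hb : ∀ k < γ.length, b ∉ M.explored a (γ.take k)) :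
    ((a :: γ).map M.faceOf).Nodup := by
  rw [List.map_cons, List.nodup_cons]
  constructor
  · intro hmem
    obtain ⟨s, hs, hsa⟩ := List.mem_map.1 hmem
    obtain ⟨i, hi, rfl⟩ := List.mem_iff_getElem.1 hs
    exact notMem_explored_of_mem_region (hb i hi) (hseed i hi).1 ⟨a, by simp, hsa⟩
  · rw [List.nodup_iff_injective_getElem]
    intro ⟨i, hi⟩ ⟨k, hk⟩ hik
    rw [List.length_map] at hi hk
    have key : ∀ i k (hi : i < γ.length) (hk : k < γ.length), i < k →
        M.faceOf γ[i] ≠ M.faceOf γ[k] := by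
      intro i k hi hk hik he
      refine notMem_explored_of_mem_region (hb k hk) (hseed k hk).1 ⟨γ[i], ?_, he.symm⟩
      exact List.mem_cons_of_mem _ (List.mem_take_iff_getElem.2 ⟨i, by omega, rfl⟩)
    simp only [List.getElem_map] at hik
    rcases lt_trichotomy i k with h1 | h1 | h1
    · exact absurd hik (key i k hi hk h1)
    · exact Fin.ext h1
    · exact absurd hik.symm (key k i hk hi h1)

namespace IsExploration

variable (h : M.IsExploration a b γ) {i j k : ℕ}

include h

theorem length_pos : 0 < γ.length := List.length_pos_iff.2 h.ne_nil

theorem target_notMem (hk : k < γ.length) : b ∉ M.explored a (γ.take k) := by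
  rw [target_notMem_explored_iff]
  refine ⟨h.source_ne, fun s hs hsb => ?_⟩
  obtain ⟨i, hi, rfl⟩ := List.mem_take_iff_getElem.1 hs
  have := (h.target i (by omega)).1 hsb
  omega

theorem seed_take (i : ℕ) (hi : i < (γ.take k).length) :
    (γ.take k)[i] ∈ M.bdry (M.regionAt a b (γ.take k) i) := by
  have hik : i < k := by rw [List.length_take] at hi; omega
  have := h.seed i (by rw [List.length_take] at hi; omega)
  rw [List.getElem_take, regionAt, List.take_take, min_eq_left hik.le]
  exact this

omit h in
theorem seed_mem_explored (hik : i < k) (hi : i < γ.length) :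
    γ[i] ∈ M.explored a (γ.take k) :=
  mem_explored_of_mem (List.mem_take_iff_getElem.2 ⟨i, by omega, rfl⟩)

theorem notMem_explored (hk : k < γ.length) {d : D} (hd : d ∈ M.regionAt a b γ k) :
    d ∉ M.explored a (γ.take k) :=
  notMem_explored_of_mem_region (h.target_notMem hk) hd

omit h in
theorem explored_take_mono (hik : i ≤ k) : M.explored a (γ.take i) ⊆ M.explored a (γ.take k) :=
  explored_mono (List.take_subset_take_left γ hik)

theorem nodup : ((a :: γ).map M.faceOf).Nodup :=
  nodup_faces h.seed fun _ hk => h.target_notMem hk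

variable [Finite D]

theorem isDisk (hM : M.IsSphere) (hk : k < γ.length) : M.IsDisk (M.regionAt a b γ k) :=
  region_isDisk hM (h.target_notMem hk) fun i hi => h.seed_take i hi

omit h [Finite D] in
theorem regionAt_nested : M.regionAt a b γ k ⊆ M.regionAt a b γ j ∨
    M.regionAt a b γ j ⊆ M.regionAt a b γ k :=
  (le_total j k).imp regionAt_anti regionAt_anti

variable (hM : M.IsSphere) (hj : j < γ.length) {u : Perm D}
  (hu : u ∈ Subgroup.zpowers (M.nextBdry (M.regionAt a b γ j)))

include hM hj hu

/-- Only edges of `C_j` change, and their outer sides are explored after `j` steps. For `k ≥ j` they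
are walls in both maps. For `k ≤ j` all of `R_j` lies in `R_k`, so it does not matter from which
dart of `C_j` an outer side is reached. -/
theorem regionAt_reglue (hk : k < γ.length) :
    (M.reglue u).regionAt a b γ k = M.regionAt a b γ k := by
  have hee := hM.edge_edge
  have hS := h.isDisk hM hj
  have hsub : ∀ k, k < γ.length →
      (M.reglue u).regionAt a b γ k ⊆ M.regionAt a b γ k := by
    intro k hk d hd
    induction hd with
    | refl => exact target_mem_region
    | @tail x y hx hxy ih =>
      rcases hxy.1 with rfl | rfl
      · exact (face_mem_region (h.target_notMem hk) x).2 ih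
      · have hy : (M.reglue u).edge x ∉ M.explored a (γ.take k) := hxy.2
        by_cases h1 : x ∈ M.bdry (M.regionAt a b γ j)
        · have h2 := (rotation_mem_bdry hM hS (Subgroup.inv_mem _ hu) x).2 h1
          rw [reglue_edge_of_mem_bdry hM hS hu h1] at hy ⊢
          rcases le_total j k with hjk | hjk
          · exact absurd (explored_take_mono hjk (edge_mem_explored_of_mem_bdry h2)) hy
          · exact edge_mem_region (regionAt_anti hjk h2.1) hy
        by_cases h2 : M.edge x ∈ M.bdry (M.regionAt a b γ j)
        · rw [reglue_edge_of_edge_mem_bdry hM hu h2]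
          rcases le_total j k with hjk | hjk
          · exact absurd (regionAt_anti hjk ih) (by have := h2.2; rwa [hee] at this)
          · exact regionAt_anti hjk ((rotation_mem_bdry hM hS hu _).2 h2).1
        · rw [reglue_edge_of_notMem hu h1 h2] at hy ⊢
          exact edge_mem_region ih hy
  have hsup : ∀ k, k < γ.length → j ≤ k →
      M.regionAt a b γ k ⊆ (M.reglue u).regionAt a b γ k := by
    intro k hk hjk d hd
    induction hd with
    | refl => exact target_mem_region
    | @tail x y hx hxy ih =>
      rcases hxy.1 with rfl | rfl
      · exact (face_mem_region (M := M.reglue u) (h.target_notMem hk) x).2 ih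
      · have hxj : x ∈ M.regionAt a b γ j := regionAt_anti hjk hx
        have hxj' : M.edge x ∈ M.regionAt a b γ j := by
          by_contra h'
          exact hxy.2 (explored_take_mono hjk (edge_mem_explored_of_mem_bdry ⟨hxj, h'⟩))
        rw [← reglue_edge_of_mem hM hu hxj hxj']
        refine edge_mem_region (M := M.reglue u) ih ?_
        rw [reglue_edge_of_mem hM hu hxj hxj']
        exact hxy.2
  refine (hsub k hk).antisymm ?_
  rcases le_total j k with hjk | hjk
  · exact hsup k hk hjk
  · have hjsub : M.regionAt a b γ j ⊆ (M.reglue u).regionAt a b γ k :=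
      (hsup j hj le_rfl).trans (regionAt_anti hjk)
    intro d hd
    induction hd with
    | refl => exact target_mem_region
    | @tail x y hx hxy ih =>
      rcases hxy.1 with rfl | rfl
      · exact (face_mem_region (M := M.reglue u) (h.target_notMem hk) x).2 ih
      · by_cases h1 : x ∈ M.bdry (M.regionAt a b γ j)
        · have h2 : M.edge x = (M.reglue u).edge (u x) := by
            rw [reglue_edge_apply]
            exact (rotation_of_notMem hu fun h' => h1.2 h'.1).symm
          rw [h2]
          refine edge_mem_region (M := M.reglue u)
            (hjsub ((rotation_mem_bdry hM hS hu x).2 h1).1) ?_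
          rw [← h2]
          exact hxy.2
        by_cases h2 : M.edge x ∈ M.bdry (M.regionAt a b γ j)
        · exact hjsub h2.1
        · rw [← reglue_edge_of_notMem hu h1 h2]
          refine edge_mem_region (M := M.reglue u) ih ?_
          rw [reglue_edge_of_notMem hu h1 h2]
          exact hxy.2

/-- The seeds `γ[i]` with `i < j` lie on explored faces outside `R_j` and are fixed by `u`. The
others lie on cycles inside `R_j`, which keep their darts. -/
theorem reglue : (M.reglue u).IsExploration a b γ where
  source_ne := h.source_ne
  ne_nil := h.ne_nil
  target := h.target
  seed i hi := by
    have hS := h.isDisk hM hj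
    rw [h.regionAt_reglue hM hj hu hi]
    rcases le_or_gt j i with hji | hji
    · rw [bdry_reglue_of_subset hM hS hu (regionAt_anti hji)]
      exact h.seed i hi
    · rw [bdry_reglue_of_superset hM hS hu (regionAt_anti hji.le)]
      refine ⟨γ[i], h.seed i hi, rotation_of_notMem hu fun h' => ?_⟩
      exact h.notMem_explored hj h'.1 (seed_mem_explored hji hi)

theorem sizes_reglue : (M.reglue u).sizes a b γ = M.sizes a b γ := by
  refine List.map_congr_left fun k hk => ?_
  have hk' := List.mem_range.1 hk
  simp only [h.regionAt_reglue hM hj hu hk']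
  exact size_reglue hM (h.isDisk hM hj) hu regionAt_nested

theorem numSwallowed_reglue : (M.reglue u).numSwallowed a b γ = M.numSwallowed a b γ := by
  have := h.length_pos
  rw [numSwallowed, numSwallowed, h.regionAt_reglue hM hj hu (by omega)]
  rfl

theorem necklaces_reglue : (M.reglue u).necklaces a b γ = M.necklaces a b γ := by
  refine List.map_congr_left fun k hk => ?_
  have hk' := List.mem_range.1 hk
  have hS := h.isDisk hM hj
  have hM' := IsSphere.reglue hM hS hu
  have h' := h.reglue hM hj hu
  have e1 := h.regionAt_reglue hM hj hu (show k < γ.length by omega)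
  have e2 := h.regionAt_reglue hM hj hu (show k + 1 < γ.length by omega)
  rw [e1, e2]
  symm
  apply Quotient.sound
  have hR := h.isDisk hM (show k < γ.length by omega)
  have hR' := h.isDisk hM (show k + 1 < γ.length by omega)
  rcases le_or_gt j k with hjk | hjk
  · exact between_reglue_of_subset hM hS hu (regionAt_anti hjk) (regionAt_anti (by omega)) hR hR'
  · refine between_reglue_of_superset hM hS hu (regionAt_anti hjk) (regionAt_anti (by omega)) hR hR'
      ?_ ?_
    · rw [← e1]; exact h'.isDisk hM' (by omega)
    · rw [← e2]; exact h'.isDisk hM' (by omega)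

/-- This is why `randomRotation` may take all its rotation groups from the original map. -/
theorem nextBdry_reglue (hk : k < γ.length) (hjk : j ≤ k) :
    (M.reglue u).nextBdry ((M.reglue u).regionAt a b γ k) = M.nextBdry (M.regionAt a b γ k) := by
  rw [h.regionAt_reglue hM hj hu hk,
    nextBdry_reglue_of_subset hM (h.isDisk hM hj) hu (regionAt_anti hjk)]

theorem ncard_bdry_reglue (hk : k < γ.length) :
    ((M.reglue u).bdry ((M.reglue u).regionAt a b γ k)).ncard =
      (M.bdry (M.regionAt a b γ k)).ncard := by
  rw [h.regionAt_reglue hM hj hu hk]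
  exact CombMap.ncard_bdry_reglue hM (h.isDisk hM hj) hu regionAt_nested

end IsExploration

end exploration

end CombMap

namespace CombMap

/-! ### Walks in the dual map -/

section dualWalk

variable {D : Type} {M : CombMap D} {a b : D} {γ γ' : List D}

/-- A non-self-intersecting path of faces that starts at the source face. -/
def IsDualWalk (M : CombMap D) (a : D) (γ : List D) : Prop :=
  (a :: γ).IsChain (fun s s' => M.faceOf (M.edge s') = M.faceOf s) ∧
  ((a :: γ).map M.faceOf).Nodup

namespace IsDualWalk

variable (h : M.IsDualWalk a γ)

include h

theorem adj {i : ℕ} (hi : i + 1 < (a :: γ).length) :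
    M.faceOf (M.edge (a :: γ)[i + 1]) = M.faceOf (a :: γ)[i] :=
  List.isChain_iff_getElem.1 h.1 i hi

theorem inj {i k : ℕ} (hi : i < (a :: γ).length) (hk : k < (a :: γ).length)
    (hik : M.faceOf (a :: γ)[i] = M.faceOf (a :: γ)[k]) : i = k := by
  have := (h.2.getElem_inj_iff (i := i) (j := k) (hi := by simpa using hi)
    (hj := by simpa using hk)).1 (by simpa only [List.getElem_map] using hik)
  exact this

theorem length_le [Finite D] : γ.length + 1 ≤ Nat.card D := by
  have := Fintype.ofFinite D
  have h1 : (a :: γ).Nodup := h.2.of_map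
  rw [Nat.card_eq_fintype_card]
  exact h1.length_le_card

theorem append_singleton {s : D}
    (hs : M.faceOf (M.edge s) = M.faceOf ((a :: γ).getLast (List.cons_ne_nil a γ)))
    (hn : ∀ t ∈ a :: γ, M.faceOf t ≠ M.faceOf s) : M.IsDualWalk a (γ ++ [s]) := by
  constructor
  · rw [← List.cons_append, List.isChain_append]
    refine ⟨h.1, List.isChain_singleton s, fun x hx y hy => ?_⟩
    rw [List.getLast?_eq_some_getLast (List.cons_ne_nil a γ), Option.mem_some_iff] at hx
    rw [List.head?_cons, Option.mem_some_iff] at hy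
    rw [← hx, ← hy, hs]
  · rw [← List.cons_append, List.map_append, List.nodup_append]
    refine ⟨h.2, by simp, ?_⟩
    intro x hx y hy
    obtain ⟨t, ht, rfl⟩ := List.mem_map.1 hx
    simp only [List.map_cons, List.map_nil, List.mem_singleton] at hy
    rw [hy]
    exact hn t ht

theorem take (k : ℕ) : M.IsDualWalk a (γ.take k) := by
  have h1 : a :: γ.take k = (a :: γ).take (k + 1) := rfl
  constructor
  · rw [h1]; exact h.1.take _
  · rw [h1, List.map_take]; exact h.2.sublist (List.take_sublist _ _)

end IsDualWalk

theorem isDualPath_iff : M.IsDualPath a b γ ↔ M.IsDualWalk a γ ∧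
    M.faceOf ((a :: γ).getLast (List.cons_ne_nil a γ)) = M.faceOf b :=
  and_assoc.symm

theorem getLast_cons_eq_getElem : (a :: γ).getLast (List.cons_ne_nil a γ) = (a :: γ)[γ.length] := by
  rw [List.getLast_eq_getElem]; rfl

/-- A set of edges (given by their darts) that has exactly one side on the source face and on the
target face, and no side or exactly two sides on every other face. -/
structure IsStrand (M : CombMap D) (a b : D) (S : D → Prop) : Prop where
  symm : ∀ d, S (M.edge d) ↔ S d
  source : ∃ d, M.faceOf d = M.faceOf a ∧ S d
  source_unique : ∀ d d', M.faceOf d = M.faceOf a → M.faceOf d' = M.faceOf a → S d → S d' → d = d'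
  mid : ∀ d, M.faceOf d ≠ M.faceOf a → M.faceOf d ≠ M.faceOf b → S d →
    ∃ d', M.faceOf d' = M.faceOf d ∧ d' ≠ d ∧ S d'
  mid_unique : ∀ d, M.faceOf d ≠ M.faceOf a → M.faceOf d ≠ M.faceOf b → S d →
    ∀ x y, M.faceOf x = M.faceOf d → M.faceOf y = M.faceOf d → x ≠ d → y ≠ d → S x → S y → x = y

namespace IsStrand

variable {S : D → Prop} (hS : M.IsStrand a b S)
  (hne : ∀ d, M.edge d ≠ d) (hee : ∀ d, M.edge (M.edge d) = d)

include hS hne hee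

/-- Leave the last face by the strand side that was not used to enter it. If the face behind it had
been visited, that face would carry one strand side too many besides its entrance and exit. -/
theorem exists_step (h : M.IsDualWalk a γ) (hγ : ∀ s ∈ γ, S s)
    (hopen : ∀ s ∈ γ, M.faceOf s ≠ M.faceOf b) :
    ∃ s, S s ∧ M.IsDualWalk a (γ ++ [s]) := by
  obtain ⟨d, hd, hSd, hdl⟩ : ∃ d, M.faceOf d = M.faceOf (a :: γ)[γ.length] ∧ S d ∧
      (γ ≠ [] → d ≠ (a :: γ)[γ.length]) := by
    rcases Nat.eq_zero_or_pos γ.length with h0 | h0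
    · have := List.length_eq_zero_iff.1 h0
      subst this
      obtain ⟨d, hd, hSd⟩ := hS.source
      exact ⟨d, hd, hSd, fun h => absurd rfl h⟩
    · obtain ⟨m, hm⟩ : ∃ m, γ.length = m + 1 := ⟨γ.length - 1, by omega⟩
      have hmem : (a :: γ)[γ.length] ∈ γ := by
        simp only [hm, List.getElem_cons_succ]; exact List.getElem_mem _
      obtain ⟨d, hd, hdne, hSd⟩ := hS.mid _ (fun h' => by
        have := h.inj (i := γ.length) (k := 0) (by simp) (by simp) h'
        omega) (hopen _ hmem) (hγ _ hmem)
      exact ⟨d, hd, hSd, fun _ => hdne⟩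
  have hSE : S (M.edge d) := (hS.symm d).2 hSd
  have hγS : ∀ i (hi : i + 1 < (a :: γ).length), S (a :: γ)[i + 1] := fun i hi =>
    hγ _ (List.getElem_mem _)
  have hγb : ∀ i (hi : i + 1 < (a :: γ).length), M.faceOf (a :: γ)[i + 1] ≠ M.faceOf b :=
    fun i hi => hopen _ (List.getElem_mem _)
  have hl : γ.length < (a :: γ).length := by simp
  refine ⟨M.edge d, hSE, h.append_singleton (by rw [hee, hd, getLast_cons_eq_getElem]) ?_⟩
  intro t ht htd
  obtain ⟨i, hi, rfl⟩ := List.mem_iff_getElem.1 ht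
  -- Going back through the entrance of face `k + 1` would put `d` on face `k`, but `d` lies on the
  -- last face.
  have hback : ∀ (k : ℕ) (hk : k + 1 < (a :: γ).length), M.edge d ≠ (a :: γ)[k + 1] := by
    intro k hk he
    have h1 : d = M.edge (a :: γ)[k + 1] := by rw [← he, hee]
    have h2 := h.adj hk
    rw [← h1, hd] at h2
    have := h.inj hl (by omega) h2
    simp only [List.length_cons] at hk
    omega
  have hfwd : ∀ (k : ℕ) (hk : k + 1 < (a :: γ).length), M.edge d ≠ M.edge (a :: γ)[k + 1] := by
    intro k hk he
    have h1 := M.edge.injective he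
    have h2 := h.inj hl hk (by rw [← hd, h1])
    refine hdl (fun h0 => by simp [h0] at hk) ?_
    rw [h1]; congr 1; exact h2.symm
  have hexit : ∀ (k : ℕ) (hk : k + 1 < (a :: γ).length), S (M.edge (a :: γ)[k + 1]) :=
    fun k hk => (hS.symm _).2 (hγS k hk)
  by_cases hil : i = γ.length
  · subst hil
    rcases Nat.eq_zero_or_pos γ.length with h0 | h0
    · have := List.length_eq_zero_iff.1 h0
      subst this
      exact hne d (hS.source_unique _ _ htd.symm hd hSE hSd)
    · obtain ⟨m, hm⟩ : ∃ m, γ.length = m + 1 := ⟨γ.length - 1, by omega⟩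
      simp only [hm] at hd htd hdl
      refine hne d (hS.mid_unique (a :: γ)[m + 1] (fun h' => ?_) (hγb m (by omega))
        (hγS m (by omega)) _ _ htd.symm hd (hback m (by omega)) (hdl ?_) hSE hSd)
      · have := h.inj (i := m + 1) (k := 0) (by omega) (by simp) h'
        omega
      · rw [← List.length_pos_iff]; exact h0
  · have hi1 : i + 1 < (a :: γ).length := by simp only [List.length_cons] at hi ⊢; omega
    have h1 := h.adj hi1
    rcases i with _ | i
    · exact hfwd 0 hi1 (hS.source_unique _ _ htd.symm h1 hSE (hexit 0 hi1))
    · refine hfwd (i + 1) hi1 (hS.mid_unique (a :: γ)[i + 1] (fun h' => ?_) (hγb i hi)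
        (hγS i hi) _ _ htd.symm h1 (hback i hi) (fun h' => ?_) hSE (hexit _ hi1))
      · have := h.inj (i := i + 1) (k := 0) hi (by simp) h'
        omega
      · have h2 : (a :: γ)[i + 1 + 1] = M.edge (a :: γ)[i + 1] := by rw [← h', hee]
        have h3 := h.adj hi
        rw [← h2] at h3
        have := h.inj hi1 (by omega) h3
        omega

/-- Every walk along the strand extends to one that reaches the target. -/
theorem exists_extension [Finite D] (h : M.IsDualWalk a γ)
    (hγ : ∀ s ∈ γ, S s)
    (hopen : ∀ s ∈ γ, M.faceOf s ≠ M.faceOf b) :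
    ∃ δ, δ ≠ [] ∧ M.IsDualPath a b (γ ++ δ) ∧ ∀ s ∈ γ ++ δ, S s := by
  -- A walk visits distinct faces, so its length is bounded by the number of darts and the extension
  -- must end at the target.
  obtain ⟨m, hm⟩ : ∃ m, Nat.card D - γ.length = m := ⟨_, rfl⟩
  induction m generalizing γ with
  | zero => have := h.length_le; omega
  | succ m ih =>
    obtain ⟨s, hs, hw⟩ := hS.exists_step hne hee h hγ hopen
    have hγ' : ∀ t ∈ γ ++ [s], S t := by
      intro t ht
      rcases List.mem_append.1 ht with ht | ht
      · exact hγ t ht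
      · rw [List.mem_singleton.1 ht]; exact hs
    by_cases hsb : M.faceOf s = M.faceOf b
    · refine ⟨[s], by simp, isDualPath_iff.2 ⟨hw, ?_⟩, hγ'⟩
      have : (a :: (γ ++ [s])).getLast (List.cons_ne_nil _ _) = s := by simp
      rw [this, hsb]
    · obtain ⟨δ, hδ, h1, h2⟩ := ih hw hγ' (fun t ht => by
        rcases List.mem_append.1 ht with ht | ht
        · exact hopen t ht
        · rw [List.mem_singleton.1 ht]; exact hsb) (by simp; omega)
      exact ⟨s :: δ, by simp, by simpa using h1, by simpa using h2⟩

-- The exit from each face is forced: the source has one strand side, any other face before the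
-- target has one besides its entrance. If one path were shorter, the other would meet the target
-- face twice.
omit hne in
theorem eq_of_isDualPath (h : M.IsDualPath a b γ) (h' : M.IsDualPath a b γ')
    (hγ : ∀ s ∈ γ, S s) (hγ' : ∀ s ∈ γ', S s) : γ = γ' := by
  obtain ⟨hw, hl⟩ := isDualPath_iff.1 h
  obtain ⟨hw', hl'⟩ := isDualPath_iff.1 h'
  rw [getLast_cons_eq_getElem] at hl hl'
  have key : ∀ i (hi : i < (a :: γ).length) (hi' : i < (a :: γ').length),
      (a :: γ)[i] = (a :: γ')[i] := by
    intro i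
    induction i with
    | zero => intro _ _; rfl
    | succ i ih =>
      intro hi hi'
      have e := ih (by omega) (by omega)
      have h1 := hw.adj hi
      have h2 := hw'.adj hi'
      have s1 : S (M.edge (a :: γ)[i + 1]) := (hS.symm _).2 (hγ _ (List.getElem_mem _))
      have s2 : S (M.edge (a :: γ')[i + 1]) := (hS.symm _).2 (hγ' _ (List.getElem_mem _))
      apply M.edge.injective
      rw [← e] at h2
      rcases i with _ | i
      · exact hS.source_unique _ _ h1 h2 s1 s2
      · have back : ∀ {η : List D} (hw : M.IsDualWalk a η) (hi : i + 1 + 1 < (a :: η).length),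
            M.edge (a :: η)[i + 1 + 1] ≠ (a :: η)[i + 1] := by
          intro η hw hi he
          have h2 : (a :: η)[i + 1 + 1] = M.edge (a :: η)[i + 1] := by rw [← he, hee]
          have h3 := hw.adj (i := i) (by omega)
          rw [← h2] at h3
          have := hw.inj hi (by omega) h3
          omega
        refine hS.mid_unique (a :: γ)[i + 1] (fun h' => ?_) (fun h' => ?_)
          (hγ _ (List.getElem_mem _)) _ _ h1 h2 (back hw hi) ?_ s1 s2
        · have := hw.inj (i := i + 1) (k := 0) (by omega) (by simp) h'
          omega
        · have := hw.inj (i := i + 1) (k := γ.length) (by omega) (by simp) (h'.trans hl.symm)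
          simp only [List.length_cons] at hi
          omega
        · rw [e]; exact back hw' hi'
  have hlen : γ.length = γ'.length := by
    rcases lt_trichotomy γ.length γ'.length with h1 | h1 | h1
    · have e := key γ.length (by simp) (by simp; omega)
      have := hw'.inj (i := γ.length) (k := γ'.length) (by simp; omega) (by simp)
        (by rw [← e, hl, hl'])
      omega
    · exact h1
    · have e := key γ'.length (by simp; omega) (by simp)
      have := hw.inj (i := γ'.length) (k := γ.length) (by simp; omega) (by simp)
        (by rw [e, hl, hl'])
      omega
  have : a :: γ = a :: γ' := List.ext_getElem (by simp [hlen]) fun i h1 h2 => key i h1 h2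
  exact (List.cons_eq_cons.1 this).2

end IsStrand

end dualWalk

end CombMap

namespace CombMap

/-! ### Percolation interfaces -/

section interface

variable {D : Type} {M : CombMap D} {a b : D} {γ p : List D} {c : M.Vertex → Bool}

/-- The faces of `a` and `b` are distinct 2-gons, and all other faces are triangles. -/
structure HasDigons (M : CombMap D) (a b : D) : Prop where
  source_ne : M.faceOf a ≠ M.faceOf b
  face_source : M.face (M.face a) = a
  face_source_ne : M.face a ≠ a
  face_target : M.face (M.face b) = b
  face_target_ne : M.face b ≠ b
  face_face_face : ∀ d, M.faceOf d ≠ M.faceOf a → M.faceOf d ≠ M.faceOf b →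
    M.face (M.face (M.face d)) = d
  face_ne : ∀ d, M.faceOf d ≠ M.faceOf a → M.faceOf d ≠ M.faceOf b → M.face d ≠ d

theorem eq_or_of_faceOf_eq [Finite D] {x d : D} (hx : M.faceOf x = M.faceOf d) :
    ∃ k : ℕ, (M.face ^ k) d = x := by
  obtain ⟨k, -, hk⟩ := (Quotient.exact hx : M.face.SameCycle x d).symm.exists_pow_eq'
  exact ⟨k, hk⟩

theorem eq_of_faceOf_eq_digon [Finite D] {x d : D} (hd : M.face (M.face d) = d)
    (hx : M.faceOf x = M.faceOf d) : x = d ∨ x = M.face d := by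
  obtain ⟨k, rfl⟩ := eq_or_of_faceOf_eq hx
  induction k with
  | zero => left; rfl
  | succ k ih =>
    have h1 : (M.face ^ (k + 1)) d = M.face ((M.face ^ k) d) := by
      rw [pow_succ', Perm.mul_apply]
    rcases ih (by rwa [h1, faceOf_face] at hx) with h | h
    · right; rw [h1, h]
    · left; rw [h1, h, hd]

theorem eq_of_faceOf_eq_triangle [Finite D] {x d : D} (hd : M.face (M.face (M.face d)) = d)
    (hx : M.faceOf x = M.faceOf d) : x = d ∨ x = M.face d ∨ x = M.face (M.face d) := by
  obtain ⟨k, rfl⟩ := eq_or_of_faceOf_eq hx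
  induction k with
  | zero => left; rfl
  | succ k ih =>
    have h1 : (M.face ^ (k + 1)) d = M.face ((M.face ^ k) d) := by
      rw [pow_succ', Perm.mul_apply]
    rcases ih (by rwa [h1, faceOf_face] at hx) with h | h | h
    · right; left; rw [h1, h]
    · right; right; rw [h1, h]
    · left; rw [h1, h, hd]

/-- The condition for the interface to cross the edge of `d`. -/
def IsInterfaceEdge (M : CombMap D) (p : List D) (c : M.Vertex → Bool) (d : D) : Prop :=
  (c (M.origin d) ≠ c (M.origin (M.edge d)) ∧ ¬ M.Crosses p d) ∨
    (c (M.origin d) = c (M.origin (M.edge d)) ∧ M.Crosses p d)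

/-- The indicator of the cut between the two colours. -/
def colourCut (M : CombMap D) (c : M.Vertex → Bool) (d : D) : ZMod 2 :=
  (if c (M.origin d) then 1 else 0) + (if c (M.origin (M.edge d)) then 1 else 0)

open Classical in
/-- The number of crossings of the edge of `d` by the path `p`, modulo two. -/
noncomputable def crossNumber (M : CombMap D) (p : List D) (d : D) : ZMod 2 :=
  (p.map fun s => (if d = s then 1 else 0) + (if d = M.edge s then 1 else 0)).sum

theorem crossNumber_edge (hee : ∀ d, M.edge (M.edge d) = d) (d : D) :
    M.crossNumber p (M.edge d) = M.crossNumber p d := by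
  classical
  unfold crossNumber
  congr 1
  refine List.map_congr_left fun s _ => ?_
  have h1 : M.edge d = s ↔ d = M.edge s := ⟨fun h => by rw [← h, hee], fun h => by rw [h, hee]⟩
  simp only [h1, M.edge.injective.eq_iff, add_comm]

/-- A path that never revisits a face crosses no edge twice, in either direction, so counting mod 2
loses nothing. -/
theorem crossNumber_eq (hee : ∀ d, M.edge (M.edge d) = d) (hp : M.IsDualWalk a p) (d : D)
    [Decidable (M.Crosses p d)] :
    M.crossNumber p d = if M.Crosses p d then 1 else 0 := by
  classical
  have hnd : p.Nodup := (hp.2.of_map).of_cons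
  have hcount : ∀ x : D, (p.map fun s => (if x = s then 1 else 0 : ZMod 2)).sum =
      if x ∈ p then 1 else 0 := by
    intro x
    clear hp
    induction p with
    | nil => simp
    | cons y p ih =>
      rw [List.nodup_cons] at hnd
      rw [List.map_cons, List.sum_cons, ih hnd.2]
      by_cases hxy : x = y
      · subst hxy; simp [hnd.1]
      · simp [hxy]
  have h1 : ∀ s, d = M.edge s ↔ M.edge d = s :=
    fun s => ⟨fun h => by rw [h, hee], fun h => by rw [← h, hee]⟩
  have h2 : M.crossNumber p d = (if d ∈ p then 1 else 0) + if M.edge d ∈ p then 1 else 0 := by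
    unfold crossNumber
    rw [List.sum_map_add]
    simp only [h1]
    rw [hcount, hcount]
  rw [h2]
  have h3 : ¬ (d ∈ p ∧ M.edge d ∈ p) := by
    rintro ⟨hd, hd'⟩
    obtain ⟨i, hi, e1⟩ := List.mem_iff_getElem.1 hd
    obtain ⟨k, hk, e2⟩ := List.mem_iff_getElem.1 hd'
    have a1 := hp.adj (i := i) (by simpa using hi)
    have a2 := hp.adj (i := k) (by simpa using hk)
    simp only [List.getElem_cons_succ, e1, e2, hee] at a1 a2
    have b1 := hp.inj (i := k + 1) (k := i) (by simpa using hk) (by simp; omega)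
      (by rw [← a1, List.getElem_cons_succ, e2])
    have b2 := hp.inj (i := i + 1) (k := k) (by simpa using hi) (by simp; omega)
      (by rw [← a2, List.getElem_cons_succ, e1])
    omega
  unfold Crosses
  by_cases hd : d ∈ p <;> by_cases hd' : M.edge d ∈ p
  · exact absurd ⟨hd, hd'⟩ h3
  all_goals simp [hd, hd']

-- Each step leaves the face that the previous step entered, so mod 2 only the two ends survive.
open Classical in
theorem sum_faces_telescope (f : M.Face) :
    ∀ (p : List D) (a : D), (a :: p).IsChain (fun s s' => M.faceOf (M.edge s') = M.faceOf s) →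
    (p.map fun s => (if M.faceOf s = f then 1 else 0 : ZMod 2) +
      (if M.faceOf (M.edge s) = f then 1 else 0)).sum =
    (if M.faceOf a = f then 1 else 0) +
      (if M.faceOf ((a :: p).getLast (List.cons_ne_nil a p)) = f then 1 else 0) := by
  intro p
  induction p with
  | nil =>
    intro a _
    rw [List.map_nil, List.sum_nil, List.getLast_singleton]
    exact (CharTwo.add_self_eq_zero _).symm
  | cons s p ih =>
    intro a h
    rw [List.isChain_cons_cons] at h
    rw [List.map_cons, List.sum_cons, ih s h.2, h.1, List.getLast_cons_cons]
    generalize (if M.faceOf s = f then 1 else 0 : ZMod 2) = x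
    rw [add_comm x, add_assoc, ← add_assoc x, CharTwo.add_self_eq_zero, zero_add]

theorem list_sum_map_add_add {ι : Type} (l : List ι) (f g : ι → ZMod 2) :
    (l.map f).sum + (l.map g).sum = (l.map fun i => f i + g i).sum :=
  List.sum_map_add.symm

open Classical in
theorem crossNumber_digon [Finite D] (hp : M.IsDualPath a b p) {d : D}
    (hd : M.face (M.face d) = d) (hd' : M.face d ≠ d) :
    M.crossNumber p d + M.crossNumber p (M.face d) =
      (if M.faceOf a = M.faceOf d then 1 else 0) + (if M.faceOf b = M.faceOf d then 1 else 0) := by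
  have h := sum_faces_telescope (M.faceOf d) p a hp.1
  rw [hp.2.2] at h
  rw [← h, crossNumber, crossNumber, list_sum_map_add_add]
  congr 1
  refine List.map_congr_left fun s _ => ?_
  have key : ∀ t : D, (if d = t then 1 else 0 : ZMod 2) + (if M.face d = t then 1 else 0) =
      if M.faceOf t = M.faceOf d then 1 else 0 := by
    intro t
    by_cases ht : M.faceOf t = M.faceOf d
    · rcases eq_of_faceOf_eq_digon hd ht with rfl | rfl
      · simp [hd']
      · simp [hd'.symm, faceOf_face]
    · have h1 : d ≠ t := fun h => ht (by rw [h])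
      have h2 : M.face d ≠ t := fun h => ht (by rw [← h, faceOf_face])
      simp [ht, h1, h2]
  rw [← key, ← key]
  ring

open Classical in
theorem crossNumber_triangle [Finite D] (hp : M.IsDualPath a b p) {d : D}
    (hd : M.face (M.face (M.face d)) = d) (hd' : M.face d ≠ d) :
    M.crossNumber p d + M.crossNumber p (M.face d) + M.crossNumber p (M.face (M.face d)) =
      (if M.faceOf a = M.faceOf d then 1 else 0) + (if M.faceOf b = M.faceOf d then 1 else 0) := by
  have h := sum_faces_telescope (M.faceOf d) p a hp.1
  rw [hp.2.2] at h
  rw [← h, crossNumber, crossNumber, crossNumber, list_sum_map_add_add, list_sum_map_add_add]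
  congr 1
  refine List.map_congr_left fun s _ => ?_
  have hd2 : M.face (M.face d) ≠ d := fun h => by rw [h] at hd; exact hd' hd
  have hd3 : M.face (M.face d) ≠ M.face d := fun h => hd' (M.face.injective h)
  have key : ∀ t : D, (if d = t then 1 else 0 : ZMod 2) + (if M.face d = t then 1 else 0) +
      (if M.face (M.face d) = t then 1 else 0) =
      if M.faceOf t = M.faceOf d then 1 else 0 := by
    intro t
    by_cases ht : M.faceOf t = M.faceOf d
    · rcases eq_of_faceOf_eq_triangle hd ht with rfl | rfl | rfl
      · simp [hd', hd2]
      · simp [hd'.symm, hd3, faceOf_face]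
      · simp [hd2.symm, hd3.symm, faceOf_face]
    · have h1 : d ≠ t := fun h => ht (by rw [h])
      have h2 : M.face d ≠ t := fun h => ht (by rw [← h, faceOf_face])
      have h3 : M.face (M.face d) ≠ t := fun h => ht (by rw [← h, faceOf_face, faceOf_face])
      simp [ht, h1, h2, h3]
  rw [← key, ← key]
  ring

/-- The two alternatives become one linear condition mod 2 that can be summed around faces. There
`colourCut` cancels and `crossNumber` gives 1 on the source and on the target, 0 elsewhere. Hence a
triangle has no or two interface sides, and the source exactly one. -/
theorem isInterfaceEdge_iff (hee : ∀ d, M.edge (M.edge d) = d) (hp : M.IsDualWalk a p) (d : D) :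
    M.IsInterfaceEdge p c d ↔ M.colourCut c d + M.crossNumber p d = 1 := by
  classical
  rw [crossNumber_eq hee hp, IsInterfaceEdge, colourCut]
  cases c (M.origin d) <;> cases c (M.origin (M.edge d)) <;> by_cases h : M.Crosses p d
  all_goals simp [h]
  all_goals decide

theorem colourCut_edge (hee : ∀ d, M.edge (M.edge d) = d) (d : D) :
    M.colourCut c (M.edge d) = M.colourCut c d := by
  rw [colourCut, colourCut, hee, add_comm]

theorem zmod_two_eq_zero_or_one (x : ZMod 2) : x = 0 ∨ x = 1 := by
  revert x; decide

/-- The edges crossed by interfaces form a strand from the source to the target. -/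
theorem interfaceEdge_isStrand [Finite D] (hee : ∀ d, M.edge (M.edge d) = d)
    (hab : M.HasDigons a b) (hp : M.IsDualPath a b p) :
    M.IsStrand a b (M.IsInterfaceEdge p c) := by
  classical
  have hw := (isDualPath_iff.1 hp).1
  have hiff := isInterfaceEdge_iff (c := c) hee hw
  have hcut2 : ∀ d, M.face (M.face d) = d → M.colourCut c d + M.colourCut c (M.face d) = 0 := by
    intro d hd
    simp only [colourCut, ← origin_face hee]
    rw [hd]
    generalize (if c (M.origin d) then 1 else 0 : ZMod 2) = x
    generalize (if c (M.origin (M.face d)) then 1 else 0 : ZMod 2) = y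
    revert x y; decide
  have hcut3 : ∀ d, M.face (M.face (M.face d)) = d → M.colourCut c d +
      M.colourCut c (M.face d) + M.colourCut c (M.face (M.face d)) = 0 := by
    intro d hd
    simp only [colourCut, ← origin_face hee]
    rw [hd]
    generalize (if c (M.origin d) then 1 else 0 : ZMod 2) = x
    generalize (if c (M.origin (M.face d)) then 1 else 0 : ZMod 2) = y
    generalize (if c (M.origin (M.face (M.face d))) then 1 else 0 : ZMod 2) = z
    revert x y z; decide
  have hsrc : M.colourCut c a + M.crossNumber p a +
      (M.colourCut c (M.face a) + M.crossNumber p (M.face a)) = 1 := by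
    have h1 := hcut2 a hab.face_source
    have h2 := crossNumber_digon hp hab.face_source hab.face_source_ne
    rw [if_pos rfl, if_neg hab.source_ne.symm, add_zero] at h2
    rw [add_add_add_comm, h1, h2, zero_add]
  have hmid : ∀ d, M.faceOf d ≠ M.faceOf a → M.faceOf d ≠ M.faceOf b →
      M.colourCut c d + M.crossNumber p d +
      (M.colourCut c (M.face d) + M.crossNumber p (M.face d)) +
      (M.colourCut c (M.face (M.face d)) + M.crossNumber p (M.face (M.face d))) = 0 := by
    intro d ha hb
    have h1 := hcut3 d (hab.face_face_face d ha hb)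
    have h2 := crossNumber_triangle hp (hab.face_face_face d ha hb) (hab.face_ne d ha hb)
    rw [if_neg ha.symm, if_neg hb.symm, add_zero] at h2
    linear_combination h1 + h2
  refine ⟨fun d => ?_, ?_, ?_, ?_, ?_⟩
  · rw [hiff, hiff, colourCut_edge hee, crossNumber_edge hee]
  · rcases zmod_two_eq_zero_or_one (M.colourCut c a + M.crossNumber p a) with h | h
    · exact ⟨M.face a, faceOf_face a, (hiff _).2 (by rwa [h, zero_add] at hsrc)⟩
    · exact ⟨a, rfl, (hiff _).2 h⟩
  · intro d d' hd hd' h h'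
    rw [hiff] at h h'
    rcases eq_of_faceOf_eq_digon hab.face_source hd with rfl | rfl <;>
    rcases eq_of_faceOf_eq_digon hab.face_source hd' with rfl | rfl
    · rfl
    · rw [h, h'] at hsrc; exact absurd hsrc (by decide)
    · rw [h, h'] at hsrc; exact absurd hsrc (by decide)
    · rfl
  · intro d ha hb hd
    rw [hiff] at hd
    have h := hmid d ha hb
    rw [hd] at h
    have hd2 : M.face (M.face d) ≠ d := fun h => hab.face_ne d ha hb (by
      have := hab.face_face_face d ha hb
      rwa [h] at this)
    rcases zmod_two_eq_zero_or_one (M.colourCut c (M.face d) + M.crossNumber p (M.face d))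
      with h' | h'
    · refine ⟨M.face (M.face d), by rw [faceOf_face, faceOf_face], hd2, (hiff _).2 ?_⟩
      rw [h', add_zero] at h
      exact (CharTwo.add_eq_zero.1 h).symm
    · exact ⟨M.face d, faceOf_face d, hab.face_ne d ha hb, (hiff _).2 h'⟩
  · intro d ha hb hd x y hx hy hxd hyd hSx hSy
    rw [hiff] at hd hSx hSy
    have h := hmid d ha hb
    rcases (eq_of_faceOf_eq_triangle (hab.face_face_face d ha hb) hx).resolve_left hxd
      with rfl | rfl <;>
    rcases (eq_of_faceOf_eq_triangle (hab.face_face_face d ha hb) hy).resolve_left hyd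
      with rfl | rfl
    · rfl
    · rw [hd, hSx, hSy] at h; exact absurd h (by decide)
    · rw [hd, hSx, hSy] at h; exact absurd h (by decide)
    · rfl

theorem existsUnique_isInterface [Finite D] (hne : ∀ d, M.edge d ≠ d)
    (hee : ∀ d, M.edge (M.edge d) = d) (hab : M.HasDigons a b) (hp : M.IsDualPath a b p)
    (c : M.Vertex → Bool) : ∃! γ, M.IsInterface a b γ p c := by
  have hS := interfaceEdge_isStrand (c := c) hee hab hp
  obtain ⟨γ, -, h1, h2⟩ := hS.exists_extension (γ := []) hne hee
    ⟨List.isChain_singleton a, by simp⟩ (by simp) (by simp)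
  exact ⟨[] ++ γ, ⟨h1, h2⟩, fun γ' h => hS.eq_of_isDualPath hee h.1 h1 h.2 h2⟩

theorem isInterface_interface [Finite D] (hne : ∀ d, M.edge d ≠ d)
    (hee : ∀ d, M.edge (M.edge d) = d) (hab : M.HasDigons a b) (hp : M.IsDualPath a b p)
    (c : M.Vertex → Bool) : M.IsInterface a b (M.interface a b p c) p c := by
  have h := (existsUnique_isInterface hne hee hab hp c).exists
  rw [interface, dif_pos h]
  exact h.choose_spec

theorem interface_eq_iff [Finite D] (hne : ∀ d, M.edge d ≠ d)
    (hee : ∀ d, M.edge (M.edge d) = d) (hab : M.HasDigons a b) (hp : M.IsDualPath a b p)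
    (c : M.Vertex → Bool) : M.interface a b p c = γ ↔ M.IsInterface a b γ p c :=
  ⟨fun h => h ▸ isInterface_interface hne hee hab hp c, fun h =>
    (existsUnique_isInterface hne hee hab hp c).unique
      (isInterface_interface hne hee hab hp c) h⟩

end interface

end CombMap

namespace CombMap

/-! ### The law of the percolation interface -/

section steps

variable {D : Type} {M : CombMap D} {a b : D} {γ p : List D} {i k : ℕ}

/-- The dart through which the `k`-th face of an exploration is entered. -/
def tip (a : D) (γ : List D) (k : ℕ) : D := (a :: γ).getD k a

theorem tip_eq_getElem (hk : k < (a :: γ).length) : tip a γ k = (a :: γ)[k] := by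
  rw [tip, List.getD_eq_getElem _ _ hk]

theorem tip_succ (hk : k < γ.length) : tip a γ (k + 1) = γ[k] := by
  rw [tip_eq_getElem (by simpa using hk), List.getElem_cons_succ]

/-- The seeds of step `k + 1` that lie on the face entered in step `k`. -/
def candidates (M : CombMap D) (a b : D) (γ : List D) (k : ℕ) : Set D :=
  {s | s ∈ M.regionAt a b γ k ∧ M.faceOf (M.edge s) = M.faceOf (tip a γ k)}

open Classical in
/-- The conditional probability of the step `k + 1` of the percolation exploration. -/
noncomputable def stepProb (M : CombMap D) (a b : D) (γ : List D) (k : ℕ) : ENNReal :=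
  if M.faceOf (M.edge (tip a γ (k + 1))) = M.faceOf (tip a γ k) then
    ((M.candidates a b γ k).ncard : ENNReal)⁻¹ else 0

theorem tip_mem_explored (hk : k ≤ γ.length) : tip a γ k ∈ M.explored a (γ.take k) := by
  rcases k with _ | k
  · exact source_mem_explored
  · rw [tip_succ (by omega)]
    exact IsExploration.seed_mem_explored (Nat.lt_succ_self k) (by omega)

theorem mem_explored_of_faceOf_eq {d d' : D} (hd : d ∈ M.explored a γ)
    (h : M.faceOf d' = M.faceOf d) : d' ∈ M.explored a γ := by
  obtain ⟨s, hs, e⟩ := hd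
  exact ⟨s, hs, h.trans e⟩

theorem candidates_subset_bdry (h : M.IsExploration a b γ) (hk : k < γ.length) :
    M.candidates a b γ k ⊆ M.bdry (M.regionAt a b γ k) := fun _ hs =>
  ⟨hs.1, fun h' => h.notMem_explored hk h'
    (mem_explored_of_faceOf_eq (tip_mem_explored hk.le) hs.2)⟩

variable [Finite D]

theorem mem_of_faceOf_eq {R : Set D} (hR : ∀ d, M.face d ∈ R ↔ d ∈ R) {x y : D} (hx : x ∈ R)
    (hxy : M.faceOf y = M.faceOf x) : y ∈ R := by
  obtain ⟨k, rfl⟩ := eq_or_of_faceOf_eq hxy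
  induction k with
  | zero => exact hx
  | succ k ih =>
    have h1 : (M.face ^ (k + 1)) x = M.face ((M.face ^ k) x) := by
      rw [pow_succ', Perm.mul_apply]
    rw [h1, hR]
    exact ih (by rwa [h1, faceOf_face] at hxy)

/-- Read backwards from the target: the faces still to be entered are adjacent and unexplored, so
they lie in the region of the target. The other side of the next seed is the last explored face,
which puts the seed on the boundary. -/
theorem IsDualPath.isExploration
    (hab : M.faceOf a ≠ M.faceOf b) (h : M.IsDualPath a b γ) : M.IsExploration a b γ := by
  obtain ⟨hw, hl⟩ := isDualPath_iff.1 h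
  rw [getLast_cons_eq_getElem] at hl
  have hne : γ ≠ [] := by
    rintro rfl
    exact hab hl
  have hlen := List.length_pos_iff.2 hne
  have htarget : ∀ i (hi : i < γ.length), M.faceOf γ[i] = M.faceOf b ↔ i + 1 = γ.length := by
    intro i hi
    constructor
    · intro h'
      exact hw.inj (i := i + 1) (k := γ.length) (by simpa using hi) (by simp)
        (by rw [hl, List.getElem_cons_succ, h'])
    · intro h'
      simp only [← h', List.getElem_cons_succ] at hl
      exact hl
  refine ⟨hab, hne, fun i hi => ?_, htarget⟩
  have hb : b ∉ M.explored a (γ.take i) := by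
    rw [target_notMem_explored_iff]
    refine ⟨hab, fun s hs hsb => ?_⟩
    obtain ⟨k, hk, rfl⟩ := List.mem_take_iff_getElem.1 hs
    have := (htarget k (by omega)).1 hsb
    omega
  have hface := face_mem_region (M := M) (b := b) hb
  have hun : ∀ k (hk : k < γ.length), i ≤ k → γ[k] ∉ M.explored a (γ.take i) := by
    rintro k hk hik ⟨s, hs, e⟩
    obtain ⟨l, hl1, rfl⟩ := List.mem_iff_getElem.1 hs
    simp only [List.length_cons, List.length_take] at hl1
    have h1 : (a :: γ.take i)[l] = (a :: γ)[l]'(by simp; omega) := by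
      rcases l with _ | l <;> simp
    rw [h1] at e
    have := hw.inj (i := k + 1) (k := l) (by simpa using hk) (by simp; omega)
      (by rw [List.getElem_cons_succ, e])
    omega
  have key : ∀ m k (hk : k < γ.length), i ≤ k → k + m + 1 = γ.length →
      γ[k] ∈ M.region a b (γ.take i) := by
    intro m
    induction m with
    | zero =>
      intro k hk _ hkm
      exact mem_of_faceOf_eq hface target_mem_region ((htarget k hk).2 (by omega))
    | succ m ih =>
      intro k hk hik hkm
      have h1 := ih (k + 1) (by omega) (by omega) (by omega)
      have h2 := hw.adj (i := k + 1) (by simp; omega)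
      simp only [List.getElem_cons_succ] at h2
      refine mem_of_faceOf_eq hface (edge_mem_region h1 fun h' => ?_) h2.symm
      exact hun k hk hik (mem_explored_of_faceOf_eq h' h2.symm)
  refine ⟨key (γ.length - 1 - i) i hi le_rfl (by omega), fun h' => ?_⟩
  refine notMem_explored_of_mem_region hb h' ?_
  refine mem_explored_of_faceOf_eq (tip_mem_explored hi.le) ?_
  rw [tip_eq_getElem (by simp; omega)]
  have := hw.adj (i := i) (by simpa using hi)
  simpa only [List.getElem_cons_succ] using this

-- By contraposition, an exploration that is not a dual path has some factor `stepProb` equal to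
-- zero.
omit [Finite D] in
theorem isDualPath_of_isExploration (h : M.IsExploration a b γ)
    (hadj : ∀ i < γ.length, M.faceOf (M.edge (tip a γ (i + 1))) = M.faceOf (tip a γ i)) :
    M.IsDualPath a b γ := by
  refine isDualPath_iff.2 ⟨⟨List.isChain_iff_getElem.2 fun i hi => ?_, h.nodup⟩, ?_⟩
  · have hi' : i < γ.length := by simpa using hi
    have := hadj i hi'
    rwa [tip_eq_getElem hi, tip_eq_getElem (by omega)] at this
  · have h0 := h.length_pos
    have h1 := (h.target (γ.length - 1) (by omega)).2 (by omega)
    rw [← h1, List.getLast_cons h.ne_nil, List.getLast_eq_getElem]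

/-- If both free sides of a new triangle lie on the boundary of the remaining region, then the apex
of the triangle has not been seen before. -/
theorem apex_new (hM : M.IsSphere) (h : M.IsExploration a b γ)
    (hi : i + 1 < γ.length) {x : D} (hx : M.faceOf x = M.faceOf γ[i])
    (h1 : M.edge x ∈ M.regionAt a b γ (i + 1))
    (h2 : M.edge (M.face x) ∈ M.regionAt a b γ (i + 1)) {z : D}
    (hz : z ∈ M.explored a (γ.take i)) : M.origin z ≠ M.origin (M.face x) := by
  intro hzw
  set R := M.regionAt a b γ (i + 1) with hRdef
  have hR := h.isDisk hM hi
  have hee := hM.edge_edge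
  set y := M.face x with hy
  have hzR : z ∉ R := fun h' => h.notMem_explored hi h'
    (IsExploration.explored_take_mono (Nat.le_succ i) hz)
  have hxR : x ∉ R := fun h' => h.notMem_explored hi h'
    (mem_explored_of_faceOf_eq (IsExploration.seed_mem_explored (Nat.lt_succ_self i) (by omega)) hx)
  have hzy : z ≠ y := by
    rintro rfl
    refine h.notMem_explored (k := i) (by omega) (h.seed i (by omega)).1
      (mem_explored_of_faceOf_eq hz ?_)
    rw [hy, faceOf_face, hx]
  have hb2 : M.edge x ∈ M.bdry R := ⟨h1, by rwa [hee]⟩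
  have hrx : M.rot (M.edge x) = y := by
    show M.face (M.edge (M.edge x)) = y
    rw [hee]
  have ho2 : M.origin (M.edge x) = M.origin y := by rw [← origin_rot, hrx]
  have hex : ∃ m, (M.rot ^ m) y = z := by
    obtain ⟨m, -, hm⟩ := (Quotient.exact hzw : M.rot.SameCycle z y).symm.exists_pow_eq'
    exact ⟨m, hm⟩
  classical
  set m := Nat.find hex with hm
  have hmz : (M.rot ^ m) y = z := Nat.find_spec hex
  have hm0 : 1 ≤ m := by
    by_contra h'
    have : m = 0 := by omega
    rw [this] at hmz
    exact hzy hmz.symm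
  have hrot1 : (M.rot ^ 1) y ∈ R := by
    rw [pow_one]
    exact (hR.face_mem _).2 h2
  -- Turning about the apex from `y` to the first arrival at `z` starts inside `R` and ends outside,
  -- so it leaves `R` through a boundary dart at the apex. The boundary is simple, so that dart is
  -- `M.edge x`, and the next turn is back at `y`, against the minimality of `m`.
  obtain ⟨l, hl1, hlm, hlR, hlR'⟩ : ∃ l, 1 ≤ l ∧ l < m ∧ (M.rot ^ l) y ∈ R ∧
      (M.rot ^ (l + 1)) y ∉ R := by
    by_contra hcon
    push Not at hcon
    have : ∀ l, 1 ≤ l → l ≤ m → (M.rot ^ l) y ∈ R := by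
      intro l hl
      induction l, hl using Nat.le_induction with
      | base => intro _; exact hrot1
      | succ l hl ih => intro hlm; exact hcon l hl (by omega) (ih (by omega))
    exact hzR (hmz ▸ this m hm0 le_rfl)
  have hrl : M.rot ((M.rot ^ l) y) = (M.rot ^ (l + 1)) y := by
    rw [pow_succ', Perm.mul_apply]
  have hb1 : (M.rot ^ l) y ∈ M.bdry R := by
    refine ⟨hlR, fun h' => hlR' ?_⟩
    rw [← hrl]
    exact (hR.face_mem _).2 h'
  have ho1 : ∀ l : ℕ, M.origin ((M.rot ^ l) y) = M.origin y := by
    intro l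
    induction l with
    | zero => rfl
    | succ l ih => rw [pow_succ', Perm.mul_apply, origin_rot, ih]
  have heq := origin_injOn_bdry hM hR hb1 hb2 (by rw [ho1, ho2])
  have hcyc : (M.rot ^ (l + 1)) y = y := by rw [← hrl, heq, hrx]
  refine Nat.find_min hex (m := m - (l + 1)) (by omega) ?_
  have : (M.rot ^ (m - (l + 1))) ((M.rot ^ (l + 1)) y) = z := by
    rw [← Perm.mul_apply, ← pow_add, Nat.sub_add_cancel (by omega), hmz]
  rwa [hcyc] at this

/-- In each step there is either only one possible seed on the last face, or there are two, and the
seed edge has an end that lies on no earlier seed edge. -/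
theorem candidates_cases (hM : M.IsSphere) (hab : M.HasDigons a b) (hγ : M.IsDualPath a b γ)
    (hi : i < γ.length) : M.candidates a b γ i = {γ[i]} ∨
      (M.candidates a b γ i).ncard = 2 ∧ ∃ w,
        (∀ k (hk : k < i), M.origin γ[k] ≠ w ∧ M.origin (M.edge γ[k]) ≠ w) ∧
        (M.origin γ[i] = w ∧ M.origin (M.edge γ[i]) ≠ w ∨
          M.origin γ[i] ≠ w ∧ M.origin (M.edge γ[i]) = w) := by
  have hee := hM.edge_edge
  have h := hγ.isExploration hab.source_ne
  have hadj : M.faceOf (M.edge γ[i]) = M.faceOf (tip a γ i) := by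
    have := (isDualPath_iff.1 hγ).1.adj (i := i) (by simpa using hi)
    rwa [List.getElem_cons_succ, ← tip_eq_getElem] at this
  have hmem : γ[i] ∈ M.candidates a b γ i := ⟨(h.seed i hi).1, hadj⟩
  -- `x` and `y` are the free sides of the last face: both sides of the source for `i = 0`, and
  -- afterwards the two sides of the triangle other than its entrance. `y` starts at their common
  -- vertex.
  obtain ⟨x, y, hxy, hsub, hor, hnew⟩ : ∃ x y, x ≠ y ∧ M.candidates a b γ i ⊆ {M.edge x, M.edge y} ∧
      (M.origin (M.edge x) = M.origin y ∨ M.origin (M.edge y) = M.origin x) ∧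
      (M.edge x ∈ M.candidates a b γ i → M.edge y ∈ M.candidates a b γ i →
        M.origin (M.edge x) = M.origin y ∧
        ∀ k (hk : k < i), M.origin γ[k] ≠ M.origin y ∧ M.origin (M.edge γ[k]) ≠ M.origin y) := by
    rcases i with _ | i
    · refine ⟨a, M.face a, hab.face_source_ne.symm, fun s hs => ?_,
        Or.inl (origin_face hee a).symm, fun _ _ => ⟨(origin_face hee a).symm,
          fun k hk => absurd hk (Nat.not_lt_zero k)⟩⟩
      rcases eq_of_faceOf_eq_digon hab.face_source hs.2 with e | e
      · left; rw [← e, hee]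
      · right; rw [Set.mem_singleton_iff, ← e, hee]
    · have hti : tip a γ (i + 1) = γ[i] := tip_succ (by omega)
      have hsa : M.faceOf γ[i] ≠ M.faceOf a := fun h' =>
        h.notMem_explored (k := i) (by omega) (h.seed i (by omega)).1 ⟨a, by simp, h'⟩
      have hsb : M.faceOf γ[i] ≠ M.faceOf b := fun h' => by
        have := (h.target i (by omega)).1 h'
        omega
      have h3 := hab.face_face_face _ hsa hsb
      have hne := hab.face_ne _ hsa hsb
      refine ⟨M.face γ[i], M.face (M.face γ[i]), fun h' => hne (M.face.injective h'.symm),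
        fun s hs => ?_, Or.inl (origin_face hee _).symm, fun h1 h2 => ⟨(origin_face hee _).symm, ?_⟩⟩
      · have h4 := hs.2
        rw [hti] at h4
        rcases eq_of_faceOf_eq_triangle h3 h4 with e | e | e
        · exfalso
          refine (h.seed i (by omega)).2 ?_
          rw [← e, hee]
          exact regionAt_anti (Nat.le_succ i) hs.1
        · left; rw [← e, hee]
        · right; rw [Set.mem_singleton_iff, ← e, hee]
      · intro k hk
        have key : ∀ z ∈ M.explored a (γ.take i), M.origin z ≠ M.origin (M.face (M.face γ[i])) :=
          fun z hz => apex_new hM h hi (faceOf_face _) h1.1 h2.1 hz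
        have h5 : M.edge γ[k] ∈ M.explored a (γ.take i) := by
          have := (isDualPath_iff.1 hγ).1.adj (i := k) (by simp; omega)
          rw [List.getElem_cons_succ, ← tip_eq_getElem] at this
          exact IsExploration.explored_take_mono (by omega)
            (mem_explored_of_faceOf_eq (tip_mem_explored (by omega)) this)
        refine ⟨?_, key _ h5⟩
        rw [← origin_rot]
        exact key _ ((face_mem_explored _).2 h5)
  have hxy' : M.edge x ≠ M.edge y := fun h' => hxy (M.edge.injective h')
  by_cases hx : M.edge x ∈ M.candidates a b γ i
  · by_cases hy : M.edge y ∈ M.candidates a b γ i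
    · right
      have heq : M.candidates a b γ i = {M.edge x, M.edge y} :=
        hsub.antisymm (Set.insert_subset hx (Set.singleton_subset_iff.2 hy))
      obtain ⟨ho, hk⟩ := hnew hx hy
      refine ⟨by rw [heq, Set.ncard_pair hxy'], M.origin y, hk, ?_⟩
      rcases hsub hmem with e | e
      · left
        rw [e, hee]
        exact ⟨ho, fun h' => hM.loopless x (h'.trans ho.symm)⟩
      · right
        rw [Set.mem_singleton_iff] at e
        rw [e, hee]
        exact ⟨(hM.loopless y).symm, rfl⟩
    · left
      have hsub' : M.candidates a b γ i ⊆ {M.edge x} := fun s hs => by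
        rcases hsub hs with e | e
        · exact e
        · exact absurd (e ▸ hs) hy
      rw [hsub'.antisymm (Set.singleton_subset_iff.2 hx), Set.singleton_eq_singleton_iff]
      exact (hsub' hmem).symm
  · left
    have hsub' : M.candidates a b γ i ⊆ {M.edge y} := fun s hs => by
      rcases hsub hs with e | e
      · exact absurd (e ▸ hs) hx
      · exact e
    rw [← Set.mem_singleton_iff.1 (hsub' hmem)] at hsub'
    exact hsub'.antisymm (Set.singleton_subset_iff.2 hmem)

/-- The number of colourings compatible with the first steps of an exploration. -/
theorem ncard_colourings_step (hM : M.IsSphere) (hab : M.HasDigons a b) (hp : M.IsDualPath a b p)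
    (hγ : M.IsDualPath a b γ) (hi : i < γ.length) :
    {c | ∀ k (hk : k < γ.length), k < i + 1 → M.IsInterfaceEdge p c γ[k]}.ncard *
      (M.candidates a b γ i).ncard =
    {c | ∀ k (hk : k < γ.length), k < i → M.IsInterfaceEdge p c γ[k]}.ncard := by
  classical
  have hee := hM.edge_edge
  have h := hγ.isExploration hab.source_ne
  have hw := (isDualPath_iff.1 hγ).1
  rcases candidates_cases hM hab hγ hi with h1 | ⟨h2, w, hw1, hw2⟩
  · rw [h1, Set.ncard_singleton, mul_one]
    congr 1
    ext c
    refine ⟨fun hc k hk hki => hc k hk (by omega), fun hc k hk hki => ?_⟩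
    rcases Nat.lt_succ_iff_lt_or_eq.1 hki with hki | rfl
    · exact hc k hk hki
    have hS := interfaceEdge_isStrand (c := c) hee hab hp
    -- The interface of `c` continues beyond the first `k` seeds, and its next seed is a candidate.
    -- With a single candidate this is `γ[k]`, so the step puts no condition on `c`.
    obtain ⟨δ, hδ, hd1, hd2⟩ := hS.exists_extension (γ := γ.take k) hM.edge_ne hee (hw.take k)
      (fun s hs => by
        obtain ⟨l, hl, rfl⟩ := List.mem_take_iff_getElem.1 hs
        exact hc l (by omega) (by omega))
      (fun s hs hsb => by
        obtain ⟨l, hl, rfl⟩ := List.mem_take_iff_getElem.1 hs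
        have := (h.target l (by omega)).1 hsb
        omega)
    obtain ⟨s, δ', rfl⟩ := List.exists_cons_of_ne_nil hδ
    have hlen : (γ.take k).length = k := by rw [List.length_take]; omega
    have hk' : k < (γ.take k ++ s :: δ').length := by simp; omega
    have hks : (γ.take k ++ s :: δ')[k] = s := by
      rw [List.getElem_append_right (by omega)]; simp [hlen]
    have htake : (γ.take k ++ s :: δ').take k = γ.take k := by
      conv_lhs => rw [← hlen]
      rw [hlen, List.take_append_of_le_length (by omega), List.take_take, min_self]
    have hs1 := (hd1.isExploration hab.source_ne).seed k hk'
    have hs2 := (isDualPath_iff.1 hd1).1.adj (i := k) (by simpa using hk')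
    rw [List.getElem_cons_succ, hks] at hs2
    rw [hks, regionAt, htake] at hs1
    have hs3 : (a :: (γ.take k ++ s :: δ'))[k]'(by simp; omega) = tip a γ k := by
      rw [tip_eq_getElem (by simp; omega)]
      rcases k with _ | k
      · rfl
      · simp only [List.getElem_cons_succ]
        rw [List.getElem_append_left (by omega), List.getElem_take]
    rw [hs3] at hs2
    have hs4 : s ∈ M.candidates a b γ k := ⟨hs1.1, hs2⟩
    rw [h1, Set.mem_singleton_iff] at hs4
    rw [← hs4]
    exact hd2 s (by simp)
  · rw [h2]
    -- Flipping the colour of `w` keeps the conditions at earlier seeds and reverses the one at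
    -- `γ[i]`, whether or not `p` crosses that edge. So exactly half of the colourings survive.
    set φ : (M.Vertex → Bool) → (M.Vertex → Bool) := fun c => Function.update c w (!c w) with hφ
    have hφφ : Function.Involutive φ := by
      intro c
      simp [hφ]
    have hstay : ∀ c k (hk : k < i), M.IsInterfaceEdge p (φ c) γ[k] ↔ M.IsInterfaceEdge p c γ[k] := by
      intro c k hk
      obtain ⟨e1, e2⟩ := hw1 k hk
      simp only [IsInterfaceEdge, hφ, Function.update_of_ne e1, Function.update_of_ne e2]
    have hflip : ∀ c, M.IsInterfaceEdge p (φ c) γ[i] ↔ ¬ M.IsInterfaceEdge p c γ[i] := by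
      intro c
      simp only [IsInterfaceEdge, hφ]
      rcases hw2 with ⟨e1, e2⟩ | ⟨e1, e2⟩
      · rw [Function.update_of_ne e2, e1, Function.update_self]
        by_cases hc : M.Crosses p γ[i] <;> cases c w <;> cases c (M.origin (M.edge γ[i])) <;>
          simp [hc]
      · rw [Function.update_of_ne e1, e2, Function.update_self]
        by_cases hc : M.Crosses p γ[i] <;> cases c w <;> cases c (M.origin γ[i]) <;>
          simp [hc]
    set A := {c | ∀ k (hk : k < γ.length), k < i + 1 → M.IsInterfaceEdge p c γ[k]} with hA
    set B := {c | ∀ k (hk : k < γ.length), k < i → M.IsInterfaceEdge p c γ[k]} with hB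
    have hAB : ∀ c, c ∈ A ↔ c ∈ B ∧ M.IsInterfaceEdge p c γ[i] := by
      intro c
      constructor
      · intro hc
        exact ⟨fun k hk hki => hc k hk (by omega), hc i hi (by omega)⟩
      · rintro ⟨hc, hc'⟩ k hk hki
        rcases Nat.lt_succ_iff_lt_or_eq.1 hki with hki | rfl
        · exact hc k hk hki
        · exact hc'
    have hBφ : ∀ c, φ c ∈ B ↔ c ∈ B := fun c => forall_congr' fun k => forall_congr' fun hk =>
      forall_congr' fun hki => hstay c k hki
    have hun : B = A ∪ φ '' A := by
      ext c
      have himg : c ∈ φ '' A ↔ φ c ∈ A := by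
        conv_lhs => rw [← hφφ c]
        exact hφφ.injective.mem_set_image
      rw [Set.mem_union, himg, hAB, hAB, hBφ, hflip, ← and_or_left, and_iff_left (em _)]
    have hdisj : Disjoint A (φ '' A) := by
      rw [Set.disjoint_left]
      rintro _ hc ⟨c, hc', rfl⟩
      exact (hflip c).1 ((hAB _).1 hc).2 ((hAB _).1 hc').2
    rw [hun, Set.ncard_union_eq hdisj, Set.ncard_image_of_injective _ hφφ.injective]
    ring

theorem candidates_ncard_ne_zero (hM : M.IsSphere) (hab : M.HasDigons a b)
    (hγ : M.IsDualPath a b γ) (hi : i < γ.length) : (M.candidates a b γ i).ncard ≠ 0 := by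
  rcases candidates_cases hM hab hγ hi with h1 | ⟨h2, -⟩
  · rw [h1, Set.ncard_singleton]; exact one_ne_zero
  · rw [h2]; exact two_ne_zero

/-- The step counts multiply, and `p` does not occur in the factors: the law of the interface is the
same for all reference paths. -/
theorem ncard_isInterface (hM : M.IsSphere) (hab : M.HasDigons a b) (hp : M.IsDualPath a b p)
    (hγ : M.IsDualPath a b γ) :
    {c | M.IsInterface a b γ p c}.ncard *
      ∏ i ∈ Finset.range γ.length, (M.candidates a b γ i).ncard = Nat.card (M.Vertex → Bool) := by
  have key : ∀ m, m ≤ γ.length →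
      {c | ∀ k (hk : k < γ.length), k < m → M.IsInterfaceEdge p c γ[k]}.ncard *
      ∏ i ∈ Finset.range m, (M.candidates a b γ i).ncard = Nat.card (M.Vertex → Bool) := by
    intro m
    induction m with
    | zero =>
      intro _
      simp [Set.ncard_univ]
    | succ m ih =>
      intro hm
      rw [Finset.prod_range_succ, mul_comm (∏ i ∈ Finset.range m, _), ← mul_assoc,
        ncard_colourings_step hM hab hp hγ hm, ih (by omega)]
  rw [← key γ.length le_rfl]
  congr 2
  ext c
  constructor
  · intro hc k hk _
    exact hc.2 _ (List.getElem_mem _)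
  · intro hc
    refine ⟨hγ, fun s hs => ?_⟩
    obtain ⟨k, hk, rfl⟩ := List.mem_iff_getElem.1 hs
    exact hc k hk hk

open Classical in
/-- The law of the percolation interface. -/
theorem percolation_apply (hM : M.IsSphere) (hab : M.HasDigons a b) (hp : M.IsDualPath a b p)
    (γ : List D) : M.percolation a b p γ =
      if M.IsExploration a b γ then ∏ i ∈ Finset.range γ.length, M.stepProb a b γ i else 0 := by
  have hee := hM.edge_edge
  let _ : Fintype (M.Vertex → Bool) := Fintype.ofFinite _
  have h1 : M.percolation a b p γ =
      ({c | M.IsInterface a b γ p c}.ncard : ENNReal) * (Nat.card (M.Vertex → Bool) : ENNReal)⁻¹ := by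
    show (PMF.map _ (PMF.uniformOfFintype (M.Vertex → Bool))) γ = _
    rw [PMF.map_apply, tsum_fintype]
    simp only [PMF.uniformOfFintype_apply]
    rw [← Finset.sum_filter, Finset.sum_const, nsmul_eq_mul, Nat.card_eq_fintype_card]
    congr 2
    rw [Set.ncard_eq_toFinset_card']
    congr 1
    ext c
    simp only [Finset.mem_filter, Finset.mem_univ, true_and, Set.mem_toFinset, Set.mem_ofPred_eq]
    rw [eq_comm, interface_eq_iff hM.edge_ne hee hab hp]
  rw [h1]
  by_cases hγ : M.IsDualPath a b γ
  · have h := hγ.isExploration hab.source_ne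
    rw [if_pos h]
    have h2 : ∀ i ∈ Finset.range γ.length, M.stepProb a b γ i =
        ((M.candidates a b γ i).ncard : ENNReal)⁻¹ := by
      intro i hi
      have hi' := Finset.mem_range.1 hi
      refine if_pos ?_
      have := (isDualPath_iff.1 hγ).1.adj (i := i) (by simpa using hi')
      rwa [← tip_eq_getElem, ← tip_eq_getElem] at this
    rw [Finset.prod_congr rfl h2, ← ENNReal.prod_inv_distrib, ← ncard_isInterface hM hab hp hγ]
    · push_cast
      set x : ENNReal := ∏ i ∈ Finset.range γ.length, ((M.candidates a b γ i).ncard : ENNReal)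
      have hx0 : x ≠ 0 := Finset.prod_ne_zero_iff.2 fun i hi => by
        exact_mod_cast candidates_ncard_ne_zero hM hab hγ (Finset.mem_range.1 hi)
      have hxt : x ≠ ⊤ := ENNReal.prod_ne_top fun i _ => ENNReal.natCast_ne_top _
      have hc0 : ({c | M.IsInterface a b γ p c}.ncard : ENNReal) ≠ 0 := by
        intro h0
        have h3 := ncard_isInterface hM hab hp hγ
        rw [Nat.cast_eq_zero.1 h0, zero_mul] at h3
        exact Nat.card_pos.ne h3
      rw [ENNReal.mul_inv (Or.inl hc0) (Or.inr hx0), ← mul_assoc,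
        ENNReal.mul_inv_cancel hc0 (ENNReal.natCast_ne_top _), one_mul]
    · intro i _ j _ _
      exact Or.inr (ENNReal.natCast_ne_top _)
  · have h0 : {c | M.IsInterface a b γ p c} = ∅ := by
      ext c
      exact iff_of_false (fun h => hγ h.1) (Set.notMem_empty c)
    rw [h0, Set.ncard_empty, Nat.cast_zero, zero_mul]
    split_ifs with h
    · by_contra hne
      have hne' := Finset.prod_ne_zero_iff.1 (Ne.symm hne)
      refine hγ (isDualPath_of_isExploration h fun i hi => ?_)
      by_contra hcon
      exact hne' i (Finset.mem_range.2 hi) (if_neg hcon)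
    · rfl

end steps

end CombMap

namespace CombMap

/-! ### The law of the Eden exploration -/

section eden

variable {D : Type} {M : CombMap D} {a b : D} {γ γ' : List D}

theorem regionAt_of_prefix {k : ℕ} (h : γ' <+: γ) (hk : k ≤ γ'.length) :
    M.regionAt a b γ k = M.regionAt a b γ' k := by
  obtain ⟨δ, rfl⟩ := h
  rw [regionAt, regionAt, List.take_append_of_le_length hk]

theorem regionAt_length : M.regionAt a b γ γ.length = M.region a b γ := by
  rw [regionAt, List.take_length]

theorem seed_append_singleton {s : D}
    (hseed : ∀ i (hi : i < γ.length), γ[i] ∈ M.bdry (M.regionAt a b γ i))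
    (hs : s ∈ M.bdry (M.region a b γ)) (i : ℕ) (hi : i < (γ ++ [s]).length) :
    (γ ++ [s])[i] ∈ M.bdry (M.regionAt a b (γ ++ [s]) i) := by
  rw [List.length_append, List.length_singleton] at hi
  rw [regionAt_of_prefix (List.prefix_append γ [s]) (by omega)]
  rcases Nat.lt_succ_iff_lt_or_eq.1 hi with hi | rfl
  · rw [List.getElem_append_left hi]
    exact hseed i hi
  · rw [List.getElem_append_right le_rfl, regionAt_length]
    simpa using hs

theorem target_notMem_explored_take (hb : b ∉ M.explored a γ) (k : ℕ) :
    b ∉ M.explored a (γ.take k) := fun h => hb (explored_mono (List.take_subset k γ) h)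

theorem target_notMem_explored_append {s : D} (hb : b ∉ M.explored a γ)
    (hs : M.faceOf s ≠ M.faceOf b) : b ∉ M.explored a (γ ++ [s]) := by
  rw [target_notMem_explored_iff] at hb ⊢
  refine ⟨hb.1, fun t ht => ?_⟩
  rcases List.mem_append.1 ht with ht | ht
  · exact hb.2 t ht
  · rwa [List.mem_singleton.1 ht]

theorem isExploration_append_singleton {s : D} (hb : b ∉ M.explored a γ)
    (hseed : ∀ i (hi : i < γ.length), γ[i] ∈ M.bdry (M.regionAt a b γ i))
    (hs : s ∈ M.bdry (M.region a b γ)) (hsb : M.faceOf s = M.faceOf b) :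
    M.IsExploration a b (γ ++ [s]) where
  source_ne := (target_notMem_explored_iff.1 hb).1
  ne_nil := by simp
  seed := seed_append_singleton hseed hs
  target i hi := by
    rw [List.length_append, List.length_singleton] at hi ⊢
    rcases Nat.lt_succ_iff_lt_or_eq.1 hi with hi | rfl
    · rw [List.getElem_append_left hi]
      exact iff_of_false ((target_notMem_explored_iff.1 hb).2 _ (List.getElem_mem _)) (by omega)
    · rw [List.getElem_append_right le_rfl]
      exact iff_of_true (by simpa using hsb) rfl

-- A general initial list `γ'` is needed for the induction. The bound `hk` ensures that the step
-- budget never cuts the exploration short, since the faces entered are distinct.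
open Classical in
theorem edenSteps_apply [Fintype D] (hM : M.IsSphere) (k : ℕ) (hb : b ∉ M.explored a γ')
    (hseed : ∀ i (hi : i < γ'.length), γ'[i] ∈ M.bdry (M.regionAt a b γ' i))
    (hk : Fintype.card D ≤ γ'.length + k) (γ : List D) :
    M.edenSteps a b k γ' γ = if γ' <+: γ ∧ M.IsExploration a b γ then
      ∏ i ∈ Finset.Ico γ'.length γ.length, ((M.bdry (M.regionAt a b γ i)).ncard : ENNReal)⁻¹
      else 0 := by
  induction k generalizing γ' with
  | zero =>
    have h1 := ((nodup_faces hseed fun k _ => target_notMem_explored_take hb k).of_map).length_le_card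
    simp only [List.length_cons] at h1
    omega
  | succ k ih =>
    -- The region is a disc, so the exploration is never stuck before the target.
    have hne : (M.bdry (M.region a b γ')).toFinset.Nonempty := by
      rw [Set.toFinset_nonempty]
      exact (region_isDisk hM hb hseed).bdry_nonempty hM
    rw [edenSteps, dif_pos hne, PMF.bind_apply]
    have hinner : ∀ s ∈ M.bdry (M.region a b γ'),
        (if M.faceOf s = M.faceOf b then PMF.pure (γ' ++ [s]) else
          M.edenSteps a b k (γ' ++ [s])) γ =
        if γ' ++ [s] <+: γ ∧ M.IsExploration a b γ then
          ∏ i ∈ Finset.Ico (γ'.length + 1) γ.length,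
            ((M.bdry (M.regionAt a b γ i)).ncard : ENNReal)⁻¹ else 0 := by
      intro s hs
      by_cases hsb : M.faceOf s = M.faceOf b
      · rw [if_pos hsb, PMF.pure_apply]
        have hE := isExploration_append_singleton hb hseed hs hsb
        by_cases hγ : γ = γ' ++ [s]
        · subst hγ
          rw [if_pos rfl, if_pos ⟨List.prefix_rfl, hE⟩]
          simp
        · rw [if_neg hγ, if_neg]
          rintro ⟨⟨δ, rfl⟩, hE'⟩
          apply hγ
          have h1 : (γ' ++ [s] ++ δ)[γ'.length]'(by simp) = s := by simp
          have h2 := (hE'.target γ'.length (by simp)).1 (by rw [h1, hsb])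
          simp only [List.length_append, List.length_singleton] at h2
          have h3 : δ = [] := List.length_eq_zero_iff.1 (by omega)
          rw [h3, List.append_nil]
      · rw [if_neg hsb, ih (target_notMem_explored_append hb hsb) (seed_append_singleton hseed hs)
          (by rw [List.length_append, List.length_singleton]; omega)]
        rw [List.length_append, List.length_singleton]
    have hterm : ∀ s, PMF.uniformOfFinset (M.bdry (M.region a b γ')).toFinset hne s *
        (if M.faceOf s = M.faceOf b then PMF.pure (γ' ++ [s]) else
          M.edenSteps a b k (γ' ++ [s])) γ =
        if s ∈ M.bdry (M.region a b γ') ∧ γ' ++ [s] <+: γ ∧ M.IsExploration a b γ then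
          ((M.bdry (M.region a b γ')).ncard : ENNReal)⁻¹ *
          ∏ i ∈ Finset.Ico (γ'.length + 1) γ.length,
            ((M.bdry (M.regionAt a b γ i)).ncard : ENNReal)⁻¹ else 0 := by
      intro s
      by_cases hs : s ∈ M.bdry (M.region a b γ')
      · rw [hinner s hs, PMF.uniformOfFinset_apply, if_pos (Set.mem_toFinset.2 hs),
          Set.ncard_eq_toFinset_card']
        simp [hs]
      · rw [PMF.uniformOfFinset_apply, if_neg (fun h => hs (Set.mem_toFinset.1 h)), zero_mul,
          if_neg fun h => hs h.1]
    rw [tsum_congr hterm]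
    by_cases hγ : γ' <+: γ ∧ M.IsExploration a b γ
    · rw [if_pos hγ]
      obtain ⟨⟨δ, rfl⟩, hE⟩ := hγ
      have hδ : δ ≠ [] := by
        rintro rfl
        rw [List.append_nil] at hE
        have h0 := hE.length_pos
        have h1 := (hE.target (γ'.length - 1) (by omega)).2 (by omega)
        exact (target_notMem_explored_iff.1 hb).2 _ (List.getElem_mem _) h1
      obtain ⟨s, δ, rfl⟩ := List.exists_cons_of_ne_nil hδ
      have hs : s ∈ M.bdry (M.region a b γ') := by
        have := hE.seed γ'.length (by simp)
        rw [regionAt_of_prefix (List.prefix_append _ _) le_rfl, regionAt_length] at this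
        simpa using this
      rw [tsum_eq_single s]
      · rw [if_pos ⟨hs, ⟨δ, by simp⟩, hE⟩,
          Finset.prod_eq_prod_Ico_succ_bot (show γ'.length < (γ' ++ s :: δ).length by simp),
          regionAt_of_prefix (List.prefix_append _ _) le_rfl, regionAt_length]
      · intro t ht
        refine if_neg fun h => ht ?_
        obtain ⟨η, hη⟩ := h.2.1
        rw [List.append_assoc, List.append_cancel_left_eq] at hη
        exact (List.cons_eq_cons.1 hη).1
    · rw [if_neg hγ]
      refine ENNReal.tsum_eq_zero.2 fun s => if_neg fun h => hγ ⟨?_, h.2.2⟩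
      exact (List.prefix_append _ _).trans h.2.1

open Classical in
/-- The law of the Eden exploration. -/
theorem eden_apply [Fintype D] (hM : M.IsSphere) (hab : M.faceOf a ≠ M.faceOf b) (γ : List D) :
    M.eden a b γ = if M.IsExploration a b γ then
      ∏ i ∈ Finset.range γ.length, ((M.bdry (M.regionAt a b γ i)).ncard : ENNReal)⁻¹ else 0 := by
  rw [eden, edenSteps_apply (γ' := []) hM _ (target_notMem_explored_iff.2 ⟨hab, by simp⟩)
    (fun i hi => absurd hi (Nat.not_lt_zero i)) (by rw [List.length_nil, zero_add])]
  simp only [List.nil_prefix, true_and, List.length_nil, Finset.range_eq_Ico]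

end eden

end CombMap

namespace CombMap

/-! ### Fattening an edge into a 2-gon -/

section fatten

variable {D : Type} {M : CombMap D} {d : D}

theorem fatten_face (M : CombMap D) (d : D) :
    (M.fatten d).face = Perm.sumCongr M.face Equiv.boolNot := rfl

theorem fatten_face_inl (x : D) : (M.fatten d).face (Sum.inl x) = Sum.inl (M.face x) := rfl

theorem fatten_face_inr (t : Bool) : (M.fatten d).face (Sum.inr t) = Sum.inr (!t) := rfl

open Classical in
theorem fatten_edge_apply (x : D ⊕ Bool) : (M.fatten d).edge x =
    swap (Sum.inl (M.edge d)) (Sum.inr false)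
      (Sum.map M.edge Equiv.boolNot (swap (Sum.inl (M.edge d)) (Sum.inr false) x)) := rfl

theorem fatten_edge_inl_self (hne : ∀ d, M.edge d ≠ d) :
    (M.fatten d).edge (Sum.inl d) = Sum.inr false := by
  classical
  rw [fatten_edge_apply, swap_apply_of_ne_of_ne (x := Sum.inl d)
    (by simpa using (hne d).symm) (by simp), Sum.map_inl, swap_apply_left]

theorem fatten_edge_inr_true : (M.fatten d).edge (Sum.inr true) = Sum.inl (M.edge d) := by
  classical
  rw [fatten_edge_apply, swap_apply_of_ne_of_ne (x := Sum.inr true) (by simp) (by simp),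
    Sum.map_inr]
  exact swap_apply_right _ _

theorem fatten_edge_inl_edge : (M.fatten d).edge (Sum.inl (M.edge d)) = Sum.inr true := by
  classical
  rw [fatten_edge_apply, swap_apply_left, Sum.map_inr]
  exact swap_apply_of_ne_of_ne (by simp) (by simp)

theorem fatten_edge_inr_false (hne : ∀ d, M.edge d ≠ d) (hee : ∀ d, M.edge (M.edge d) = d) :
    (M.fatten d).edge (Sum.inr false) = Sum.inl d := by
  classical
  rw [fatten_edge_apply, swap_apply_right, Sum.map_inl, hee]
  exact swap_apply_of_ne_of_ne (by simpa using (hne d).symm) (by simp)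

theorem fatten_edge_inl {x : D} (h1 : x ≠ d) (h2 : x ≠ M.edge d) :
    (M.fatten d).edge (Sum.inl x) = Sum.inl (M.edge x) := by
  classical
  rw [fatten_edge_apply, swap_apply_of_ne_of_ne (x := Sum.inl x) (by simpa using h2) (by simp),
    Sum.map_inl]
  exact swap_apply_of_ne_of_ne (by simpa using h1) (by simp)

/-- The vertex of the original map corresponding to the origin of a dart of the fattened map. -/
def fattenOrigin (M : CombMap D) (d : D) : D ⊕ Bool → M.Vertex
  | Sum.inl x => M.origin x
  | Sum.inr true => M.origin d
  | Sum.inr false => M.origin (M.edge d)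

section

variable (hne : ∀ d, M.edge d ≠ d) (hee : ∀ d, M.edge (M.edge d) = d)

include hne hee

theorem fattenOrigin_rot (x : D ⊕ Bool) :
    M.fattenOrigin d ((M.fatten d).rot x) = M.fattenOrigin d x := by
  have hrot : (M.fatten d).rot x = (M.fatten d).face ((M.fatten d).edge x) := rfl
  rw [hrot]
  rcases x with x | _ | _
  · by_cases h1 : x = d
    · subst h1
      rw [fatten_edge_inl_self hne]
      rfl
    · by_cases h2 : x = M.edge d
      · subst h2
        rw [fatten_edge_inl_edge]
        rfl
      · rw [fatten_edge_inl h1 h2]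
        exact origin_rot x
  · rw [fatten_edge_inr_false hne hee]
    exact origin_face hee d
  · rw [fatten_edge_inr_true]
    exact origin_rot d

/-- A turn over the fattened edge takes two turns in the new map, with a side of the 2-gon in
between. -/
theorem fatten_sameCycle_inl_rot (x : D) :
    (M.fatten d).rot.SameCycle (Sum.inl x) (Sum.inl (M.rot x)) := by
  have hrot : ∀ x, (M.fatten d).rot x = (M.fatten d).face ((M.fatten d).edge x) := fun x => rfl
  by_cases h1 : x = d
  · subst h1
    refine ⟨2, ?_⟩
    show (M.fatten x).rot ((M.fatten x).rot _) = _
    rw [hrot (Sum.inl x), fatten_edge_inl_self hne, fatten_face_inr, hrot]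
    exact congrArg _ fatten_edge_inr_true
  · by_cases h2 : x = M.edge d
    · subst h2
      refine ⟨2, ?_⟩
      show (M.fatten d).rot ((M.fatten d).rot _) = _
      rw [hrot (Sum.inl _), fatten_edge_inl_edge, fatten_face_inr, hrot]
      refine (congrArg _ (fatten_edge_inr_false hne hee)).trans ?_
      rw [fatten_face_inl]
      show _ = Sum.inl (M.face (M.edge (M.edge d)))
      rw [hee]
    · refine ⟨1, ?_⟩
      rw [zpow_one, hrot, fatten_edge_inl h1 h2]
      rfl

theorem fatten_origin_eq_iff [Finite D] (x y : D ⊕ Bool) :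
    (M.fatten d).origin x = (M.fatten d).origin y ↔
      M.fattenOrigin d x = M.fattenOrigin d y := by
  have hpow : ∀ (k : ℕ) x, M.fattenOrigin d (((M.fatten d).rot ^ k) x) = M.fattenOrigin d x := by
    intro k
    induction k with
    | zero => intro x; rfl
    | succ k ih => intro x; rw [pow_succ', Perm.mul_apply, fattenOrigin_rot hne hee, ih]
  have hinl : ∀ x y, M.rot.SameCycle x y →
      (M.fatten d).rot.SameCycle (Sum.inl x) (Sum.inl y) := by
    intro x y h
    obtain ⟨k, -, rfl⟩ := h.exists_pow_eq'
    induction k with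
    | zero => exact Perm.SameCycle.refl _ _
    | succ k ih =>
      rw [pow_succ', Perm.mul_apply]
      exact (ih ⟨k, rfl⟩).trans (fatten_sameCycle_inl_rot hne hee _)
  have hrep : ∀ x, ∃ x', (M.fatten d).rot.SameCycle (Sum.inl x') x ∧
      M.fattenOrigin d x = M.origin x' := by
    have hrot : ∀ x, (M.fatten d).rot x = (M.fatten d).face ((M.fatten d).edge x) := fun x => rfl
    rintro (x | _ | _)
    · exact ⟨x, Perm.SameCycle.refl _ _, rfl⟩
    · refine ⟨M.edge d, ⟨1, ?_⟩, rfl⟩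
      rw [zpow_one, hrot, fatten_edge_inl_edge]
      rfl
    · refine ⟨d, ⟨1, ?_⟩, rfl⟩
      rw [zpow_one, hrot, fatten_edge_inl_self hne]
      rfl
  constructor
  · intro h
    obtain ⟨k, -, rfl⟩ := (Quotient.exact h : (M.fatten d).rot.SameCycle x y).exists_pow_eq'
    exact (hpow k x).symm
  · intro h
    obtain ⟨x', hx, ex⟩ := hrep x
    obtain ⟨y', hy, ey⟩ := hrep y
    rw [ex, ey] at h
    exact Quotient.sound (hx.symm.trans ((hinl _ _ (Quotient.exact h)).trans hy))

theorem fatten_edge_ne (x : D ⊕ Bool) : (M.fatten d).edge x ≠ x := by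
  rcases x with x | _ | _
  · by_cases h1 : x = d
    · subst h1; rw [fatten_edge_inl_self hne]; simp
    · by_cases h2 : x = M.edge d
      · subst h2; rw [fatten_edge_inl_edge]; simp
      · rw [fatten_edge_inl h1 h2]; simpa using hne x
  · rw [fatten_edge_inr_false hne hee]; simp
  · rw [fatten_edge_inr_true]; simp

theorem fatten_edge_edge (x : D ⊕ Bool) : (M.fatten d).edge ((M.fatten d).edge x) = x := by
  rcases x with x | _ | _
  · by_cases h1 : x = d
    · subst h1; rw [fatten_edge_inl_self hne, fatten_edge_inr_false hne hee]
    · by_cases h2 : x = M.edge d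
      · subst h2; rw [fatten_edge_inl_edge, fatten_edge_inr_true]
      · rw [fatten_edge_inl h1 h2, fatten_edge_inl, hee]
        · intro h; apply h2; rw [← h, hee]
        · intro h; exact h1 (M.edge.injective h)
  · rw [fatten_edge_inr_false hne hee, fatten_edge_inl_self hne]
  · rw [fatten_edge_inr_true, fatten_edge_inl_edge]

theorem fatten_card [Finite D] : Nat.card (M.fatten d).Vertex = Nat.card M.Vertex ∧
    Nat.card (M.fatten d).Edge = Nat.card M.Edge + 1 ∧
    Nat.card (M.fatten d).Face = Nat.card M.Face + 1 := by
  refine ⟨?_, ?_, ?_⟩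
  · refine card_cycles _ (M.fattenOrigin d) ?_ (fattenOrigin_rot hne hee) ?_
    · intro v
      obtain ⟨x, rfl⟩ : ∃ x, M.origin x = v := Quotient.exists_rep v
      exact ⟨Sum.inl x, rfl⟩
    · intro x y h
      exact Quotient.exact ((fatten_origin_eq_iff hne hee x y).2 h)
  · have h1 := card_darts (M := M) hne hee
    have h2 := card_darts (M := M.fatten d) (fatten_edge_ne hne hee) (fatten_edge_edge hne hee)
    rw [Nat.card_sum, Nat.card_eq_fintype_card (α := Bool), Fintype.card_bool] at h2
    omega
  · have h1 : Nat.card (M.Face ⊕ Unit) = Nat.card M.Face + 1 := by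
      rw [Nat.card_sum, Nat.card_unique (α := Unit)]
    rw [← h1]
    refine card_cycles _ (Sum.map M.faceOf fun _ => ()) ?_ ?_ ?_
    · rintro (f | _)
      · obtain ⟨x, rfl⟩ : ∃ x, M.faceOf x = f := Quotient.exists_rep f
        exact ⟨Sum.inl x, rfl⟩
      · exact ⟨Sum.inr true, rfl⟩
    · rintro (x | t)
      · exact congrArg Sum.inl (faceOf_face x)
      · rfl
    · rintro (x | t) (y | t') h
      · obtain ⟨k, hk⟩ : M.face.SameCycle x y := Quotient.exact (Sum.inl_injective h)
        refine ⟨k, ?_⟩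
        have h2 : (M.fatten d).face ^ k = Perm.sumCongr (M.face ^ k) (Equiv.boolNot ^ k) := by
          rw [fatten_face]
          exact (map_zpow (Perm.sumCongrHom D Bool) (M.face, Equiv.boolNot) k).symm
        rw [h2, Perm.sumCongr_apply, Sum.map_inl, hk]
      · exact absurd h (by simp)
      · exact absurd h (by simp)
      · by_cases htt : t = t'
        · rw [htt]
        · refine ⟨1, ?_⟩
          rw [zpow_one, fatten_face_inr]
          congr 1
          clear h; revert htt; revert t t'; decide

/-- Fattening keeps the vertices and adds one edge and one face, so the Euler characteristic is the
same; the two copies of the edge have the ends of the original one. -/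
theorem fatten_isSphere_iff [Finite D] : (M.fatten d).IsSphere ↔ M.IsSphere := by
  obtain ⟨hV, hE, hF⟩ := fatten_card (d := d) hne hee
  have hlab := fatten_origin_eq_iff (d := d) hne hee
  constructor
  · intro h
    refine ⟨hne, hee, ?_, ?_, ?_⟩
    · set G := Subgroup.closure {M.face, M.edge} with hG
      have hf : M.face ∈ G := Subgroup.subset_closure (by simp)
      have he : M.edge ∈ G := Subgroup.subset_closure (by simp)
      -- A side of the 2-gon is projected to the dart glued to it.
      let base : D ⊕ Bool → D := Sum.elim id fun t => if t then M.edge d else d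
      have mul : ∀ g ∈ G, ∀ x y, (∃ h ∈ G, h x = y) → ∃ h ∈ G, h x = g y := by
        rintro g hg x _ ⟨h, hh, rfl⟩
        exact ⟨g * h, G.mul_mem hg hh, rfl⟩
      intro x y
      refine connected_induction h.connected (P := fun z => ∃ g ∈ G, g x = base z) ?_ ?_
        (d := Sum.inl x) ⟨1, G.one_mem, rfl⟩ (Sum.inl y)
      · rintro (z | _ | _) hz
        · exact mul _ hf _ _ hz
        · exact mul _ he _ _ hz
        · have := mul _ he _ _ hz
          have e : M.edge (base (Sum.inr true)) = base (Sum.inr false) := hee d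
          rwa [e] at this
      · rintro (z | _ | _) hz
        · by_cases h1 : z = d
          · subst h1; rw [fatten_edge_inl_self hne]; exact hz
          · by_cases h2 : z = M.edge d
            · subst h2; rw [fatten_edge_inl_edge]; exact hz
            · rw [fatten_edge_inl h1 h2]; exact mul _ he _ _ hz
        · rw [fatten_edge_inr_false hne hee]; exact hz
        · rw [fatten_edge_inr_true]; exact hz
    · have := h.euler
      rw [hV, hE, hF] at this
      push_cast at this
      linarith
    · intro x hx
      by_cases h1 : x = d
      · subst h1
        refine h.loopless (Sum.inl x) ((hlab _ _).2 ?_)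
        rw [fatten_edge_inl_self hne]
        exact hx
      · by_cases h2 : x = M.edge d
        · subst h2
          refine h.loopless (Sum.inl (M.edge d)) ((hlab _ _).2 ?_)
          rw [fatten_edge_inl_edge]
          rw [hee] at hx
          exact hx
        · refine h.loopless (Sum.inl x) ((hlab _ _).2 ?_)
          rw [fatten_edge_inl h1 h2]
          exact hx
  · intro h
    refine ⟨fatten_edge_ne hne hee, fatten_edge_edge hne hee, ?_, ?_, ?_⟩
    · set G := Subgroup.closure {(M.fatten d).face, (M.fatten d).edge} with hG
      have hf : (M.fatten d).face ∈ G := Subgroup.subset_closure (by simp)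
      have he : (M.fatten d).edge ∈ G := Subgroup.subset_closure (by simp)
      have mul : ∀ g ∈ G, ∀ x y, (∃ h ∈ G, h x = y) → ∃ h ∈ G, h x = g y := by
        rintro g hg x _ ⟨h, hh, rfl⟩
        exact ⟨g * h, G.mul_mem hg hh, rfl⟩
      have hinl : ∀ y, ∃ g ∈ G, g (Sum.inl d) = Sum.inl y := by
        refine connected_induction h.connected
          (P := fun y => ∃ g ∈ G, g (Sum.inl d) = (Sum.inl y : D ⊕ Bool)) ?_ ?_
          (d := d) ⟨1, G.one_mem, rfl⟩
        · intro y hy; exact mul _ hf _ _ hy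
        · intro y hy
          by_cases h1 : y = d
          · subst h1
            have := mul _ he _ _ (mul _ hf _ _ (mul _ he _ _ hy))
            rwa [fatten_edge_inl_self hne, fatten_face_inr, Bool.not_false,
              fatten_edge_inr_true] at this
          · by_cases h2 : y = M.edge d
            · subst h2
              have := mul _ he _ _ (mul _ hf _ _ (mul _ he _ _ hy))
              rw [fatten_edge_inl_edge, fatten_face_inr, Bool.not_true,
                fatten_edge_inr_false hne hee] at this
              rwa [hee]
            · have := mul _ he _ _ hy
              rwa [fatten_edge_inl h1 h2] at this
      have hall : ∀ y, ∃ g ∈ G, g (Sum.inl d) = y := by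
        rintro (y | _ | _)
        · exact hinl y
        · have := mul _ he _ _ (hinl d)
          rwa [fatten_edge_inl_self hne] at this
        · have := mul _ he _ _ (hinl (M.edge d))
          rwa [fatten_edge_inl_edge] at this
      intro x y
      obtain ⟨g, hg, rfl⟩ := hall x
      obtain ⟨g', hg', rfl⟩ := hall y
      exact ⟨g' * g⁻¹, G.mul_mem hg' (G.inv_mem hg), congrArg g' (g.symm_apply_apply _)⟩
    · have := h.euler
      rw [hV, hE, hF]
      push_cast
      linarith
    · intro x hx
      rw [hlab] at hx
      rcases x with x | _ | _
      · by_cases h1 : x = d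
        · subst h1
          rw [fatten_edge_inl_self hne] at hx
          exact h.loopless x hx
        · by_cases h2 : x = M.edge d
          · subst h2
            rw [fatten_edge_inl_edge] at hx
            exact h.loopless d hx.symm
          · rw [fatten_edge_inl h1 h2] at hx
            exact h.loopless x hx
      · rw [fatten_edge_inr_false hne hee] at hx
        exact h.loopless d hx.symm
      · rw [fatten_edge_inr_true] at hx
        exact h.loopless d hx

end

theorem fatten_injective {M' : CombMap D} {d' : D} (hne : ∀ d, M.edge d ≠ d)
    (hee : ∀ d, M.edge (M.edge d) = d) (hne' : ∀ d, M'.edge d ≠ d)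
    (hee' : ∀ d, M'.edge (M'.edge d) = d) (h : M.fatten d = M'.fatten d') : M = M' ∧ d = d' := by
  have hd : d = d' := by
    have h1 := fatten_edge_inr_false (d := d) hne hee
    rw [h, fatten_edge_inr_false hne' hee'] at h1
    exact (Sum.inl_injective h1).symm
  subst hd
  have hd' : M.edge d = M'.edge d := by
    have h1 := fatten_edge_inr_true (M := M) (d := d)
    rw [h, fatten_edge_inr_true] at h1
    exact (Sum.inl_injective h1).symm
  refine ⟨CombMap.ext ?_ ?_, rfl⟩
  · ext x
    have h1 : (M.fatten d).face (Sum.inl x) = (M'.fatten d).face (Sum.inl x) := by rw [h]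
    exact Sum.inl_injective h1
  · ext x
    by_cases h1 : x = d
    · rw [h1, hd']
    · by_cases h2 : x = M.edge d
      · rw [h2, hee, hd', hee']
      · have h3 : (M.fatten d).edge (Sum.inl x) = (M'.fatten d).edge (Sum.inl x) := by rw [h]
        rw [fatten_edge_inl h1 h2, fatten_edge_inl h1 (hd' ▸ h2)] at h3
        exact Sum.inl_injective h3

/-- A map of the sphere with a 2-gon arises by fattening. -/
theorem exists_eq_fatten [Finite D] [Nonempty D] {X : CombMap (D ⊕ Bool)} {f : Perm D}
    (hX : X.IsSphere) (hf : X.face = Perm.sumCongr f Equiv.boolNot) :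
    ∃ (M : CombMap D) (d : D), X = M.fatten d ∧ M.face = f ∧ M.IsSphere := by
  have hee := hX.edge_edge
  have hft : ∀ t, X.face (Sum.inr t) = Sum.inr (!t) := fun t => by rw [hf]; rfl
  obtain ⟨x0⟩ := ‹Nonempty D›
  -- If the sides of the 2-gon were glued to each other, the 2-gon would be the entire connected
  -- map.
  have hnot : X.edge (Sum.inr false) ≠ Sum.inr true := by
    intro h
    have h' : X.edge (Sum.inr true) = Sum.inr false := by rw [← h, hee]
    have := connected_induction hX.connected (P := fun z => ∃ t, z = Sum.inr t)
      (by rintro _ ⟨t, rfl⟩; exact ⟨_, hft t⟩)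
      (by rintro _ ⟨_ | _, rfl⟩; exacts [⟨_, h⟩, ⟨_, h'⟩]) ⟨true, rfl⟩ (Sum.inl x0)
    obtain ⟨t, ht⟩ := this
    exact absurd ht (by simp)
  obtain ⟨d, hd⟩ : ∃ d, X.edge (Sum.inr false) = Sum.inl d := by
    rcases h : X.edge (Sum.inr false) with d | _ | _
    · exact ⟨d, rfl⟩
    · exact absurd h (hX.edge_ne _)
    · exact absurd h hnot
  obtain ⟨d', hd'⟩ : ∃ d, X.edge (Sum.inr true) = Sum.inl d := by
    rcases h : X.edge (Sum.inr true) with d | _ | _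
    · exact ⟨d, rfl⟩
    · exact absurd (by rw [← h, hee]) hnot
    · exact absurd h (hX.edge_ne _)
  have hdi : X.edge (Sum.inl d) = Sum.inr false := by rw [← hd, hee]
  have hdi' : X.edge (Sum.inl d') = Sum.inr true := by rw [← hd', hee]
  have hdd : d ≠ d' := by
    rintro rfl
    rw [hdi] at hdi'
    exact absurd hdi' (by simp)
  -- Closing the 2-gon replaces each of its sides by the dart across its other side.
  let back : D ⊕ Bool → D := Sum.elim id fun t => if t then d else d'
  let e : D → D := fun x => back (X.edge (Sum.inl x))
  have ed : e d = d' := by simp [e, back, hdi]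
  have ed' : e d' = d := by simp [e, back, hdi']
  have eo : ∀ x, x ≠ d → x ≠ d' → X.edge (Sum.inl x) = Sum.inl (e x) := by
    intro x h1 h2
    rcases h : X.edge (Sum.inl x) with y | _ | _
    · simp [e, back, h]
    · rw [← hdi] at h
      exact absurd (Sum.inl_injective (X.edge.injective h)) h1
    · rw [← hdi'] at h
      exact absurd (Sum.inl_injective (X.edge.injective h)) h2
  have hne : ∀ x, e x ≠ x := by
    intro x hx
    by_cases h1 : x = d
    · rw [h1, ed] at hx; exact hdd hx.symm
    · by_cases h2 : x = d'
      · rw [h2, ed'] at hx; exact hdd hx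
      · have := eo x h1 h2
        rw [hx] at this
        exact hX.edge_ne _ this
  have hinv : Function.Involutive e := by
    intro x
    by_cases h1 : x = d
    · rw [h1, ed, ed']
    · by_cases h2 : x = d'
      · rw [h2, ed', ed]
      · have h3 := eo x h1 h2
        have h4 : X.edge (Sum.inl (e x)) = Sum.inl x := by rw [← h3, hee]
        show back (X.edge (Sum.inl (e x))) = x
        rw [h4]
        rfl
  let M : CombMap D := ⟨f, hinv.toPerm⟩
  have hME : ∀ x, M.edge x = e x := fun x => rfl
  have hMne : ∀ x, M.edge x ≠ x := hne
  have hMee : ∀ x, M.edge (M.edge x) = x := hinv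
  have hXM : X = M.fatten d := by
    refine CombMap.ext hf (Equiv.ext ?_)
    have hMd : M.edge d = d' := ed
    rintro (x | _ | _)
    · by_cases h1 : x = d
      · rw [h1, hdi, fatten_edge_inl_self hMne]
      · by_cases h2 : x = d'
        · rw [h2, hdi', ← hMd, fatten_edge_inl_edge]
        · rw [eo x h1 h2, fatten_edge_inl h1 (by rwa [hMd])]
          rfl
    · rw [hd, fatten_edge_inr_false hMne hMee]
    · rw [hd', fatten_edge_inr_true, hMd]
  exact ⟨M, d, hXM, rfl, (fatten_isSphere_iff hMne hMee).1 (hXM ▸ hX)⟩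

end fatten

end CombMap

/-! ### The set of fattened triangulations -/

namespace MarkedTriangulation

open CombMap

variable {n : ℕ}

theorem fat_face (ω : MarkedTriangulation n) :
    ω.fat.face = Perm.sumCongr (Perm.sumCongr ω.map.face Equiv.boolNot) Equiv.boolNot := rfl

theorem fat_isSphere (ω : MarkedTriangulation n) : ω.fat.IsSphere := by
  have h0 := ω.isSphere.isSphere
  have h1 := (fatten_isSphere_iff (d := ω.e₁) h0.edge_ne h0.edge_edge).2 h0
  exact (fatten_isSphere_iff h1.edge_ne h1.edge_edge).2 h1

theorem fat_hasDigons (ω : MarkedTriangulation n) : ω.fat.HasDigons (source n) (target n) := by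
  have hsrc : ∀ t, ω.fat.faceOf (Sum.inl (Sum.inr t)) = ω.fat.faceOf (source n) := by
    intro t
    cases t
    · rfl
    · exact faceOf_face (M := ω.fat) (source n)
  have htgt : ∀ t, ω.fat.faceOf (Sum.inr t) = ω.fat.faceOf (target n) := by
    intro t
    cases t
    · rfl
    · exact faceOf_face (M := ω.fat) (target n)
  refine ⟨?_, rfl, ?_, rfl, ?_, ?_, ?_⟩
  · intro h
    obtain ⟨k, hk⟩ := eq_or_of_faceOf_eq h
    have hpow : ∀ k : ℕ, ∃ t, (ω.fat.face ^ k) (target n) = Sum.inr t := by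
      intro k
      induction k with
      | zero => exact ⟨_, rfl⟩
      | succ k ih =>
        obtain ⟨t, ht⟩ := ih
        exact ⟨!t, by rw [pow_succ', Perm.mul_apply, ht]; rfl⟩
    obtain ⟨t, ht⟩ := hpow k
    rw [hk] at ht
    exact absurd ht (by simp [source])
  · intro h
    exact absurd (Sum.inr_injective (Sum.inl_injective h)) (by decide)
  · intro h
    exact absurd (Sum.inr_injective h) (by decide)
  · rintro ((x | t) | t) h1 h2
    · exact congrArg (Sum.inl ∘ Sum.inl) (ω.isSphere.face_face_face x)
    · exact absurd (hsrc t) h1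
    · exact absurd (htgt t) h2
  · rintro ((x | t) | t) h1 h2
    · intro h
      exact ω.isSphere.face_ne x (Sum.inl_injective (Sum.inl_injective h))
    · exact absurd (hsrc t) h1
    · exact absurd (htgt t) h2

/-- Under the uniform law on marked triangulations, all fattened maps therefore have the same
probability. -/
theorem fat_injective : Function.Injective (fat (n := n)) := by
  intro ω ω' h
  have h0 := ω.isSphere.isSphere
  have h0' := ω'.isSphere.isSphere
  have h1 := (fatten_isSphere_iff (d := ω.e₁) h0.edge_ne h0.edge_edge).2 h0
  have h1' := (fatten_isSphere_iff (d := ω'.e₁) h0'.edge_ne h0'.edge_edge).2 h0'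
  obtain ⟨e1, e2⟩ := fatten_injective h1.edge_ne h1.edge_edge h1'.edge_ne h1'.edge_edge h
  obtain ⟨e3, e4⟩ := fatten_injective h0.edge_ne h0.edge_edge h0'.edge_ne h0'.edge_edge e1
  exact MarkedTriangulation.ext e3 e4 e2

/-- The fattened triangulations are exactly the maps of the sphere with the same faces. -/
theorem mem_range_fat_of_face_eq (hn : 2 < n) {X X' : CombMap (FatDart n)}
    (hX : X ∈ Set.range (fat (n := n)))
    (hface : X'.face = X.face) (hX' : X'.IsSphere) : X' ∈ Set.range (fat (n := n)) := by
  obtain ⟨ω, rfl⟩ := hX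
  have : Nonempty (Fin (6 * (n - 2))) := ⟨ω.e₁⟩
  obtain ⟨M₁, d₁, rfl, hf₁, hM₁⟩ := exists_eq_fatten hX' (hface.trans ω.fat_face)
  obtain ⟨M₀, d₀, rfl, hf₀, hM₀⟩ := exists_eq_fatten hM₁ hf₁
  have hT : M₀.IsSphereTriangulation := by
    refine ⟨hM₀.edge_ne, hM₀.edge_edge, ?_, ?_, hM₀.connected, hM₀.euler, hM₀.loopless⟩
    · rw [hf₀]; exact ω.isSphere.face_ne
    · rw [hf₀]; exact ω.isSphere.face_face_face
  have hV : Nat.card M₀.Vertex = n := by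
    -- The number of vertices follows from Euler's formula, with `6 (n - 2)` darts, two per edge and
    -- three per face.
    have h1 := card_darts hM₀.edge_ne hM₀.edge_edge
    have h2 := card_darts_of_triangulation hT
    have h3 := hM₀.euler
    rw [Nat.card_eq_fintype_card, Fintype.card_fin] at h1 h2
    omega
  exact ⟨⟨M₀, hT, hV, d₀, d₁⟩, rfl⟩

end MarkedTriangulation

namespace CombMap

/-! ### Rotations and the steps of the percolation exploration -/

namespace IsExploration

variable {D : Type} [Finite D] {M : CombMap D} {a b : D} {γ : List D} {i j : ℕ}

/-- Needed for arbitrary explorations, since the intermediate laws are not carried by dual paths. If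
the last face did not border the new region, nothing would separate that region from the rest of the
old one, which is connected and contains the last face. -/
theorem candidates_nonempty (h : M.IsExploration a b γ) (hM : M.IsSphere) (hj : j < γ.length) :
    (M.candidates a b γ j).Nonempty := by
  have hR := h.isDisk hM hj
  rcases j with _ | j
  · obtain ⟨s, hs⟩ := hR.bdry_nonempty hM
    obtain ⟨t, ht, e⟩ := edge_mem_explored_of_mem_bdry hs
    rw [List.take_zero, List.mem_singleton] at ht
    exact ⟨s, hs.1, by rw [e, ht]; rfl⟩
  · have hS := h.isDisk hM (show j < γ.length by omega)
    have hsub : M.regionAt a b γ (j + 1) ⊆ M.regionAt a b γ j := regionAt_anti (Nat.le_succ j)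
    by_contra hne
    rw [Set.not_nonempty_iff_eq_empty, Set.eq_empty_iff_forall_notMem] at hne
    have hcross : ∀ d ∈ M.regionAt a b γ (j + 1), M.edge d ∈ M.regionAt a b γ j →
        M.edge d ∈ M.regionAt a b γ (j + 1) := by
      intro d hd hd'
      by_contra hd2
      obtain ⟨t, ht, e⟩ := edge_mem_explored_of_mem_bdry ⟨hd, hd2⟩
      have hold := h.notMem_explored (show j < γ.length by omega) hd'
      rw [List.take_succ_eq_append_getElem (by omega), ← List.cons_append, List.mem_append,
        List.mem_singleton] at ht
      rcases ht with ht | ht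
      · exact hold ⟨t, ht, e⟩
      · exact hne d ⟨hd, by rw [e, ht, tip_succ (by omega)]⟩
    have hall := hS.conn (fun d => d ∈ M.regionAt a b γ (j + 1)) (fun d _ => hR.face_mem d)
      (fun d hd hd' => ⟨fun h' => by
        have := hcross _ h' (by rwa [hM.edge_edge])
        rwa [hM.edge_edge] at this, fun h' => hcross d h' hd'⟩)
      b target_mem_region γ[j] (h.seed j (by omega)).1 target_mem_region
    exact h.notMem_explored hj hall (seed_mem_explored (Nat.lt_succ_self j) (by omega))

variable (h : M.IsExploration a b γ) (hM : M.IsSphere) (hj : j < γ.length) {u : Perm D}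
  (hu : u ∈ Subgroup.zpowers (M.nextBdry (M.regionAt a b γ j)))

include h hM hj hu

/-- For `j < i`, both `s` and the face entered in step `i` lie in `R_j`, and adjacency inside `R_j`
is not changed. -/
theorem reglue_edge_faceOf_iff (hi : i < γ.length) (hji : j < i) {s : D}
    (hs : s ∈ M.regionAt a b γ i) :
    M.faceOf ((M.reglue u).edge s) = M.faceOf (tip a γ i) ↔
      M.faceOf (M.edge s) = M.faceOf (tip a γ i) := by
  have hS := h.isDisk hM hj
  by_cases hsb : M.edge s ∈ M.regionAt a b γ j
  · rw [reglue_edge_of_mem hM hu (regionAt_anti hji.le hs) hsb]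
  · have htip : tip a γ i ∈ M.regionAt a b γ j := by
      obtain ⟨k, rfl⟩ : ∃ k, i = k + 1 := ⟨i - 1, by omega⟩
      rw [tip_succ (by omega)]
      exact regionAt_anti (by omega) (h.seed k (by omega)).1
    refine iff_of_false (fun h' => ?_) fun h' => hsb (mem_of_faceOf_eq hS.face_mem htip h')
    exact reglue_edge_notMem hM hS hu ⟨regionAt_anti hji.le hs, hsb⟩
      (mem_of_faceOf_eq hS.face_mem htip h')

theorem stepProb_reglue (hi : i < γ.length) (hji : j < i) :
    (M.reglue u).stepProb a b γ i = M.stepProb a b γ i := by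
  have h1 : (M.reglue u).candidates a b γ i = M.candidates a b γ i := by
    ext s
    rw [candidates, candidates, h.regionAt_reglue hM hj hu hi]
    exact and_congr_right fun hs => h.reglue_edge_faceOf_iff hM hj hu hi hji hs
  have h2 := h.reglue_edge_faceOf_iff hM hj hu hi hji (s := tip a γ (i + 1)) (by
    rw [tip_succ hi]; exact (h.seed i hi).1)
  classical
  unfold stepProb
  rw [h1]
  exact if_congr h2 rfl rfl

-- The new candidates are the old ones turned by `u`; equivalently, the seed is turned back by
-- `u⁻¹`.
open Classical in
theorem stepProb_reglue_self : (M.reglue u).stepProb a b γ j =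
    if u⁻¹ γ[j] ∈ M.candidates a b γ j then ((M.candidates a b γ j).ncard : ENNReal)⁻¹ else 0 := by
  have hS := h.isDisk hM hj
  have h' := h.reglue hM hj hu
  have hbd := bdry_reglue_of_subset hM hS hu subset_rfl
  have hseed := h.seed j hj
  have hmem := rotation_mem_bdry hM hS hu
  have hmem' := rotation_mem_bdry hM hS (Subgroup.inv_mem _ hu)
  have hR := h.regionAt_reglue hM hj hu hj
  have h1 : (M.reglue u).candidates a b γ j = u '' M.candidates a b γ j := by
    ext d
    obtain ⟨s, rfl⟩ := u.surjective d
    rw [u.injective.mem_set_image]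
    have key : s ∈ M.bdry (M.regionAt a b γ j) → (u s ∈ (M.reglue u).candidates a b γ j ↔
        s ∈ M.candidates a b γ j) := by
      intro hs
      simp only [candidates, Set.mem_ofPred_eq]
      rw [hR, reglue_edge_apply, rotation_of_notMem hu fun h => hs.2 h.1]
      exact and_congr_left fun _ => iff_of_true ((hmem s).2 hs).1 hs.1
    constructor
    · intro hs
      refine (key ?_).1 hs
      have := candidates_subset_bdry h' hj hs
      rw [hR, hbd] at this
      exact (hmem s).1 this
    · intro hs
      exact (key (candidates_subset_bdry h hj hs)).2 hs
  unfold stepProb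
  rw [h1, Set.ncard_image_of_injective _ u.injective, tip_succ hj,
    reglue_edge_of_mem_bdry hM hS hu hseed]
  exact if_congr ⟨fun e => ⟨((hmem' _).2 hseed).1, e⟩, fun e => e.2⟩ rfl rfl

-- The dart `u⁻¹ γ[j]` visits each edge of `C_j` once, and each candidate contributes the inverse of
-- the number of candidates. This averaging is what turns percolation into Eden.
omit hu in
theorem sum_stepProb_reglue
    [Fintype (Subgroup.zpowers (M.nextBdry (M.regionAt a b γ j)))] :
    ∑ u : Subgroup.zpowers (M.nextBdry (M.regionAt a b γ j)),
      (M.reglue (u : Perm D)).stepProb a b γ j = 1 := by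
  classical
  have hS := h.isDisk hM hj
  have := Fintype.ofFinite D
  rw [Finset.sum_congr rfl fun u _ => h.stepProb_reglue_self hM hj u.2,
    (rotation_bijective hM hS (h.seed j hj)).sum_comp
      (fun d : M.bdry (M.regionAt a b γ j) => if (d : D) ∈ M.candidates a b γ j then
        ((M.candidates a b γ j).ncard : ENNReal)⁻¹ else 0), ← Finset.sum_filter,
    Finset.sum_const, nsmul_eq_mul]
  have h1 : (Finset.univ.filter fun d : M.bdry (M.regionAt a b γ j) =>
      (d : D) ∈ M.candidates a b γ j).card = (M.candidates a b γ j).ncard := by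
    rw [Set.ncard_eq_toFinset_card', ← Finset.card_map (Function.Embedding.subtype _)]
    congr 1
    ext d
    simp only [Finset.mem_map, Finset.mem_filter, Finset.mem_univ, true_and,
      Function.Embedding.subtype_apply, Set.mem_toFinset]
    exact ⟨fun ⟨x, hx, e⟩ => e ▸ hx, fun hd => ⟨⟨d, candidates_subset_bdry h hj hd⟩, hd, rfl⟩⟩
  rw [h1]
  refine ENNReal.mul_inv_cancel ?_ (ENNReal.natCast_ne_top _)
  have := (Set.ncard_pos).2 (h.candidates_nonempty hM hj)
  exact_mod_cast this.ne'

end IsExploration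

/-! ### Random rotations -/

section randomRotation

variable {D : Type} [Finite D]

open Classical in
/-- The law of a map after a random rotation by a power of `ν`. -/
noncomputable def rotationLaw (ν : Perm D) (M : CombMap D) : PMF (CombMap D) :=
  haveI : Fintype (Subgroup.zpowers ν) := Fintype.ofFinite _
  (PMF.uniformOfFintype (Subgroup.zpowers ν)).map
    fun u : Subgroup.zpowers ν => M.reglue (u : Perm D)

theorem rotationLaw_apply (ν : Perm D) (M N : CombMap D) [Fintype (Subgroup.zpowers ν)]
    [DecidableEq (CombMap D)] :
    rotationLaw ν M N = ∑ u : Subgroup.zpowers ν,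
      if N = M.reglue (u : Perm D) then (Nat.card (Subgroup.zpowers ν) : ENNReal)⁻¹ else 0 := by
  rw [rotationLaw, PMF.map_apply, tsum_fintype]
  simp only [PMF.uniformOfFintype_apply, Nat.card_eq_fintype_card]
  convert rfl

theorem mem_support_rotationLaw {ν : Perm D} {M N : CombMap D} :
    N ∈ (rotationLaw ν M).support ↔ ∃ u ∈ Subgroup.zpowers ν, M.reglue u = N := by
  rw [rotationLaw, PMF.mem_support_map_iff]
  constructor
  · rintro ⟨u, -, rfl⟩
    exact ⟨u, u.2, rfl⟩
  · rintro ⟨u, hu, rfl⟩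
    let _ : Fintype (Subgroup.zpowers ν) := Fintype.ofFinite _
    exact ⟨⟨u, hu⟩, PMF.mem_support_uniformOfFintype _, rfl⟩

/-- The maps obtained in the course of rotating the necklaces of an exploration. -/
structure IsRotated (M N : CombMap D) (a b : D) (γ : List D) (k : ℕ) : Prop where
  isSphere : N.IsSphere
  isExploration : N.IsExploration a b γ
  face_eq : N.face = M.face
  nextBdry_eq : ∀ i < γ.length, k ≤ i →
    N.nextBdry (N.regionAt a b γ i) = M.nextBdry (M.regionAt a b γ i)
  sizes_eq : N.sizes a b γ = M.sizes a b γ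
  numSwallowed_eq : N.numSwallowed a b γ = M.numSwallowed a b γ
  necklaces_eq : N.necklaces a b γ = M.necklaces a b γ

variable {M N : CombMap D} {a b : D} {γ : List D} {k : ℕ}

/-- The rotations of `C_k` in `N` are those in `M`, so a rotation drawn from `M` may be applied to
`N`, and the one-cycle invariances accumulate. -/
theorem IsRotated.succ (h : IsRotated M N a b γ k) (hk : k < γ.length) {u : Perm D}
    (hu : u ∈ Subgroup.zpowers (M.nextBdry (M.regionAt a b γ k))) :
    IsRotated M (N.reglue u) a b γ (k + 1) := by
  rw [← h.nextBdry_eq k hk le_rfl] at hu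
  have hN := h.isSphere
  have hE := h.isExploration
  exact ⟨hN.reglue (hE.isDisk hN hk) hu, hE.reglue hN hk hu, h.face_eq,
    fun i hi hki => (hE.nextBdry_reglue hN hk hu hi (by omega)).trans
      (h.nextBdry_eq i hi (by omega)),
    (hE.sizes_reglue hN hk hu).trans h.sizes_eq,
    (hE.numSwallowed_reglue hN hk hu).trans h.numSwallowed_eq,
    (hE.necklaces_reglue hN hk hu).trans h.necklaces_eq⟩

open Classical in
theorem randomRotation_succ : M.randomRotation a b γ (k + 1) =
    haveI : Fintype (Subgroup.zpowers (M.nextBdry (M.regionAt a b γ k))) := Fintype.ofFinite _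
    (M.randomRotation a b γ k).bind fun r =>
      (PMF.uniformOfFintype (Subgroup.zpowers (M.nextBdry (M.regionAt a b γ k)))).map
        fun u : Subgroup.zpowers (M.nextBdry (M.regionAt a b γ k)) => (u : Perm D) * r := by
  rw [randomRotation]
  refine congrArg (PMF.bind _) (funext fun r => ?_)
  exact PMF.map_comp _ _ _

theorem isRotated_of_mem_support (hM : M.IsSphere) (hE : M.IsExploration a b γ)
    (hk : k ≤ γ.length) {r : Perm D} (hr : r ∈ (M.randomRotation a b γ k).support) :
    IsRotated M (M.reglue r) a b γ k := by
  induction k generalizing r with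
  | zero =>
    rw [randomRotation, PMF.support_pure, Set.mem_singleton_iff] at hr
    rw [hr, reglue_one]
    exact ⟨hM, hE, rfl, fun _ _ _ => rfl, rfl, rfl, rfl⟩
  | succ k ih =>
    rw [randomRotation_succ, PMF.mem_support_bind_iff] at hr
    obtain ⟨r', hr', hr⟩ := hr
    rw [PMF.mem_support_map_iff] at hr
    obtain ⟨u, -, rfl⟩ := hr
    rw [reglue_mul]
    exact (ih (by omega) hr').succ (by omega) u.2

/-- The rotation of the necklaces proceeds one boundary cycle at a time. -/
theorem randomRotation_succ_map (hM : M.IsSphere) (hE : M.IsExploration a b γ)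
    (hk : k < γ.length) :
    (M.randomRotation a b γ (k + 1)).map M.reglue =
      ((M.randomRotation a b γ k).map M.reglue).bind fun N =>
        rotationLaw (N.nextBdry (N.regionAt a b γ k)) N := by
  rw [PMF.bind_map, randomRotation_succ, PMF.map_bind]
  ext N
  rw [PMF.bind_apply, PMF.bind_apply]
  refine tsum_congr fun r => ?_
  by_cases hr : M.randomRotation a b γ k r = 0
  · rw [hr, zero_mul, zero_mul]
  · have h := isRotated_of_mem_support hM hE hk.le ((PMF.mem_support_iff _ _).2 hr)
    simp only [Function.comp_apply]
    rw [h.nextBdry_eq k hk le_rfl, PMF.map_comp, rotationLaw]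
    congr 2

end randomRotation

end CombMap

namespace CombMap

/-! ### Interpolation between the two explorations -/

section interpolation

variable {D : Type} [Finite D]

open Classical in
/-- The weight of a map `X` and an exploration `γ`, when the first `j` seeds are chosen uniformly
and the remaining ones by the percolation interface. -/
noncomputable def hybridWeight (𝒳 : Set (CombMap D)) (c : ENNReal) (a b : D) (γ : List D) (j : ℕ)
    (X : CombMap D) : ENNReal :=
  if X ∈ 𝒳 ∧ X.IsExploration a b γ then
    c * ((∏ i ∈ Finset.range j, ((X.bdry (X.regionAt a b γ i)).ncard : ENNReal)⁻¹) *
      ∏ i ∈ Finset.Ico j γ.length, X.stepProb a b γ i)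
  else 0

variable {𝒳 : Set (CombMap D)} {c : ENNReal} {a b : D} {γ : List D} {j : ℕ}

/-- `Z` is carried to `Y` by `u` exactly when `Z` is `Y` turned by `u⁻¹`, and both maps have the
same rotation group along `C_j`. Substituting `u⁻¹` for `u` makes the sum run over the rotations of
`Y`. -/
theorem hybridWeight_mul_rotationLaw (hsph : ∀ X ∈ 𝒳, X.IsSphere) {Y : CombMap D} (hY : Y ∈ 𝒳)
    (hYE : Y.IsExploration a b γ) (hj : j < γ.length) (Z : CombMap D)
    [Fintype (Subgroup.zpowers (Y.nextBdry (Y.regionAt a b γ j)))] [DecidableEq (CombMap D)] :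
    hybridWeight 𝒳 c a b γ j Z * rotationLaw (Z.nextBdry (Z.regionAt a b γ j)) Z Y =
      ∑ u : Subgroup.zpowers (Y.nextBdry (Y.regionAt a b γ j)),
        if Z = Y.reglue (u : Perm D) then hybridWeight 𝒳 c a b γ j Z *
          ((Y.bdry (Y.regionAt a b γ j)).ncard : ENNReal)⁻¹ else 0 := by
  by_cases hZ : Z ∈ 𝒳 ∧ Z.IsExploration a b γ
  swap
  · simp [hybridWeight, hZ]
  by_cases hν : Z.nextBdry (Z.regionAt a b γ j) = Y.nextBdry (Y.regionAt a b γ j)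
  · rw [hν, rotationLaw_apply, card_rotations (hsph Y hY) (hYE.isDisk (hsph Y hY) hj),
      Finset.mul_sum, ← Equiv.sum_comp (Equiv.inv _)]
    refine Finset.sum_congr rfl fun u _ => ?_
    rw [mul_ite, mul_zero]
    refine if_congr ?_ rfl rfl
    simp only [Equiv.inv_apply, InvMemClass.coe_inv]
    constructor
    · intro h
      have := congrArg (fun X => reglue X (u : Perm D)) h
      simpa only [← reglue_mul, mul_inv_cancel, reglue_one] using this.symm
    · intro h
      have := congrArg (fun X => reglue X (u : Perm D)⁻¹) h
      simpa only [← reglue_mul, inv_mul_cancel, reglue_one] using this.symm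
  -- If the first return maps differ, neither map is a rotation of the other and both sides vanish.
  · have h1 : rotationLaw (Z.nextBdry (Z.regionAt a b γ j)) Z Y = 0 := by
      by_contra hne
      obtain ⟨u, hu, rfl⟩ := mem_support_rotationLaw.1 ((PMF.mem_support_iff _ _).2 hne)
      exact hν (hZ.2.nextBdry_reglue (hsph Z hZ.1) hj hu hj le_rfl).symm
    rw [h1, mul_zero, Finset.sum_eq_zero]
    intro u _
    refine if_neg ?_
    rintro rfl
    exact hν (hYE.nextBdry_reglue (hsph Y hY) hj u.2 hj le_rfl)

/-- Turning along `C_j` affects only the factor of step `j`: the factors before it are cycle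
lengths, those after it depend on the inside of `C_j`. -/
theorem hybridWeight_reglue (hsph : ∀ X ∈ 𝒳, X.IsSphere)
    (hcl : ∀ X ∈ 𝒳, ∀ X' : CombMap D, X'.face = X.face → X'.IsSphere → X' ∈ 𝒳)
    {Y : CombMap D} (hY : Y ∈ 𝒳) (hYE : Y.IsExploration a b γ) (hj : j < γ.length) {u : Perm D}
    (hu : u ∈ Subgroup.zpowers (Y.nextBdry (Y.regionAt a b γ j))) :
    hybridWeight 𝒳 c a b γ j (Y.reglue u) =
      c * ((∏ i ∈ Finset.range j, ((Y.bdry (Y.regionAt a b γ i)).ncard : ENNReal)⁻¹) *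
        ∏ i ∈ Finset.Ico (j + 1) γ.length, Y.stepProb a b γ i) *
          (Y.reglue u).stepProb a b γ j := by
  have hM := hsph Y hY
  have hmem : Y.reglue u ∈ 𝒳 := hcl Y hY _ rfl (hM.reglue (hYE.isDisk hM hj) hu)
  rw [hybridWeight, if_pos ⟨hmem, hYE.reglue hM hj hu⟩,
    Finset.prod_congr rfl fun i hi => by
      rw [hYE.ncard_bdry_reglue hM hj hu ((Finset.mem_range.1 hi).trans hj)],
    Finset.prod_eq_prod_Ico_succ_bot hj,
    Finset.prod_congr (s₁ := Finset.Ico (j + 1) γ.length) rfl fun i hi =>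
      hYE.stepProb_reglue hM hj hu (Finset.mem_Ico.1 hi).2 (Finset.mem_Ico.1 hi).1]
  ring

/-- Rotating along the boundary cycle `C_j` makes the choice of the seed number `j` uniform. -/
theorem tsum_hybridWeight_mul_rotationLaw (hsph : ∀ X ∈ 𝒳, X.IsSphere)
    (hcl : ∀ X ∈ 𝒳, ∀ X' : CombMap D, X'.face = X.face → X'.IsSphere → X' ∈ 𝒳)
    (hj : j < γ.length) (Y : CombMap D) :
    ∑' Z, hybridWeight 𝒳 c a b γ j Z * rotationLaw (Z.nextBdry (Z.regionAt a b γ j)) Z Y =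
      hybridWeight 𝒳 c a b γ (j + 1) Y := by
  classical
  by_cases hY : Y ∈ 𝒳 ∧ Y.IsExploration a b γ
  · have hM := hsph Y hY.1
    let _ : Fintype (Subgroup.zpowers (Y.nextBdry (Y.regionAt a b γ j))) := Fintype.ofFinite _
    rw [tsum_congr fun Z => hybridWeight_mul_rotationLaw hsph hY.1 hY.2 hj Z,
      Summable.tsum_finsetSum fun _ _ => ENNReal.summable]
    simp only [tsum_ite_eq]
    rw [Finset.sum_congr rfl fun u _ => by
        rw [hybridWeight_reglue hsph hcl hY.1 hY.2 hj u.2], ← Finset.sum_mul, ← Finset.mul_sum,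
      hY.2.sum_stepProb_reglue hM hj, hybridWeight, if_pos hY, Finset.prod_range_succ]
    ring
  · rw [hybridWeight, if_neg hY, ENNReal.tsum_eq_zero]
    intro Z
    by_contra hne
    obtain ⟨h1, h2⟩ := mul_ne_zero_iff.1 hne
    have hZ : Z ∈ 𝒳 ∧ Z.IsExploration a b γ := by
      by_contra hZ
      exact h1 (if_neg hZ)
    obtain ⟨u, hu, rfl⟩ := mem_support_rotationLaw.1 ((PMF.mem_support_iff _ _).2 h2)
    have hM := hsph Z hZ.1
    exact hY ⟨hcl Z hZ.1 _ rfl (hM.reglue (hZ.2.isDisk hM hj) hu), hZ.2.reglue hM hj hu⟩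

/-- Iterates the one-cycle step; at `j = γ.length` the percolation weight has become the Eden
weight. -/
theorem tsum_hybridWeight_mul_randomRotation (hsph : ∀ X ∈ 𝒳, X.IsSphere)
    (hcl : ∀ X ∈ 𝒳, ∀ X' : CombMap D, X'.face = X.face → X'.IsSphere → X' ∈ 𝒳)
    (hj : j ≤ γ.length) (Y : CombMap D) :
    ∑' X, hybridWeight 𝒳 c a b γ 0 X * ((X.randomRotation a b γ j).map X.reglue) Y =
      hybridWeight 𝒳 c a b γ j Y := by
  induction j generalizing Y with
  | zero =>
    classical
    simp only [randomRotation, PMF.pure_map, reglue_one, PMF.pure_apply, mul_ite, mul_one, mul_zero]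
    exact (tsum_congr fun X => if_congr eq_comm rfl rfl).trans (tsum_ite_eq Y _)
  | succ j ih =>
    have h1 : ∀ X : CombMap D,
        hybridWeight 𝒳 c a b γ 0 X * ((X.randomRotation a b γ (j + 1)).map X.reglue) Y =
        ∑' Z, hybridWeight 𝒳 c a b γ 0 X * ((X.randomRotation a b γ j).map X.reglue) Z *
          rotationLaw (Z.nextBdry (Z.regionAt a b γ j)) Z Y := by
      intro X
      by_cases hX : X ∈ 𝒳 ∧ X.IsExploration a b γ
      · rw [randomRotation_succ_map (hsph X hX.1) hX.2 hj, PMF.bind_apply, ← ENNReal.tsum_mul_left]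
        exact tsum_congr fun Z => (mul_assoc _ _ _).symm
      · simp [hybridWeight, hX]
    rw [tsum_congr h1, ENNReal.tsum_comm,
      tsum_congr fun Z => by rw [ENNReal.tsum_mul_right, ih (by omega) Z]]
    exact tsum_hybridWeight_mul_rotationLaw hsph hcl hj Y

end interpolation

end CombMap

/-! ### The two laws -/

section laws

open CombMap

variable {n : ℕ}

/-- As `fat` is injective, at most one marked triangulation contributes to the weight of `X`. -/
theorem bind_uniformLaw_apply (hn : 2 < n) (κ : MarkedTriangulation n → PMF (List (FatDart n)))
    (X : CombMap (FatDart n)) (γ : List (FatDart n)) {w : ENNReal} {P : Prop} [Decidable P]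
    (hP : ∀ ω, ω.fat = X → κ ω γ = if P then w else 0)
    [Decidable (X ∈ Set.range (MarkedTriangulation.fat (n := n)) ∧ P)] :
    ((uniformLaw n hn).bind fun ω => (κ ω).map fun γ => (ω.fat, γ)) (X, γ) =
      if X ∈ Set.range (MarkedTriangulation.fat (n := n)) ∧ P then
        (Nat.card (MarkedTriangulation n) : ENNReal)⁻¹ * w else 0 := by
  classical
  have hmap : ∀ ω : MarkedTriangulation n, ((κ ω).map fun γ => (ω.fat, γ)) (X, γ) =
      if ω.fat = X then κ ω γ else 0 := by
    intro ω
    rw [PMF.map_apply]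
    by_cases h : ω.fat = X
    · subst h
      simp
    · rw [if_neg h, ENNReal.tsum_eq_zero]
      intro δ
      exact if_neg fun e => h (congrArg Prod.fst e).symm
  rw [PMF.bind_apply]
  simp only [hmap]
  by_cases hX : X ∈ Set.range (MarkedTriangulation.fat (n := n))
  · obtain ⟨ω, hω⟩ := hX
    rw [tsum_eq_single ω, if_pos hω, hP ω hω]
    · rw [mul_ite, mul_zero]
      refine if_congr (by simp [← hω]) ?_ rfl
      let _ : Fintype (MarkedTriangulation n) := Fintype.ofFinite _
      have : Nonempty (MarkedTriangulation n) := ⟨ω⟩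
      rw [Nat.card_eq_fintype_card]
      exact congrArg (· * w) (PMF.uniformOfFintype_apply ω)
    · intro ω' h
      rw [if_neg fun e => h (MarkedTriangulation.fat_injective (e.trans hω.symm)), mul_zero]
  · rw [if_neg fun h => hX h.1, ENNReal.tsum_eq_zero]
    intro ω
    rw [if_neg fun e => hX ⟨ω, e⟩, mul_zero]

/-- The weight at level `j` between the percolation exploration (level `0`) and the Eden
exploration (level `γ.length`). -/
noncomputable def fatWeight (n : ℕ) (γ : List (FatDart n)) (j : ℕ) :
    CombMap (FatDart n) → ENNReal :=
  hybridWeight (Set.range MarkedTriangulation.fat) (Nat.card (MarkedTriangulation n) : ENNReal)⁻¹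
    (source n) (target n) γ j

theorem percolationLaw_apply (hn : 2 < n) {p : MarkedTriangulation n → List (FatDart n)}
    (hp : ∀ ω : MarkedTriangulation n, ω.fat.IsDualPath (source n) (target n) (p ω))
    (X : CombMap (FatDart n)) (γ : List (FatDart n)) :
    percolationLaw n hn p (X, γ) = fatWeight n γ 0 X := by
  classical
  rw [fatWeight, hybridWeight, Finset.range_zero, Finset.prod_empty, one_mul,
    Nat.Ico_zero_eq_range, percolationLaw]
  refine bind_uniformLaw_apply hn _ X γ fun ω hω => ?_
  subst hω
  rw [percolation_apply ω.fat_isSphere ω.fat_hasDigons (hp ω)]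

theorem edenLaw_apply (hn : 2 < n) (X : CombMap (FatDart n)) (γ : List (FatDart n)) :
    edenLaw n hn (X, γ) = fatWeight n γ γ.length X := by
  classical
  rw [fatWeight, hybridWeight, Finset.Ico_self, Finset.prod_empty, mul_one, edenLaw]
  refine bind_uniformLaw_apply hn _ X γ fun ω hω => ?_
  subst hω
  rw [eden_apply ω.fat_isSphere ω.fat_hasDigons.source_ne]

/-- The two laws are the extreme cases of `fatWeight`. Rotations keep `γ`, so the identity is
checked for each `γ` separately, summing over maps only. -/
theorem edenLaw_eq_bind_rotateNecklaces (hn : 2 < n)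
    {p : MarkedTriangulation n → List (FatDart n)}
    (hp : ∀ ω : MarkedTriangulation n, ω.fat.IsDualPath (source n) (target n) (p ω)) :
    edenLaw n hn = (percolationLaw n hn p).bind fun X =>
      (X.1.rotateNecklaces (source n) (target n) X.2).map fun Y => (Y, X.2) := by
  classical
  have hsph : ∀ X ∈ Set.range (MarkedTriangulation.fat (n := n)), X.IsSphere := by
    rintro _ ⟨ω, rfl⟩
    exact ω.fat_isSphere
  ext ⟨Y, γ⟩
  have hmap : ∀ (X : CombMap (FatDart n)) (δ : List (FatDart n)),
      ((X.rotateNecklaces (source n) (target n) δ).map fun Y => (Y, δ)) (Y, γ) =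
        if δ = γ then X.rotateNecklaces (source n) (target n) γ Y else 0 := by
    intro X δ
    rw [PMF.map_apply]
    by_cases h : δ = γ
    · subst h
      simp
    · rw [if_neg h, ENNReal.tsum_eq_zero]
      intro Z
      exact if_neg fun e => h (congrArg Prod.snd e).symm
  rw [edenLaw_apply, PMF.bind_apply, ENNReal.tsum_prod', fatWeight,
    ← tsum_hybridWeight_mul_randomRotation hsph
      (fun X hX X' h1 h2 => MarkedTriangulation.mem_range_fat_of_face_eq hn hX h1 h2) le_rfl]
  refine tsum_congr fun X => ?_
  simp only [hmap, mul_ite, mul_zero]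
  rw [tsum_ite_eq, percolationLaw_apply hn hp]
  rfl

/-- A statistic which is not affected by rotations has the same law for both explorations. -/
theorem map_edenLaw_eq (hn : 2 < n) {p : MarkedTriangulation n → List (FatDart n)}
    (hp : ∀ ω : MarkedTriangulation n, ω.fat.IsDualPath (source n) (target n) (p ω))
    {α : Type*} (F : CombMap (FatDart n) → List (FatDart n) → α)
    (hF : ∀ X Y γ k, IsRotated X Y (source n) (target n) γ k → F Y γ = F X γ) :
    (edenLaw n hn).map (fun X => F X.1 X.2) =
      (percolationLaw n hn p).map (fun X => F X.1 X.2) := by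
  rw [edenLaw_eq_bind_rotateNecklaces hn hp, PMF.map_bind]
  conv_rhs => rw [← PMF.bind_pure_comp]
  ext x
  rw [PMF.bind_apply, PMF.bind_apply]
  refine tsum_congr fun ⟨X, γ⟩ => ?_
  by_cases h0 : percolationLaw n hn p (X, γ) = 0
  · rw [h0, zero_mul, zero_mul]
  rw [percolationLaw_apply hn hp] at h0
  have hX : X ∈ Set.range (MarkedTriangulation.fat (n := n)) ∧
      X.IsExploration (source n) (target n) γ := by
    by_contra hX
    exact h0 (if_neg hX)
  obtain ⟨⟨ω, rfl⟩, hE⟩ := hX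
  congr 1
  -- Every rotation in the support gives the same value of `F`, so the conditional law given `(X,
  -- γ)` is a point mass.
  rw [rotateNecklaces, PMF.map_comp, PMF.map_comp]
  rw [← PMF.bind_pure_comp, Function.comp_apply,
    ← PMF.bind_const ((ω.fat).randomRotation (source n) (target n) γ γ.length)
      (PMF.pure (F ω.fat γ)), PMF.bind_apply, PMF.bind_apply]
  refine tsum_congr fun r => ?_
  by_cases hr : ω.fat.randomRotation (source n) (target n) γ γ.length r = 0
  · rw [hr, zero_mul, zero_mul]
  · have h := isRotated_of_mem_support ω.fat_isSphere hE le_rfl ((PMF.mem_support_iff _ _).2 hr)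
    simp only [Function.comp_apply]
    rw [hF _ _ _ _ h]

end laws
theorem proposition2p2 (n : ℕ) (hn : 2 < n) :
    -- the numbers of triangles and of edges
    (∀ (D : Type) [Finite D] (T : CombMap D), T.IsSphereTriangulation → Nat.card T.Vertex = n →
      Nat.card T.Face = 2 * (n - 2) ∧ Nat.card T.Edge = 3 * (n - 2) ∧
        Nat.card D = 6 * (n - 2)) ∧
    -- for every choice of the reference paths `p`
    ∀ p : MarkedTriangulation n → List (FatDart n),
      (∀ ω : MarkedTriangulation n, ω.fat.IsDualPath (source n) (target n) (p ω)) →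
      -- the percolation interface is well defined
      (∀ (ω : MarkedTriangulation n) (c : ω.fat.Vertex → Bool),
        ∃! γ, ω.fat.IsInterface (source n) (target n) γ (p ω) c) ∧
      -- the law of the chain `(M_k, N_k)`
      (edenLaw n hn).map (fun X => X.1.sizes (source n) (target n) X.2) =
        (percolationLaw n hn p).map (fun X => X.1.sizes (source n) (target n) X.2) ∧
      -- the law of the number of triangles explored before the target is reached
      (edenLaw n hn).map (fun X => CombMap.numExplored X.2) =
        (percolationLaw n hn p).map (fun X => CombMap.numExplored X.2) ∧
      -- the law of the number of triangles explored or enclosed in bubbles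
      (edenLaw n hn).map (fun X => X.1.numSwallowed (source n) (target n) X.2) =
        (percolationLaw n hn p).map (fun X => X.1.numSwallowed (source n) (target n) X.2) ∧
      -- the law of the sequence of necklaces
      (edenLaw n hn).map (fun X => X.1.necklaces (source n) (target n) X.2) =
        (percolationLaw n hn p).map (fun X => X.1.necklaces (source n) (target n) X.2) ∧
      -- the Eden exploration is the percolation exploration with randomly rotated necklaces
      edenLaw n hn =
        (percolationLaw n hn p).bind fun X =>
          (X.1.rotateNecklaces (source n) (target n) X.2).map fun Y => (Y, X.2) := by
  refine ⟨fun D _ T hT hV => hT.card_eq hn hV, fun p hp => ⟨fun ω c => ?_, ?_, ?_, ?_, ?_, ?_⟩⟩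
  · exact CombMap.existsUnique_isInterface ω.fat_isSphere.edge_ne ω.fat_isSphere.edge_edge
      ω.fat_hasDigons (hp ω) c
  · exact map_edenLaw_eq hn hp (fun X γ => X.sizes (source n) (target n) γ)
      fun X Y γ k h => h.sizes_eq
  · exact map_edenLaw_eq hn hp (fun _ γ => CombMap.numExplored γ) fun X Y γ k h => rfl
  · exact map_edenLaw_eq hn hp (fun X γ => X.numSwallowed (source n) (target n) γ)
      fun X Y γ k h => h.numSwallowed_eq
  · exact map_edenLaw_eq hn hp (fun X γ => X.necklaces (source n) (target n) γ)
      fun X Y γ k h => h.necklaces_eq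
  · exact edenLaw_eq_bind_rotateNecklaces hn hp
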